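/- **Setting.** Let $d\ge 1$. Write $|x|$ for the Euclidean norm. For $f:\mathbb Z^d\to\mathbb R$ let $f^{(\mu)}(x)=f(x)e^{\mu\cdot x}$ ($\mu\in\mathbb R^d$) be its exponential tilt, $\hat f(k)=\sum_{x\in\mathbb Z^d}f(x)e^{-ik\cdot x}$ its Fourier transform, and $\|f\|_p$ its $\ell^p(\mathbb Z^d)$ norm. Call $f$ *symmetric* if $f(x)$ is unchanged when a component of $x$ changes sign or the components are permuted. Put $a\wedge b=\min\{a,b\}$. For $M,K,\zeta>0$ let $\mathcal Q_{M,K,\zeta}$ be the set of pairs $(Q,g)$ of functions $\mathbb Z^d\to\mathbb R$ such that $$\|Q\|_1,\ \big\||y|^{2+\zeta}Q(y)\big\|_1\le M,\qquad \operatorname{Re}[\hat Q(0)-\hat Q(k)]\ge K|k|^2\quad(k\in[-\pi,\pi]^d),$$ $$\|g\|_1,\ \big\||y|^{\zeta}g(y)\big\|_1,\ \big\||y|^2g(y)\big\|_{p_d\wedge2}\le M,$$ where $p_1=2$ and $p_d=\frac{d}{d-2+(\zeta\wedge2)}$ for $d\ge2$, and, if $d\ge4$, also $\big\||y|^{d-1}Q(y)\big\|_{\frac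 d3\wedge2},\ \big\||y|^{d-1}g(y)\big\|_2\le M$. **Hypotheses on $(S,J,h)$.** (A) $S:\mathbb Z^d\to[0,\infty)$ is symmetric, the set $\Omega=\{\mu\in\mathbb R^d:\sum_xS^{(\mu)}(x)<\infty\}$ is open and contains $0$, and $\mu_1e_1\notin\Omega$ for some $\mu_1>0$. (B) $J,h\in\ell^1(\mathbb Z^d)$ are real-valued and symmetric, $S=h+J*S$, and for every $\mu\in\overline\Omega$ one has $(J^{(\mu)},h^{(\mu)})\in\mathcal Q_{M,K,\zeta}$ (with the same $M,K,\zeta$ for all $\mu$) and $\hat h^{(\mu)}(0)>0$. **Notation.** Let $m_S=\sup\{t\ge0:te_1\in\Omega\}$. For $x\ne0$ let $\hat x=x/|x|$ and let $\mu_{\hat x}\in\partial\Omega$ be the vector with $\mu_{\hat x}\cdot x=\max_{\mu\in\overline\Omega}\mu\cdot x$; put $|x|_S=\mu_{\hat x}\cdot x/m_S$ and $$\eta_{\hat x,j}=\sum_yy_jJ^{(\mu_{\hat x})}(y),\qquad \Lambda_{\hat x,jl}=\sum_yy_jy_lJ^{(\mu_{\hat x})}(y).$$ The Green function of Brownian motion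 with drift $\eta$ and covariance $\Lambda$ is $$C(x;\eta,\Lambda)=\int_0^\infty\frac{1}{\sqrt{\det\Lambda}\,(2\pi t)^{d/2}}\exp\Big\{-\frac1{2t}(x-t\eta)\cdot\Lambda^{-1}(x-t\eta)\Big\}\,dt.$$ **Theorem (Crossover Theorem).** Let $d\ge1$ and $M,K,\zeta>0$. (i) If $(S,J,h)$ satisfies (A) and (B), then $m_S$ is finite and positive, and for every nonzero $x\in\mathbb R^d$ the vector $\mu_{\hat x}$ exists and is unique, $\Lambda_{\hat x}$ is positive definite, and the integral $C(x;\eta_{\hat x},\Lambda_{\hat x})$ converges. (ii) There is $\varepsilon>0$, depending only on $d,\zeta,M,K$, with the following properties. * If $d>2$, there are constants $A,R$ depending only on $d,\zeta,M,K$ such that, for all $(S,J,h)$ satisfying (A) and (B) and all nonzero $x\in\mathbb Z^d$ with $|x|\ge R$, $$S(x)=C(x;\eta_{\hat x},\Lambda_{\hat x})\,e^{-m_S|x|_S}\big[\hat h^{(\mu_{\hat x})}(0)+r(x)\big],\qquad |r(x)|\le\frac{A}{|x|^{\varepsilon}}.$$ * If $d\le2$, then for every $s_0>0$ there are constants $A,R$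 depending only on $d,\zeta,M,K,s_0$ such that the same formula and bound hold for all $(S,J,h)$ satisfying (A) and (B) and all nonzero $x\in\mathbb Z^d$ with $|x|\ge R$ and $m_S|x|\ge s_0$. -/

import Mathlib

open MeasureTheory Set

noncomputable section

namespace OrnsteinZernike

/-- The integer lattice `ℤ^d`. -/
abbrev Lat (d : ℕ) : Type := Fin d → ℤ

/-- `ℝ^d` with its Euclidean norm. -/
abbrev Euc (d : ℕ) : Type := EuclideanSpace ℝ (Fin d)

/-- The inclusion of `ℤ^d` in `ℝ^d`; thus `‖emb y‖` is the Euclidean norm `|y|`. -/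
def emb {d : ℕ} (y : Lat d) : Euc d := WithLp.toLp 2 fun i => (y i : ℝ)

/-- `ℤ^d`-symmetry: invariance under a sign change of one coordinate and under permutations of
the coordinates. -/
def LatSymmetric {d : ℕ} (f : Lat d → ℝ) : Prop :=
  (∀ (x : Lat d) (i : Fin d), f (Function.update x i (-x i)) = f x) ∧
    ∀ (x : Lat d) (σ : Equiv.Perm (Fin d)), f (x ∘ σ) = f x

/-- The exponential tilt `f^{(μ)}(x) = f(x) e^{μ·x}`. -/
def tilt {d : ℕ} (f : Lat d → ℝ) (μ : Euc d) (x : Lat d) : ℝ :=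
  f x * Real.exp (inner ℝ μ (emb x))

/-- The Fourier transform `f̂(k) = ∑_x f(x) e^{-ik·x}`. -/
def latFourier {d : ℕ} (f : Lat d → ℝ) (k : Euc d) : ℂ :=
  ∑' x : Lat d, (f x : ℂ) * Complex.exp (-Complex.I * ((inner ℝ k (emb x) : ℝ) : ℂ))

/-- `f̂(0)` is the real number `∑_x f(x)`. -/
theorem latFourier_zero {d : ℕ} (f : Lat d → ℝ) :
    latFourier f 0 = ((∑' x : Lat d, f x : ℝ) : ℂ) := by
  simp [latFourier, Complex.ofReal_tsum]

/-- The convolution `(f*g)(x) = ∑_y f(x-y) g(y)`. -/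
def latConv {d : ℕ} (f g : Lat d → ℝ) (x : Lat d) : ℝ :=
  ∑' y : Lat d, f (x - y) * g y

/-- The `ℓ^p(ℤ^d)` norm, with value `∞` when `f` is not in `ℓ^p`; `p` is a positive real. -/
def latNorm {d : ℕ} (p : ℝ) (f : Lat d → ℝ) : ENNReal :=
  eLpNorm f (ENNReal.ofReal p) Measure.count

/-- `Ω`, the set of tilts `μ` at which the tilted susceptibility `∑_x S^{(μ)}(x)` of the
nonnegative function `S` is finite. Its closure is the Wulff shape. -/
def Omega {d : ℕ} (S : Lat d → ℝ) : Set (Euc d) :=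
  {μ | Summable (tilt S μ)}

/-- The vector `t e₁`. -/
def axis {d : ℕ} [NeZero d] (t : ℝ) : Euc d := EuclideanSpace.single (0 : Fin d) t

/-- The set whose supremum is the mass. -/
def massSet {d : ℕ} [NeZero d] (S : Lat d → ℝ) : Set ℝ :=
  {t | 0 ≤ t ∧ axis t ∈ Omega S}

/-- The mass `m_S = sup {t ≥ 0 : χ^{(t e₁)} < ∞}`. -/
def mass {d : ℕ} [NeZero d] (S : Lat d → ℝ) : ℝ := sSup (massSet S)

/-- Averaged exponential decay. -/
structure AveragedDecay {d : ℕ} [NeZero d] (S : Lat d → ℝ) : Prop where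
  nonneg : ∀ x, 0 ≤ S x
  symm : LatSymmetric S
  isOpen : IsOpen (Omega S)
  zero_mem : (0 : Euc d) ∈ Omega S
  exists_notMem : ∃ μ₁ : ℝ, 0 < μ₁ ∧ axis μ₁ ∉ Omega S

/-- The exponent `p_d`. -/
def pExp (d : ℕ) (ζ : ℝ) : ℝ :=
  if d = 1 then 2 else (d : ℝ) / ((d : ℝ) - 2 + min ζ 2)

/-- The class `𝒬_{M,K,ζ}` of pairs `(Q, g)`. In the infrared bound, the torus is represented by
the cube `[-π, π]^d`. -/
structure InQ {d : ℕ} (M K ζ : ℝ) (Q g : Lat d → ℝ) : Prop where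
  Q_l1 : latNorm 1 Q ≤ ENNReal.ofReal M
  Q_moment : latNorm 1 (fun y => ‖emb y‖ ^ (2 + ζ) * Q y) ≤ ENNReal.ofReal M
  infrared : ∀ k : Euc d, (∀ i, k i ∈ Icc (-Real.pi) Real.pi) →
    K * ‖k‖ ^ 2 ≤ (latFourier Q 0 - latFourier Q k).re
  g_l1 : latNorm 1 g ≤ ENNReal.ofReal M
  g_moment : latNorm 1 (fun y => ‖emb y‖ ^ ζ * g y) ≤ ENNReal.ofReal M
  g_second : latNorm (min (pExp d ζ) 2) (fun y => ‖emb y‖ ^ 2 * g y) ≤ ENNReal.ofReal M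
  Q_high : 4 ≤ d →
    latNorm (min ((d : ℝ) / 3) 2) (fun y => ‖emb y‖ ^ (d - 1) * Q y) ≤ ENNReal.ofReal M
  g_high : 4 ≤ d → latNorm 2 (fun y => ‖emb y‖ ^ (d - 1) * g y) ≤ ENNReal.ofReal M

/-- `S` solves the generalised Ornstein–Zernike equation `S = h + J * S`, and the tilts
`(J^{(μ)}, h^{(μ)})` obey the moment and infrared bounds uniformly over the Wulff shape. -/
structure OZBounds {d : ℕ} (M K ζ : ℝ) (S J h : Lat d → ℝ) : Prop where
  oz : ∀ x, S x = h x + latConv J S x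
  J_symm : LatSymmetric J
  h_symm : LatSymmetric h
  J_summable : Summable J
  h_summable : Summable h
  mem_Q : ∀ μ ∈ closure (Omega S), InQ M K ζ (tilt J μ) (tilt h μ)
  h_pos : ∀ μ ∈ closure (Omega S), 0 < (latFourier (tilt h μ) 0).re

/-- `μ ∈ ∂Ω` attains the maximum of `ν·x` over `ν` in the Wulff shape. -/
def IsOptimalTilt {d : ℕ} (S : Lat d → ℝ) (x μ : Euc d) : Prop :=
  μ ∈ frontier (Omega S) ∧ IsMaxOn (fun ν : Euc d => inner ℝ ν x) (closure (Omega S)) μ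

/-- The optimal tilt `μ_x̂`; its existence and uniqueness for `x ≠ 0` are part of the claim. -/
def optimalTilt {d : ℕ} (S : Lat d → ℝ) (x : Euc d) : Euc d :=
  Classical.epsilon (IsOptimalTilt S x)

open Classical in
/-- The norm `|x|_S`: zero at `0`, and `μ_x̂·x / m_S` elsewhere. -/
def normS {d : ℕ} [NeZero d] (S : Lat d → ℝ) (x : Euc d) : ℝ :=
  if x = 0 then 0 else inner ℝ (optimalTilt S x) x / mass S

/-- First moments `η_j = ∑_y y_j Q(y)`. -/
def drift {d : ℕ} (Q : Lat d → ℝ) : Euc d :=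
  WithLp.toLp 2 fun j => ∑' y : Lat d, (y j : ℝ) * Q y

/-- Second moments `Λ_{jl} = ∑_y y_j y_l Q(y)`. -/
def covMatrix {d : ℕ} (Q : Lat d → ℝ) : Matrix (Fin d) (Fin d) ℝ :=
  Matrix.of fun j l => ∑' y : Lat d, (y j : ℝ) * (y l : ℝ) * Q y

/-- Heat kernel `ρ_t(x; η, Λ)` of Brownian motion with drift `η` and covariance `Λ`. -/
def heatKernel {d : ℕ} (t : ℝ) (x η : Euc d) (Λ : Matrix (Fin d) (Fin d) ℝ) : ℝ :=
  1 / Real.sqrt Λ.det * (1 / (2 * Real.pi * t) ^ ((d : ℝ) / 2)) *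
    Real.exp (-(1 / (2 * t)) *
      ((x - t • η).ofLp ⬝ᵥ (Matrix.mulVec Λ⁻¹ (x - t • η).ofLp)))

/-- Green function `C(x; η, Λ) = ∫_0^∞ ρ_t(x; η, Λ) dt`. -/
def brownianGreen {d : ℕ} (x η : Euc d) (Λ : Matrix (Fin d) (Fin d) ℝ) : ℝ :=
  ∫ t in Ioi (0 : ℝ), heatKernel t x η Λ

/-- `η_x̂`, the drift of `J` tilted by `μ_x̂`. -/
def etaHat {d : ℕ} (S J : Lat d → ℝ) (x : Euc d) : Euc d :=
  drift (tilt J (optimalTilt S x))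

/-- `Λ_x̂`, the covariance of `J` tilted by `μ_x̂`. -/
def lambdaHat {d : ℕ} (S J : Lat d → ℝ) (x : Euc d) : Matrix (Fin d) (Fin d) ℝ :=
  covMatrix (tilt J (optimalTilt S x))

/-- The objects in the asymptotic formula are well defined: `m_S` is a genuine positive supremum,
the optimal tilt exists and is unique, `Λ_x̂` is positive definite, and the integral defining
`C(x; η_x̂, Λ_x̂)` converges. -/
structure WellDefined {d : ℕ} [NeZero d] (S J : Lat d → ℝ) : Prop where
  mass_lub : IsLUB (massSet S) (mass S)
  mass_pos : 0 < mass S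
  tilt_unique : ∀ x : Euc d, x ≠ 0 → ∃! μ, IsOptimalTilt S x μ
  lambda_posDef : ∀ x : Euc d, x ≠ 0 → (lambdaHat S J x).PosDef
  green_finite : ∀ x : Euc d, x ≠ 0 →
    IntegrableOn (fun t => heatKernel t x (etaHat S J x) (lambdaHat S J x)) (Ioi (0 : ℝ))

/-- The formula `S(x) = C(x; η_x̂, Λ_x̂) e^{-m_S|x|_S} [ĥ^{(μ_x̂)}(0) + r]` at the point `x`, with
`|r| ≤ A / |x|^ε`. -/
def CrossoverAt {d : ℕ} [NeZero d] (S J h : Lat d → ℝ) (A ε : ℝ) (x : Lat d) : Prop :=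
  ∃ r : ℝ, |r| ≤ A * (1 / ‖emb x‖ ^ ε) ∧
    S x = brownianGreen (emb x) (etaHat S J (emb x)) (lambdaHat S J (emb x)) *
      Real.exp (-(mass S * normS S (emb x))) *
        ((latFourier (tilt h (optimalTilt S (emb x))) 0).re + r)

end OrnsteinZernike

end

/-!
Let `μ` be the optimal tilt for `x`, a boundary point of `Ω`. Since `S(x) = S^{(μ)}(x) e^{-μ·x}` and
`μ·x = m_S |x|_S`, the task is to compare the tilted function `S^{(μ)}(x)` with the Green function
of Brownian motion. The Ornstein-Zernike equation is preserved by tilting, and at a boundary point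
`∑ J^{(μ)} = 1` (`tsum_J_eq_one`): otherwise the susceptibility would stay finite there. The map
`μ ↦ ∑ J^{(μ)}` is uniformly convex, because its Hessian is a covariance matrix, which the infrared
bound keeps above `2K` (`taylor_tsum_J`). So the level set `∂Ω` is strictly convex, the optimal tilt
is unique (`IsOptimalTilt.unique`), and the gradient `η` of the map is an outer normal at `μ`, hence
parallel to `x` (`IsOptimalTilt.drift_eq`), with `|η| ≥ K|μ|` (`mul_norm_le_norm_drift`).

The comparison is made in time. With `Q = J^{(μ)}` and `g = h^{(μ)}`, the tilted function is
`S^{(μ)}(x) = ∫_0^∞ q_s(x) ds`, where `q_s` has Fourier transform `ĝ e^{-s(1 - Q̂)}`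
(`integral_semiKernel_of_mem_frontier`). Inside `Ω` this is `1/(1 - Q̂) = ∫_0^∞ e^{-s(1 - Q̂)} ds`;
it survives the passage to the boundary because the drift does not vanish. As `C(x; η, Λ)` is the
time integral of Gaussian heat kernels, it suffices to compare kernels, for which there are two
bounds.

* The kernels live on the scale `√(1+s)` around `s η`, with polynomial decay of order
  `m = max(2, d-1)` beyond (`norm_semiKernel_le`). Steps shorter than `√(1+s)` tolerate an additional
  exponential tilt on the diffusive scale and give exponential decay. Longer steps are rare; they
  enter through the convolution exponential in a weighted norm that is submultiplicative
  (`wnorm_convExp_le`) and that the moment conditions bound uniformly in `s` (`wnorm_far_le`).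
* The local limit theorem: `q_s - ĝ(0) ρ_s` is at most of order `s^{-d/2 - z/2}`, where `ρ_s` is the
  heat kernel and `z = min(ζ, 1)` (`norm_semiKernel_sub_le`).

Interpolating them makes the difference at times `s ≥ |x|^{1/2}` smaller by a power of `|x|` than a
diffusive kernel with decay exponent `m - 1/2`. As `η` is parallel to `x`, the norm of `x - s η` is
`| |x| - s |η| |`, and the time integrals become one-dimensional. The one of the diffusive kernel is
comparable with that of the heat kernel (`exists_intLE_integral_gaussKernel`) if either `d ≥ 3`, or
the path passes `x` after it has become localised on the scale of its displacement, that is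
`|x| |η|` is bounded below. The latter follows from a lower bound on `m_S |x|`
(`mul_mass_mul_norm_le`) and is needed for `d ≤ 2`, where driftless Brownian motion is recurrent.
At times `s ≤ |x|^{1/2}` both kernels are negligible, since `x` is out of reach
(`exists_norm_integral_semiKernel_sub_le`). The resulting exponent is `min(ζ, 1) / (8m)`.
-/


namespace OrnsteinZernike

/-! ### Lattice sums and moments -/

section Moments

variable {d : ℕ}

@[simp] theorem emb_zero : emb (0 : Lat d) = 0 := by ext i; simp [emb]

@[simp] theorem emb_apply (y : Lat d) (i : Fin d) : emb y i = (y i : ℝ) := rfl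

theorem emb_add (x y : Lat d) : emb (x + y) = emb x + emb y := by ext i; simp

theorem emb_sub (x y : Lat d) : emb (x - y) = emb x - emb y := by ext i; simp

theorem emb_injective : Function.Injective (emb : Lat d → Euc d) := by
  intro x y h
  funext i
  have := congrArg (fun v : Euc d => v i) h
  simpa using this

theorem emb_ne_zero {y : Lat d} (hy : y ≠ 0) : emb y ≠ 0 := fun h =>
  hy (emb_injective (h.trans emb_zero.symm))

theorem abs_apply_le_norm (v : Euc d) (i : Fin d) : |v i| ≤ ‖v‖ := by
  simpa using PiLp.norm_apply_le v i

theorem one_le_norm_emb {y : Lat d} (hy : y ≠ 0) : 1 ≤ ‖emb y‖ := by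
  obtain ⟨i, hi⟩ := Function.ne_iff.mp hy
  have h1 : (1 : ℝ) ≤ |(y i : ℝ)| := by
    have := Int.one_le_abs (by simpa using hi : y i ≠ 0)
    exact_mod_cast this
  exact h1.trans (abs_apply_le_norm (emb y) i)

/-- `f` is summable with sum at most `M`. -/
def SumLE (f : Lat d → ℝ) (M : ℝ) : Prop := Summable f ∧ ∑' y, f y ≤ M

theorem SumLE.mono {f g : Lat d → ℝ} {M : ℝ} (hg : SumLE g M) (hf : ∀ y, 0 ≤ f y)
    (hfg : ∀ y, f y ≤ g y) : SumLE f M := by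
  have hs : Summable f := Summable.of_nonneg_of_le hf hfg hg.1
  exact ⟨hs, (hs.tsum_le_tsum hfg hg.1).trans hg.2⟩

theorem lintegral_count_lat (f : Lat d → ENNReal) : ∫⁻ y, f y ∂Measure.count = ∑' y, f y :=
  lintegral_count f

theorem sumLE_of_tsum_le {f : Lat d → ℝ} (hf : ∀ y, 0 ≤ f y) {M : ℝ} (hM : 0 ≤ M)
    (h : ∑' y, ENNReal.ofReal (f y) ≤ ENNReal.ofReal M) : SumLE f M := by
  have hs : Summable f := by
    have h1 : ∑' y, ENNReal.ofReal (f y) ≠ ⊤ := (h.trans_lt ENNReal.ofReal_lt_top).ne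
    have := ENNReal.summable_toReal h1
    refine this.congr fun y => ENNReal.toReal_ofReal (hf y)
  refine ⟨hs, ?_⟩
  rw [← ENNReal.ofReal_tsum_of_nonneg hf hs] at h
  exact (ENNReal.ofReal_le_ofReal_iff hM).1 h

theorem sumLE_of_latNorm {f : Lat d → ℝ} {p M : ℝ} (hp : 0 < p) (hM : 0 ≤ M)
    (h : latNorm p f ≤ ENNReal.ofReal M) : SumLE (fun y => |f y| ^ p) (M ^ p) := by
  refine sumLE_of_tsum_le (fun y => by positivity) (by positivity) ?_
  have hp0 : ENNReal.ofReal p ≠ 0 := by simpa using hp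
  rw [latNorm, eLpNorm_eq_lintegral_rpow_enorm_toReal hp0 ENNReal.ofReal_ne_top,
    ENNReal.toReal_ofReal hp.le, lintegral_count_lat] at h
  have h2 := ENNReal.rpow_le_rpow h hp.le
  rw [← ENNReal.rpow_mul, one_div_mul_cancel hp.ne', ENNReal.rpow_one,
    ENNReal.ofReal_rpow_of_nonneg hM hp.le] at h2
  refine le_trans (ENNReal.tsum_le_tsum fun y => ?_) h2
  rw [← ENNReal.ofReal_rpow_of_nonneg (abs_nonneg _) hp.le, ← Real.enorm_eq_ofReal_abs]

theorem sumLE_of_latNorm_one {f : Lat d → ℝ} {M : ℝ} (hM : 0 ≤ M)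
    (h : latNorm 1 f ≤ ENNReal.ofReal M) : SumLE (fun y => |f y|) M := by
  simpa using sumLE_of_latNorm one_pos hM h

/-- For exponents `p ≤ q` the `ℓ^q` norm is at most the `ℓ^p` norm; here `q = 2`. -/
theorem sumLE_sq_of_latNorm {f : Lat d → ℝ} {p M : ℝ} (hp : 0 < p) (hp2 : p ≤ 2) (hM : 0 < M)
    (h : latNorm p f ≤ ENNReal.ofReal M) : SumLE (fun y => |f y| ^ 2) (M ^ 2) := by
  have h1 := sumLE_of_latNorm hp hM.le h
  have h2 : ∀ y, |f y| ≤ M := by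
    intro y
    have h3 : |f y| ^ p ≤ M ^ p :=
      (h1.1.le_tsum y (fun z _ => by positivity)).trans h1.2
    exact (Real.rpow_le_rpow_iff (abs_nonneg _) hM.le hp).1 h3
  have h4 : ∀ y, |f y| ^ 2 ≤ M ^ (2 - p) * |f y| ^ p := by
    intro y
    rcases (abs_nonneg (f y)).eq_or_lt with h0 | h0
    · rw [← h0]; simp [Real.zero_rpow hp.ne']
    · calc |f y| ^ 2 = |f y| ^ (2 - p) * |f y| ^ p := by
            rw [← Real.rpow_add h0]; norm_num
        _ ≤ _ := by
            gcongr
            exact h2 y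
  refine SumLE.mono (g := fun y => M ^ (2 - p) * |f y| ^ p) ⟨h1.1.mul_left _, ?_⟩
    (fun y => by positivity) h4
  rw [tsum_mul_left]
  calc _ ≤ M ^ (2 - p) * M ^ p := by gcongr; exact h1.2
    _ = M ^ 2 := by rw [← Real.rpow_add hM]; norm_num

/-- Summability of `|y|^a |f(y)|` is monotone in `a`, as `|y| ≥ 1` for `y ≠ 0`. -/
theorem SumLE.moment_mono {f : Lat d → ℝ} {a b M : ℝ} (ha : 0 < a) (hab : a ≤ b)
    (h : SumLE (fun y => ‖emb y‖ ^ b * |f y|) M) : SumLE (fun y => ‖emb y‖ ^ a * |f y|) M := by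
  refine h.mono (fun y => by positivity) fun y => ?_
  gcongr ?_ * _
  rcases eq_or_ne y 0 with rfl | hy
  · simp [Real.zero_rpow ha.ne', Real.zero_rpow (ha.trans_le hab).ne']
  · exact Real.rpow_le_rpow_of_exponent_le (one_le_norm_emb hy) hab

section InQ

variable {M K ζ : ℝ} {Q g : Lat d → ℝ}

theorem InQ.sum_Q (h : InQ M K ζ Q g) (hM : 0 < M) : SumLE (fun y => |Q y|) M :=
  sumLE_of_latNorm_one hM.le h.Q_l1

theorem InQ.sum_g (h : InQ M K ζ Q g) (hM : 0 < M) : SumLE (fun y => |g y|) M :=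
  sumLE_of_latNorm_one hM.le h.g_l1

theorem InQ.sum_rpow_Q (h : InQ M K ζ Q g) (hM : 0 < M) {a : ℝ} (ha : 0 < a) (ha' : a ≤ 2 + ζ) :
    SumLE (fun y => ‖emb y‖ ^ a * |Q y|) M := by
  have h1 := sumLE_of_latNorm_one hM.le h.Q_moment
  refine SumLE.moment_mono ha ha' ?_
  simpa only [abs_mul, abs_of_nonneg (Real.rpow_nonneg (norm_nonneg _) _)] using h1

theorem InQ.sum_rpow_g (h : InQ M K ζ Q g) (hM : 0 < M) {a : ℝ} (ha : 0 < a) (ha' : a ≤ ζ) :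
    SumLE (fun y => ‖emb y‖ ^ a * |g y|) M := by
  have h1 := sumLE_of_latNorm_one hM.le h.g_moment
  refine SumLE.moment_mono ha ha' ?_
  simpa only [abs_mul, abs_of_nonneg (Real.rpow_nonneg (norm_nonneg _) _)] using h1

theorem InQ.sum_sq_Q (h : InQ M K ζ Q g) (hM : 0 < M) (hζ : 0 < ζ) :
    SumLE (fun y => ‖emb y‖ ^ 2 * |Q y|) M := by
  have := h.sum_rpow_Q hM (a := 2) (by norm_num) (by linarith)
  simpa using this

theorem InQ.sum_norm_Q (h : InQ M K ζ Q g) (hM : 0 < M) (hζ : 0 < ζ) :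
    SumLE (fun y => ‖emb y‖ * |Q y|) M := by
  have := h.sum_rpow_Q hM (a := 1) (by norm_num) (by linarith)
  simpa using this

/-- The number `max(2, d-1)` of moments of the steps and of the source that are controlled. It is
the power at which the kernels decay on the diffusive scale. -/
def decayExp (d : ℕ) : ℕ := max 2 (d - 1)

theorem two_le_decayExp (d : ℕ) : 2 ≤ decayExp d := le_max_left _ _

/-- The source has `max(2, d-1)` moments in `ℓ^2`. For `d ≤ 3` this is the second moment condition,
whose exponent `p_d ∧ 2` is at most `2`; for `d ≥ 4` it is the extra condition of order `d-1`. -/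
theorem InQ.sum_sq_moment_g (h : InQ M K ζ Q g) (hM : 0 < M) (hζ : 0 < ζ) (hd : 1 ≤ d) :
    SumLE (fun y => (‖emb y‖ ^ decayExp d * |g y|) ^ 2) (M ^ 2) := by
  rcases lt_or_ge d 4 with h4 | h4
  · have hm : decayExp d = 2 := by unfold decayExp; omega
    have hp : 0 < min (pExp d ζ) 2 := by
      refine lt_min ?_ two_pos
      unfold pExp
      split_ifs with h1
      · norm_num
      · have h2 : (2 : ℝ) ≤ d := by exact_mod_cast (by omega : 2 ≤ d)
        have h3 : 0 < min ζ 2 := lt_min hζ two_pos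
        exact div_pos (by linarith) (by linarith)
    have := sumLE_sq_of_latNorm hp (min_le_right _ _) hM h.g_second
    rw [hm]
    convert this using 3 with y
    rw [abs_mul, abs_of_nonneg (by positivity : 0 ≤ ‖emb y‖ ^ 2)]
  · have hm : decayExp d = d - 1 := by unfold decayExp; omega
    have := sumLE_sq_of_latNorm two_pos le_rfl hM (h.g_high h4)
    rw [hm]
    convert this using 3 with y
    rw [abs_mul, abs_of_nonneg (by positivity : 0 ≤ ‖emb y‖ ^ (d - 1))]

end InQ

end Moments

/-! ### Fourier series of summable lattice functions -/

section Fourier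

variable {d : ℕ}

/-- The character `x ↦ e^{-ik·x}`. -/
noncomputable def char (k : Euc d) (x : Lat d) : ℂ :=
  Complex.exp (-Complex.I * ((inner ℝ k (emb x) : ℝ) : ℂ))

theorem latFourier_eq (f : Lat d → ℝ) (k : Euc d) :
    latFourier f k = ∑' x, (f x : ℂ) * char k x := rfl

theorem char_eq (k : Euc d) (x : Lat d) :
    char k x = Complex.exp (((-(inner ℝ k (emb x)) : ℝ) : ℂ) * Complex.I) := by
  unfold char; congr 1; push_cast; ring

@[simp] theorem norm_char (k : Euc d) (x : Lat d) : ‖char k x‖ = 1 := by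
  rw [char_eq, Complex.norm_exp_ofReal_mul_I]

theorem char_re (k : Euc d) (x : Lat d) : (char k x).re = Real.cos (inner ℝ k (emb x)) := by
  rw [char_eq, Complex.exp_ofReal_mul_I_re, Real.cos_neg]

theorem char_add (k : Euc d) (x y : Lat d) : char k (x + y) = char k x * char k y := by
  unfold char
  rw [← Complex.exp_add, emb_add, inner_add_right]; congr 1; push_cast; ring

@[simp] theorem char_zero (k : Euc d) : char k (0 : Lat d) = 1 := by simp [char]

@[simp] theorem char_zero_left (x : Lat d) : char (0 : Euc d) x = 1 := by simp [char]

theorem char_neg_mul (k : Euc d) (x y : Lat d) : char k (-x) * char k y = char k (y - x) := by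
  rw [← char_add]; congr 1; abel

@[fun_prop] theorem continuous_char (x : Lat d) : Continuous fun k : Euc d => char k x := by
  unfold char; fun_prop

theorem summable_mul_char {f : Lat d → ℝ} (hf : Summable f) (k : Euc d) :
    Summable fun x => (f x : ℂ) * char k x := by
  refine Summable.of_norm ?_
  simpa using hf.abs

theorem norm_latFourier_le {f : Lat d → ℝ} (hf : Summable f) (k : Euc d) :
    ‖latFourier f k‖ ≤ ∑' x, |f x| := by
  rw [latFourier_eq]
  refine (norm_tsum_le_tsum_norm (by simpa using hf.abs)).trans_eq ?_
  simp

theorem latFourier_re {f : Lat d → ℝ} (hf : Summable f) (k : Euc d) :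
    (latFourier f k).re = ∑' x, f x * Real.cos (inner ℝ k (emb x)) := by
  rw [latFourier_eq, Complex.re_tsum (summable_mul_char hf k)]
  simp [char_re]

theorem continuous_latFourier {f : Lat d → ℝ} (hf : Summable f) :
    Continuous fun k : Euc d => latFourier f k := by
  simp only [latFourier_eq]
  refine continuous_tsum (u := fun x => |f x|) (fun x => by fun_prop) hf.abs fun x k => ?_
  simp

/-- The shear `(x, y) ↦ (x + y, y)`, which turns convolution sums into sums over a product. -/
def shear (d : ℕ) : Lat d × Lat d ≃ Lat d × Lat d where
  toFun p := (p.1 + p.2, p.2)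
  invFun p := (p.1 - p.2, p.2)
  left_inv p := by simp
  right_inv p := by simp

theorem summable_conv_prod {f g : Lat d → ℝ} (hf : Summable f) (hg : Summable g) :
    Summable fun p : Lat d × Lat d => f (p.1 - p.2) * g p.2 := by
  have h1 : Summable fun p : Lat d × Lat d => f p.1 * g p.2 :=
    summable_mul_of_summable_norm hf.abs hg.abs
  have := (shear d).symm.summable_iff.2 h1
  exact this

theorem summable_latConv {f g : Lat d → ℝ} (hf : Summable f) (hg : Summable g) :
    Summable (latConv f g) :=
  (summable_conv_prod hf hg).prod

theorem latFourier_latConv {f g : Lat d → ℝ} (hf : Summable f) (hg : Summable g) (k : Euc d) :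
    latFourier (latConv f g) k = latFourier f k * latFourier g k := by
  have hF := (summable_mul_char hf k).norm
  have hG := (summable_mul_char hg k).norm
  have hs : Summable fun p : Lat d × Lat d => ((f (p.1 - p.2) * g p.2 : ℝ) : ℂ) * char k p.1 := by
    refine Summable.of_norm ?_
    simpa using (summable_conv_prod hf hg).abs
  rw [latFourier_eq, latFourier_eq, latFourier_eq, tsum_mul_tsum_of_summable_norm hF hG,
    ← (shear d).symm.tsum_eq]
  have : (fun c : Lat d × Lat d => (f ((shear d).symm c).1 : ℂ) * char k ((shear d).symm c).1 *
      ((g ((shear d).symm c).2 : ℂ) * char k ((shear d).symm c).2)) =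
      fun p => ((f (p.1 - p.2) * g p.2 : ℝ) : ℂ) * char k p.1 := by
    funext p
    have : char k p.1 = char k (p.1 - p.2) * char k p.2 := by
      rw [← char_add]; congr 1; abel
    simp only [shear, Equiv.coe_fn_symm_mk]
    rw [this]; push_cast; ring
  rw [this, hs.tsum_prod]
  refine tsum_congr fun x => ?_
  rw [latConv, Complex.ofReal_tsum, ← tsum_mul_right]

/-- The cube `[-π, π]^d`, which represents the torus. -/
def box (d : ℕ) : Set (Euc d) := {k | ∀ i, k i ∈ Icc (-Real.pi) Real.pi}

theorem box_preimage :
    (WithLp.toLp 2 : (Fin d → ℝ) → Euc d) ⁻¹' box d =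
      Set.pi univ fun _ => Icc (-Real.pi) Real.pi := by
  ext k
  exact ⟨fun h i _ => h i, fun h i => h i trivial⟩

theorem isClosed_box : IsClosed (box d) := by
  have : box d = ⋂ i, (fun k : Euc d => k i) ⁻¹' Icc (-Real.pi) Real.pi := by
    ext k; simp [box]
  rw [this]
  exact isClosed_iInter fun i => isClosed_Icc.preimage (by fun_prop)

theorem measurableSet_box : MeasurableSet (box d) := isClosed_box.measurableSet

theorem norm_sq_le_of_mem_box {k : Euc d} (hk : k ∈ box d) : ‖k‖ ^ 2 ≤ d * Real.pi ^ 2 := by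
  rw [EuclideanSpace.norm_sq_eq]
  refine (Finset.sum_le_card_nsmul _ _ (Real.pi ^ 2) fun i _ => ?_).trans_eq (by simp)
  rw [Real.norm_eq_abs, sq_abs]
  have := hk i
  exact sq_le_sq' this.1 this.2

theorem isCompact_box : IsCompact (box d) := by
  refine Metric.isCompact_of_isClosed_isBounded isClosed_box ?_
  refine (Metric.isBounded_closedBall (x := (0 : Euc d))
    (r := Real.sqrt (d * Real.pi ^ 2))).subset fun k hk => ?_
  rw [mem_closedBall_zero_iff]
  exact Real.le_sqrt_of_sq_le (norm_sq_le_of_mem_box hk)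

theorem pi_le_norm_of_notMem_box {k : Euc d} (hk : k ∉ box d) : Real.pi ≤ ‖k‖ := by
  simp only [box, mem_ofPred_eq, not_forall] at hk
  obtain ⟨i, hi⟩ := hk
  refine le_trans ?_ (abs_apply_le_norm k i)
  by_contra hc
  push Not at hc
  exact hi (mem_Icc.2 ⟨(abs_lt.1 hc).1.le, (abs_lt.1 hc).2.le⟩)

theorem volume_box_lt_top : volume (box d) < ⊤ := isCompact_box.measure_lt_top

theorem integral_exp_int (n : ℤ) :
    ∫ t in Icc (-Real.pi) Real.pi, Complex.exp (-Complex.I * ((t * n : ℝ) : ℂ)) =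
      if n = 0 then 2 * (Real.pi : ℂ) else 0 := by
  rw [integral_Icc_eq_integral_Ioc, ← intervalIntegral.integral_of_le (by linarith [Real.pi_pos])]
  split_ifs with hn
  · subst hn
    simp; ring
  · have hc : (-Complex.I * n : ℂ) ≠ 0 := by simp [hn]
    have h1 := integral_exp_mul_complex (a := -Real.pi) (b := Real.pi) hc
    have h2 : ∀ t : ℝ, (-Complex.I * ((t * n : ℝ) : ℂ)) = -Complex.I * n * t := by
      intro t; push_cast; ring
    simp only [h2]
    rw [h1, div_eq_zero_iff]
    left
    have h3 : Complex.exp (-Complex.I * n * ((Real.pi : ℝ) : ℂ)) =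
        Complex.exp (-Complex.I * n * ((-Real.pi : ℝ) : ℂ)) := by
      rw [Complex.exp_eq_exp_iff_exists_int]
      exact ⟨-n, by push_cast; ring⟩
    rw [h3, sub_self]

theorem inner_emb (k : Euc d) (y : Lat d) : inner ℝ k (emb y) = ∑ i, k i * (y i : ℝ) := by
  simp [PiLp.inner_apply, mul_comm]

theorem integral_char_box (y : Lat d) :
    ∫ k in box d, char k y = if y = 0 then (2 * (Real.pi : ℂ)) ^ d else 0 := by
  have h1 := (PiLp.volume_preserving_toLp (Fin d)).setIntegral_preimage_emb
    (MeasurableEquiv.toLp 2 (Fin d → ℝ)).measurableEmbedding (fun k => char k y) (box d)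
  rw [← h1, box_preimage, volume_pi, Measure.restrict_pi_pi]
  have h2 : ∀ k : Fin d → ℝ, char (WithLp.toLp 2 k : Euc d) y =
      ∏ i, Complex.exp (-Complex.I * ((k i * y i : ℝ) : ℂ)) := by
    intro k
    rw [char, inner_emb, ← Complex.exp_sum]
    congr 1
    push_cast
    rw [Finset.mul_sum]
  simp_rw [h2]
  rw [integral_fintype_prod_eq_prod
    (fun (i : Fin d) (t : ℝ) => Complex.exp (-Complex.I * ((t * y i : ℝ) : ℂ)))]
  simp_rw [integral_exp_int]
  split_ifs with hy
  · subst hy; simp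
  · obtain ⟨i, hi⟩ := Function.ne_iff.mp hy
    exact Finset.prod_eq_zero (Finset.mem_univ i) (if_neg hi)

theorem integrableOn_box {φ : Euc d → ℂ} (hφ : Continuous φ) : IntegrableOn φ (box d) :=
  hφ.continuousOn.integrableOn_compact isCompact_box

/-- Fourier inversion for summable functions on the lattice. -/
theorem fourier_inversion {f : Lat d → ℝ} (hf : Summable f) (x : Lat d) :
    ∫ k in box d, char k (-x) * latFourier f k = (2 * (Real.pi : ℂ)) ^ d * (f x : ℂ) := by
  have h1 : ∀ k : Euc d, char k (-x) * latFourier f k =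
      ∑' y, (f y : ℂ) * char k (y - x) := by
    intro k
    rw [latFourier_eq, ← tsum_mul_left]
    refine tsum_congr fun y => ?_
    rw [← char_neg_mul]; ring
  simp_rw [h1]
  rw [← integral_tsum_of_summable_integral_norm]
  · simp_rw [integral_const_mul, integral_char_box, sub_eq_zero]
    rw [tsum_eq_single x]
    · simp [mul_comm]
    · intro y hy; simp [hy]
  · intro y
    exact integrableOn_box (by fun_prop)
  · simp only [norm_mul, norm_char, mul_one, integral_const]
    refine Summable.mul_left _ ?_
    simpa using hf.abs

end Fourier

/-! ### Weighted norms and the convolution exponential -/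

section ConvExp

variable {d : ℕ}

/-- `sup_x ∑_y G(x-y) a(y)`, the supremum of a convolution of nonnegative functions. -/
noncomputable def supConv (G a : Lat d → ENNReal) : ENNReal := ⨆ x, ∑' y, G (x - y) * a y

/-- The norm `‖g‖_1 + c sup_x ∑_y G(x-y) w(y) |g(y)|`. For a weight `w` of polynomial growth it is
submultiplicative under convolution up to a constant: the weight of a sum of lattice vectors is
carried by one of the summands, and the other one enters through its `ℓ^1` norm only. -/
noncomputable def wnorm (c : ENNReal) (G w : Lat d → ENNReal) (g : Lat d → ℝ) : ENNReal :=
  (∑' y, ‖g y‖ₑ) + c * supConv G fun y => w y * ‖g y‖ₑ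

/-- Convolving with `b` costs only the `ℓ^1` norm of `b`, since `supConv` is a supremum over
translations. -/
theorem tsum_conv_le_supConv (G a b : Lat d → ENNReal) (x : Lat d) :
    ∑' y, ∑' z, G (x - y) * (a (y - z) * b z) ≤ supConv G a * ∑' z, b z := by
  rw [ENNReal.tsum_comm, ← ENNReal.tsum_mul_left]
  refine ENNReal.tsum_le_tsum fun z => ?_
  calc ∑' y, G (x - y) * (a (y - z) * b z) = (∑' y, G (x - y) * a (y - z)) * b z := by
        rw [← ENNReal.tsum_mul_right]; exact tsum_congr fun y => by ring
    _ ≤ supConv G a * b z := by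
        gcongr
        rw [← (Equiv.addRight z).tsum_eq]
        refine le_trans (le_of_eq ?_) (le_iSup _ (x - z))
        refine tsum_congr fun y => ?_
        simp only [Equiv.coe_addRight, add_sub_cancel_right]
        congr 2; abel

theorem enorm_latConv_le (f g : Lat d → ℝ) (y : Lat d) :
    ‖latConv f g y‖ₑ ≤ ∑' z, ‖f (y - z)‖ₑ * ‖g z‖ₑ := by
  refine enorm_tsum_le_tsum_enorm.trans_eq ?_
  simp [enorm_mul]

theorem tsum_sub_comm (a b : Lat d → ENNReal) (y : Lat d) :
    ∑' z, a (y - z) * b z = ∑' z, b (y - z) * a z := by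
  rw [← (Equiv.subLeft y).tsum_eq]
  exact tsum_congr fun z => by simp [mul_comm]

theorem tsum_enorm_latConv_le (f g : Lat d → ℝ) :
    ∑' y, ‖latConv f g y‖ₑ ≤ (∑' y, ‖f y‖ₑ) * ∑' y, ‖g y‖ₑ := by
  have h := tsum_conv_le_supConv (fun _ => 1) (fun y => ‖f y‖ₑ) (fun y => ‖g y‖ₑ) 0
  simp only [one_mul, supConv, iSup_const] at h
  exact (ENNReal.tsum_le_tsum fun y => enorm_latConv_le f g y).trans h

/-- Submultiplicativity of the weighted norm, for weights that are quasi-subadditive. -/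
theorem wnorm_latConv_le {c : ENNReal} {G w : Lat d → ENNReal} {D : ENNReal} (hD : 1 ≤ D)
    (hw : ∀ y z, w (y + z) ≤ D * (w y + w z)) (f g : Lat d → ℝ) :
    wnorm c G w (latConv f g) ≤ D * wnorm c G w f * wnorm c G w g := by
  set nf := ∑' y, ‖f y‖ₑ
  set ng := ∑' y, ‖g y‖ₑ
  set wf := supConv G fun y => w y * ‖f y‖ₑ
  set wg := supConv G fun y => w y * ‖g y‖ₑ
  have key : (supConv G fun y => w y * ‖latConv f g y‖ₑ) ≤ D * (wf * ng + wg * nf) := by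
    refine iSup_le fun x => ?_
    have h1 := tsum_conv_le_supConv G (fun y => w y * ‖f y‖ₑ) (fun y => ‖g y‖ₑ) x
    have h2 := tsum_conv_le_supConv G (fun y => w y * ‖g y‖ₑ) (fun y => ‖f y‖ₑ) x
    have h3 : ∀ y, G (x - y) * (w y * ‖latConv f g y‖ₑ) ≤
        D * ((∑' z, G (x - y) * (w (y - z) * ‖f (y - z)‖ₑ * ‖g z‖ₑ)) +
          ∑' z, G (x - y) * (w (y - z) * ‖g (y - z)‖ₑ * ‖f z‖ₑ)) := by
      intro y
      rw [ENNReal.tsum_mul_left, ENNReal.tsum_mul_left,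
        tsum_sub_comm (fun z => w z * ‖g z‖ₑ) (fun z => ‖f z‖ₑ), ← mul_add, ← ENNReal.tsum_add,
        mul_left_comm D]
      have h4 : w y * ‖latConv f g y‖ₑ ≤ D * ∑' z, (w (y - z) * ‖f (y - z)‖ₑ * ‖g z‖ₑ +
          ‖f (y - z)‖ₑ * (w z * ‖g z‖ₑ)) := by
        calc w y * ‖latConv f g y‖ₑ ≤ w y * ∑' z, ‖f (y - z)‖ₑ * ‖g z‖ₑ := by
              gcongr; exact enorm_latConv_le f g y
          _ ≤ _ := by
            rw [← ENNReal.tsum_mul_left, ← ENNReal.tsum_mul_left]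
            refine ENNReal.tsum_le_tsum fun z => ?_
            have := hw (y - z) z
            rw [sub_add_cancel] at this
            calc w y * (‖f (y - z)‖ₑ * ‖g z‖ₑ)
                ≤ (D * (w (y - z) + w z)) * (‖f (y - z)‖ₑ * ‖g z‖ₑ) := by gcongr
              _ = _ := by ring
      refine le_trans (le_of_eq rfl) ((mul_le_mul_right h4 (G (x - y))).trans_eq ?_)
      ring
    refine (ENNReal.tsum_le_tsum h3).trans ?_
    rw [ENNReal.tsum_mul_left, ENNReal.tsum_add]
    gcongr
  calc wnorm c G w (latConv f g) ≤ nf * ng + c * (D * (wf * ng + wg * nf)) := by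
        unfold wnorm
        gcongr
        exact tsum_enorm_latConv_le f g
    _ ≤ D * (nf * ng) + c * (D * (wf * ng + wg * nf)) + D * (c * wf) * (c * wg) := by
        refine le_trans ?_ le_self_add
        exact add_le_add_left (le_mul_of_one_le_left (zero_le (a := nf * ng)) hD) _
    _ = D * (nf + c * wf) * (ng + c * wg) := by ring

/-- The terms `f^{*n} * g / n!` of the convolution exponential. -/
noncomputable def convExpTerm (f g : Lat d → ℝ) : ℕ → Lat d → ℝ
  | 0 => g
  | n + 1 => fun x => ((n : ℝ) + 1)⁻¹ * latConv f (convExpTerm f g n) x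

/-- The convolution exponential `∑_n f^{*n} * g / n!`, with Fourier transform `e^{f̂} ĝ`. -/
noncomputable def convExp (f g : Lat d → ℝ) (x : Lat d) : ℝ := ∑' n, convExpTerm f g n x

theorem wnorm_const_mul (c : ENNReal) (G w : Lat d → ENNReal) (a : ℝ) (g : Lat d → ℝ) :
    wnorm c G w (fun x => a * g x) = ‖a‖ₑ * wnorm c G w g := by
  unfold wnorm supConv
  simp only [enorm_mul]
  have h1 : ∀ x, ∑' y, G (x - y) * (w y * (‖a‖ₑ * ‖g y‖ₑ)) =
      ‖a‖ₑ * ∑' y, G (x - y) * (w y * ‖g y‖ₑ) := fun x => by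
    rw [← ENNReal.tsum_mul_left]
    exact tsum_congr fun y => by ring
  simp_rw [h1]
  rw [ENNReal.tsum_mul_left, ← ENNReal.mul_iSup]
  ring

theorem wnorm_convExpTerm_le {c : ENNReal} {G w : Lat d → ENNReal} {D : ENNReal} (hD : 1 ≤ D)
    (hw : ∀ y z, w (y + z) ≤ D * (w y + w z)) (f g : Lat d → ℝ) {κ : ℝ} (hκ : 0 ≤ κ)
    (hf : D * wnorm c G w f ≤ ENNReal.ofReal κ) (n : ℕ) :
    wnorm c G w (convExpTerm f g n) ≤
      ENNReal.ofReal (κ ^ n / n.factorial) * wnorm c G w g := by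
  induction n with
  | zero => simp [convExpTerm]
  | succ n ih =>
    rw [convExpTerm, wnorm_const_mul]
    calc _ ≤ ‖((n : ℝ) + 1)⁻¹‖ₑ * (ENNReal.ofReal κ *
          (ENNReal.ofReal (κ ^ n / n.factorial) * wnorm c G w g)) := by
          gcongr
          refine (wnorm_latConv_le hD hw _ _).trans ?_
          gcongr
      _ = _ := by
          rw [Real.enorm_eq_ofReal (by positivity), ← mul_assoc, ← mul_assoc,
            ← ENNReal.ofReal_mul (by positivity), ← ENNReal.ofReal_mul (by positivity)]
          congr 2
          rw [Nat.factorial_succ, pow_succ]; push_cast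
          field_simp

theorem wnorm_tsum_le (c : ENNReal) (G w : Lat d → ENNReal) (u : ℕ → Lat d → ℝ) :
    wnorm c G w (fun x => ∑' n, u n x) ≤ ∑' n, wnorm c G w (u n) := by
  unfold wnorm
  rw [ENNReal.tsum_add, ENNReal.tsum_mul_left]
  gcongr
  · rw [ENNReal.tsum_comm]
    exact ENNReal.tsum_le_tsum fun y => enorm_tsum_le_tsum_enorm (f := fun n => u n y)
  · refine iSup_le fun x => ?_
    calc _ ≤ ∑' y, ∑' n, G (x - y) * (w y * ‖u n y‖ₑ) := by
          refine ENNReal.tsum_le_tsum fun y => ?_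
          rw [ENNReal.tsum_mul_left, ENNReal.tsum_mul_left]
          refine mul_le_mul_right (mul_le_mul_right ?_ _) _
          exact enorm_tsum_le_tsum_enorm (f := fun n => u n y)
      _ = ∑' n, ∑' y, G (x - y) * (w y * ‖u n y‖ₑ) := ENNReal.tsum_comm
      _ ≤ _ := ENNReal.tsum_le_tsum fun n =>
          le_iSup (fun x => ∑' y, G (x - y) * (w y * ‖u n y‖ₑ)) x

theorem tsum_ofReal_exp {κ : ℝ} (hκ : 0 ≤ κ) :
    ∑' n : ℕ, ENNReal.ofReal (κ ^ n / n.factorial) = ENNReal.ofReal (Real.exp κ) := by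
  rw [← ENNReal.ofReal_tsum_of_nonneg (fun n => by positivity) (Real.summable_pow_div_factorial κ),
    Real.exp_eq_exp_ℝ, NormedSpace.exp_eq_tsum_div]

theorem tsum_wnorm_convExpTerm_le {c : ENNReal} {G w : Lat d → ENNReal} {D : ENNReal} (hD : 1 ≤ D)
    (hw : ∀ y z, w (y + z) ≤ D * (w y + w z)) (f g : Lat d → ℝ) {κ : ℝ} (hκ : 0 ≤ κ)
    (hf : D * wnorm c G w f ≤ ENNReal.ofReal κ) :
    ∑' n, wnorm c G w (convExpTerm f g n) ≤ ENNReal.ofReal (Real.exp κ) * wnorm c G w g := by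
  rw [← tsum_ofReal_exp hκ, ← ENNReal.tsum_mul_right]
  exact ENNReal.tsum_le_tsum fun n => wnorm_convExpTerm_le hD hw f g hκ hf n

theorem wnorm_convExp_le {c : ENNReal} {G w : Lat d → ENNReal} {D : ENNReal} (hD : 1 ≤ D)
    (hw : ∀ y z, w (y + z) ≤ D * (w y + w z)) (f g : Lat d → ℝ) {κ : ℝ} (hκ : 0 ≤ κ)
    (hf : D * wnorm c G w f ≤ ENNReal.ofReal κ) :
    wnorm c G w (convExp f g) ≤ ENNReal.ofReal (Real.exp κ) * wnorm c G w g :=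
  (wnorm_tsum_le c G w _).trans (tsum_wnorm_convExpTerm_le hD hw f g hκ hf)

theorem tsum_enorm_eq {f : Lat d → ℝ} (hf : Summable f) :
    ∑' y, ‖f y‖ₑ = ENNReal.ofReal (∑' y, |f y|) := by
  rw [ENNReal.ofReal_tsum_of_nonneg (fun y => abs_nonneg _) hf.abs]
  simp [Real.enorm_eq_ofReal_abs]

theorem summable_of_tsum_enorm {ι : Type*} {f : ι → ℝ} (hf : ∑' y, ‖f y‖ₑ ≠ ⊤) : Summable f := by
  refine Summable.of_norm ?_
  simpa using ENNReal.summable_toReal hf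

theorem summable_uncurry_convExpTerm {f g : Lat d → ℝ} (hf : Summable f) (hg : Summable g) :
    Summable fun p : ℕ × Lat d => convExpTerm f g p.1 p.2 := by
  refine summable_of_tsum_enorm (ne_top_of_le_ne_top ?_ (le_trans (le_of_eq ?_)
    (tsum_wnorm_convExpTerm_le (c := 0) (G := 0) (w := 0) (D := 1) le_rfl
      (by simp) f g (κ := ∑' y, |f y|) (tsum_nonneg fun _ => abs_nonneg _) ?_)))
  · simp only [wnorm, zero_mul, add_zero, tsum_enorm_eq hg]
    exact ENNReal.mul_ne_top ENNReal.ofReal_ne_top ENNReal.ofReal_ne_top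
  · rw [ENNReal.tsum_prod (f := fun n y => ‖convExpTerm f g n y‖ₑ)]; simp [wnorm]
  · simp only [wnorm, zero_mul, add_zero, one_mul, tsum_enorm_eq hf]; exact le_rfl

theorem summable_convExpTerm {f g : Lat d → ℝ} (hf : Summable f) (hg : Summable g) (n : ℕ) :
    Summable (convExpTerm f g n) :=
  (summable_uncurry_convExpTerm hf hg).prod_factor n

theorem summable_convExp {f g : Lat d → ℝ} (hf : Summable f) (hg : Summable g) :
    Summable (convExp f g) :=
  (summable_uncurry_convExpTerm hf hg).prod_symm.prod

theorem latFourier_const_mul (a : ℝ) (f : Lat d → ℝ) (k : Euc d) :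
    latFourier (fun x => a * f x) k = a * latFourier f k := by
  rw [latFourier_eq, latFourier_eq, ← tsum_mul_left]
  exact tsum_congr fun x => by push_cast; ring

theorem latFourier_convExpTerm {f g : Lat d → ℝ} (hf : Summable f) (hg : Summable g) (k : Euc d)
    (n : ℕ) : latFourier (convExpTerm f g n) k =
      latFourier f k ^ n / n.factorial * latFourier g k := by
  induction n with
  | zero => simp [convExpTerm]
  | succ n ih =>
    rw [convExpTerm, latFourier_const_mul, latFourier_latConv hf (summable_convExpTerm hf hg n), ih,
      Nat.factorial_succ, pow_succ]
    have : (n : ℂ) + 1 ≠ 0 := by exact_mod_cast Nat.succ_ne_zero n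
    push_cast
    field_simp

/-- The Fourier transform turns the convolution exponential into an exponential. -/
theorem latFourier_convExp {f g : Lat d → ℝ} (hf : Summable f) (hg : Summable g) (k : Euc d) :
    latFourier (convExp f g) k = Complex.exp (latFourier f k) * latFourier g k := by
  have hs : Summable fun p : ℕ × Lat d => (convExpTerm f g p.1 p.2 : ℂ) * char k p.2 := by
    refine Summable.of_norm ?_
    simpa using (summable_uncurry_convExpTerm hf hg).abs
  have h1 : latFourier (convExp f g) k = ∑' x, ∑' n, (convExpTerm f g n x : ℂ) * char k x := by
    rw [latFourier_eq]
    refine tsum_congr fun x => ?_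
    rw [convExp, Complex.ofReal_tsum, ← tsum_mul_right]
  have h2 : ∀ n, ∑' x, (convExpTerm f g n x : ℂ) * char k x =
      latFourier f k ^ n / n.factorial * latFourier g k := fun n =>
    latFourier_convExpTerm hf hg k n
  rw [h1, Summable.tsum_comm' hs hs.prod_factor hs.prod_symm.prod_factor]
  simp_rw [h2]
  rw [tsum_mul_right, Complex.exp_eq_exp_ℂ, NormedSpace.exp_eq_tsum_div]

theorem tilt_latConv (f g : Lat d → ℝ) (μ : Euc d) :
    tilt (latConv f g) μ = latConv (tilt f μ) (tilt g μ) := by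
  funext x
  rw [tilt, latConv, latConv, ← tsum_mul_right]
  refine tsum_congr fun y => ?_
  have : Real.exp (inner ℝ μ (emb x)) =
      Real.exp (inner ℝ μ (emb (x - y))) * Real.exp (inner ℝ μ (emb y)) := by
    rw [← Real.exp_add, emb_sub, inner_sub_right]; congr 1; ring
  rw [this]; simp only [tilt]; ring

theorem tilt_convExpTerm (f g : Lat d → ℝ) (μ : Euc d) (n : ℕ) :
    tilt (convExpTerm f g n) μ = convExpTerm (tilt f μ) (tilt g μ) n := by
  induction n with
  | zero => rfl
  | succ n ih =>
    rw [convExpTerm, convExpTerm, ← ih, ← tilt_latConv]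
    funext x; simp only [tilt]; ring

/-- Tilting is multiplicative under convolution, so it passes to the convolution exponential. -/
theorem tilt_convExp (f g : Lat d → ℝ) (μ : Euc d) :
    tilt (convExp f g) μ = convExp (tilt f μ) (tilt g μ) := by
  funext x
  simp_rw [convExp, ← tilt_convExpTerm]
  simp only [tilt, convExp, tsum_mul_right]

end ConvExp

/-! ### Spatial decay of the semigroup kernels -/

section Kernel

variable {d : ℕ}

/-- The restriction of `Q` to the ball of radius `L`. -/
noncomputable def near (L : ℝ) (Q : Lat d → ℝ) (y : Lat d) : ℝ := if ‖emb y‖ ≤ L then Q y else 0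

/-- The restriction of `Q` to the complement of the ball of radius `L`. -/
noncomputable def far (L : ℝ) (Q : Lat d → ℝ) (y : Lat d) : ℝ := if ‖emb y‖ ≤ L then 0 else Q y

theorem near_add_far (L : ℝ) (Q : Lat d → ℝ) (y : Lat d) : near L Q y + far L Q y = Q y := by
  unfold near far; split_ifs <;> simp

theorem abs_near_le (L : ℝ) (Q : Lat d → ℝ) (y : Lat d) : |near L Q y| ≤ |Q y| := by
  unfold near; split_ifs <;> simp

theorem abs_far_le (L : ℝ) (Q : Lat d → ℝ) (y : Lat d) : |far L Q y| ≤ |Q y| := by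
  unfold far; split_ifs <;> simp

/-- The point mass at the origin, the unit for convolution. -/
noncomputable def delta (d : ℕ) : Lat d → ℝ := Pi.single 0 1

theorem summable_delta : Summable (delta d) :=
  summable_of_ne_finset_zero (s := {0}) fun y hy => by
    simp only [Finset.mem_singleton] at hy; simp [delta, hy]

theorem latFourier_delta (k : Euc d) : latFourier (delta d) k = 1 := by
  rw [latFourier_eq, tsum_eq_single 0]
  · simp [delta]
  · intro y hy; simp [delta, hy]

theorem tilt_delta (θ : Euc d) : tilt (delta d) θ = delta d := by
  funext y
  rcases eq_or_ne y 0 with rfl | hy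
  · simp [tilt]
  · simp [tilt, delta, hy]

theorem inner_drift {Q : Lat d → ℝ} (h1 : Summable fun y => ‖emb y‖ * |Q y|) (θ : Euc d) :
    inner ℝ θ (drift Q) = ∑' y, inner ℝ θ (emb y) * Q y := by
  have hs : ∀ i, Summable fun y : Lat d => θ i * ((y i : ℝ) * Q y) := by
    intro i
    refine Summable.mul_left _ (Summable.of_norm_bounded h1 fun y => ?_)
    rw [norm_mul]
    exact mul_le_mul_of_nonneg_right (abs_apply_le_norm (emb y) i) (abs_nonneg _)
  simp_rw [inner_emb, Finset.sum_mul, mul_assoc]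
  rw [Summable.tsum_finsetSum fun i _ => hs i]
  simp only [PiLp.inner_apply, drift, tsum_mul_left]
  exact Finset.sum_congr rfl fun i _ => by simp [mul_comm]

theorem abs_exp_sub_one_sub_le {u : ℝ} (hu : |u| ≤ 1) : |Real.exp u - 1 - u| ≤ u ^ 2 :=
  Real.abs_exp_sub_one_sub_id_le hu

theorem abs_cos_sub_one_le (u : ℝ) : |Real.cos u - 1| ≤ |u| := by
  have h1 := Real.abs_cos_sub_cos_le u 0
  simpa using h1

/-- The data on a step distribution `Q` that give spatial decay of the kernels. -/
structure StepBounds (M K : ℝ) (Q : Lat d → ℝ) : Prop where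
  l1 : SumLE (fun y => |Q y|) M
  moment1 : SumLE (fun y => ‖emb y‖ * |Q y|) M
  moment2 : SumLE (fun y => ‖emb y‖ ^ 2 * |Q y|) M
  infrared : ∀ k ∈ box d, K * ‖k‖ ^ 2 ≤ (latFourier Q 0 - latFourier Q k).re
  mass_le : ∑' y, Q y ≤ 1

theorem StepBounds.summable {M K : ℝ} {Q : Lat d → ℝ} (h : StepBounds M K Q) : Summable Q :=
  summable_abs_iff.1 h.l1.1

theorem StepBounds.latFourier_re_le {M K : ℝ} {Q : Lat d → ℝ} (h : StepBounds M K Q) {k : Euc d}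
    (hk : k ∈ box d) : (latFourier Q k).re ≤ 1 - K * ‖k‖ ^ 2 := by
  have h1 := h.infrared k hk
  rw [Complex.sub_re, latFourier_zero, Complex.ofReal_re] at h1
  linarith [h.mass_le]

/-- Second order expansion of the tilt of a short step: since `|θ·y| ≤ 1`, the tilt contributes the
drift term `θ·y` up to an error `|y|²/L²`, and replacing `cos(k·y)` by `1` in that term costs
`|k| |y|²/L`. -/
theorem near_tilt_term_le (Q : Lat d → ℝ) {L : ℝ} (hL : 0 < L) {θ : Euc d} (hθ : ‖θ‖ ≤ L⁻¹)
    (k : Euc d) (y : Lat d) :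
    tilt (near L Q) θ y * Real.cos (inner ℝ k (emb y)) ≤
      Q y * Real.cos (inner ℝ k (emb y)) + inner ℝ θ (emb y) * Q y +
        (2 * L⁻¹ ^ 2 + ‖k‖ * L⁻¹) * (‖emb y‖ ^ 2 * |Q y|) := by
  set u := inner ℝ θ (emb y) with hu
  set c := Real.cos (inner ℝ k (emb y)) with hc
  have hc1 : |c| ≤ 1 := Real.abs_cos_le_one _
  have hu1 : |u| ≤ L⁻¹ * ‖emb y‖ :=
    (abs_real_inner_le_norm _ _).trans (by gcongr)
  have hLi : 0 < L⁻¹ := by positivity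
  by_cases hy : ‖emb y‖ ≤ L
  · have h1 : |u| ≤ 1 := hu1.trans (by
      rw [inv_mul_le_iff₀ hL]; simpa using hy)
    have h2 : tilt (near L Q) θ y * c - Q y * c - u * Q y =
        Q y * ((Real.exp u - 1 - u) * c + u * (c - 1)) := by
      simp only [tilt, near, hy, if_true]; ring
    have h3 : |Q y * ((Real.exp u - 1 - u) * c + u * (c - 1))| ≤
        |Q y| * ((L⁻¹ * ‖emb y‖) ^ 2 + (L⁻¹ * ‖emb y‖) * (‖k‖ * ‖emb y‖)) := by
      rw [abs_mul]
      gcongr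
      refine (abs_add_le _ _).trans ?_
      rw [abs_mul, abs_mul]
      have h4 : |Real.exp u - 1 - u| ≤ (L⁻¹ * ‖emb y‖) ^ 2 :=
        (abs_exp_sub_one_sub_le h1).trans (by rw [← sq_abs]; gcongr)
      have h5 : |c - 1| ≤ ‖k‖ * ‖emb y‖ :=
        (abs_cos_sub_one_le _).trans (abs_real_inner_le_norm _ _)
      have h6 : |Real.exp u - 1 - u| * |c| ≤ (L⁻¹ * ‖emb y‖) ^ 2 * 1 := by gcongr
      have h7 : |u| * |c - 1| ≤ (L⁻¹ * ‖emb y‖) * (‖k‖ * ‖emb y‖) := by gcongr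
      linarith
    have h4 : 0 ≤ L⁻¹ ^ 2 * (‖emb y‖ ^ 2 * |Q y|) := by positivity
    have h5 := (le_abs_self _).trans h3
    rw [← h2] at h5
    nlinarith
  · push Not at hy
    have h1 : tilt (near L Q) θ y = 0 := by simp [tilt, near, not_le.2 hy]
    rw [h1, zero_mul]
    have h2 : 1 ≤ L⁻¹ * ‖emb y‖ := by
      rw [le_inv_mul_iff₀ hL]; linarith
    have h3 : |Q y * c + u * Q y| ≤ |Q y| * (1 + L⁻¹ * ‖emb y‖) := by
      have : Q y * c + u * Q y = Q y * (c + u) := by ring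
      rw [this, abs_mul]
      gcongr
      exact (abs_add_le _ _).trans (by gcongr)
    have h4 : 1 + L⁻¹ * ‖emb y‖ ≤ 2 * (L⁻¹ * ‖emb y‖) ^ 2 := by nlinarith
    have h5 : |Q y| * (1 + L⁻¹ * ‖emb y‖) ≤ |Q y| * (2 * (L⁻¹ * ‖emb y‖) ^ 2) := by gcongr
    have h6 : 0 ≤ ‖k‖ * L⁻¹ * (‖emb y‖ ^ 2 * |Q y|) := by positivity
    have h7 := neg_abs_le (Q y * c + u * Q y)
    nlinarith

theorem summable_tilt_near {Q : Lat d → ℝ} (hQ : Summable Q) {L : ℝ} (hL : 0 < L) {θ : Euc d}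
    (hθ : ‖θ‖ ≤ L⁻¹) : Summable (tilt (near L Q) θ) := by
  refine Summable.of_norm_bounded (g := fun y => Real.exp 1 * |Q y|) (hQ.abs.mul_left _) fun y => ?_
  rw [tilt, norm_mul, Real.norm_eq_abs, Real.norm_eq_abs, Real.abs_exp, mul_comm]
  by_cases hy : ‖emb y‖ ≤ L
  · refine mul_le_mul (Real.exp_le_exp.2 ?_) (abs_near_le L Q y) (abs_nonneg _) (Real.exp_pos _).le
    refine (real_inner_le_norm _ _).trans ?_
    calc ‖θ‖ * ‖emb y‖ ≤ L⁻¹ * L := by gcongr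
      _ = 1 := inv_mul_cancel₀ hL.ne'
  · simp only [near, hy, if_false, abs_zero, mul_zero]; positivity

/-- Tilting the truncated step distribution by `|θ| ≤ 1/L` changes the exponent, apart from the
drift term, by a bounded amount only, since `s / L² ≤ 1`. -/
theorem StepBounds.near_exponent_le {M K : ℝ} {Q : Lat d → ℝ} (h : StepBounds M K Q) (hM : 0 < M)
    (hK : 0 < K) {s : ℝ} (hs : 0 < s) {θ : Euc d} (hθ : ‖θ‖ ≤ (Real.sqrt (1 + s))⁻¹) {k : Euc d}
    (hk : k ∈ box d) :
    s * (latFourier (tilt (near (Real.sqrt (1 + s)) Q) θ) k).re ≤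
      s + s * inner ℝ θ (drift Q) - s * K / 2 * ‖k‖ ^ 2 + (2 * M + M ^ 2 / (2 * K)) := by
  set L := Real.sqrt (1 + s)
  have hL : 0 < L := Real.sqrt_pos.2 (by linarith)
  have hL2 : L ^ 2 = 1 + s := Real.sq_sqrt (by linarith)
  have hA := summable_tilt_near h.summable hL hθ
  have hAc : Summable fun y => tilt (near L Q) θ y * Real.cos (inner ℝ k (emb y)) :=
    Summable.of_norm_bounded hA.abs fun y => by
      rw [norm_mul]; exact mul_le_of_le_one_right (abs_nonneg _) (Real.abs_cos_le_one _)
  have hQc : Summable fun y => Q y * Real.cos (inner ℝ k (emb y)) :=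
    Summable.of_norm_bounded h.l1.1 fun y => by
      rw [norm_mul]; exact mul_le_of_le_one_right (abs_nonneg _) (Real.abs_cos_le_one _)
  have hQd : Summable fun y => inner ℝ θ (emb y) * Q y :=
    Summable.of_norm_bounded (h.moment1.1.mul_left ‖θ‖) fun y => by
      rw [norm_mul, ← mul_assoc]
      exact mul_le_mul_of_nonneg_right (norm_inner_le_norm _ _) (abs_nonneg _)
  have hQ2 := h.moment2.1.mul_left (2 * L⁻¹ ^ 2 + ‖k‖ * L⁻¹)
  have h1 := hAc.tsum_le_tsum (near_tilt_term_le Q hL hθ k) ((hQc.add hQd).add hQ2)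
  rw [(hQc.add hQd).tsum_add hQ2, hQc.tsum_add hQd, tsum_mul_left, ← latFourier_re hA,
    ← latFourier_re h.summable, ← inner_drift h.moment1.1] at h1
  have h2 := h.latFourier_re_le hk
  have h3 : (2 * L⁻¹ ^ 2 + ‖k‖ * L⁻¹) * ∑' y, ‖emb y‖ ^ 2 * |Q y| ≤
      (2 * L⁻¹ ^ 2 + ‖k‖ * L⁻¹) * M := by
    gcongr; exact h.moment2.2
  have h4 : s * L⁻¹ ^ 2 ≤ 1 := by
    rw [inv_pow, hL2, mul_inv_le_iff₀ (by linarith)]; linarith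
  have h5 : s * (‖k‖ * L⁻¹) * M ≤ s * K / 2 * ‖k‖ ^ 2 + M ^ 2 / (2 * K) := by
    have e1 : 0 ≤ s * (K * ‖k‖ - M * L⁻¹) ^ 2 := by positivity
    have e2 : s * L⁻¹ ^ 2 * M ^ 2 ≤ 1 * M ^ 2 := by gcongr
    have e3 : s * (‖k‖ * L⁻¹) * M * (2 * K) ≤ (s * K / 2 * ‖k‖ ^ 2 + M ^ 2 / (2 * K)) * (2 * K) := by
      have : (s * K / 2 * ‖k‖ ^ 2 + M ^ 2 / (2 * K)) * (2 * K) = s * K ^ 2 * ‖k‖ ^ 2 + M ^ 2 := by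
        field_simp
      rw [this]
      nlinarith
    exact le_of_mul_le_mul_right e3 (by positivity)
  have h6 : s * (latFourier (tilt (near L Q) θ) k).re ≤ s * ((1 - K * ‖k‖ ^ 2) +
      inner ℝ θ (drift Q) + (2 * L⁻¹ ^ 2 + ‖k‖ * L⁻¹) * M) := by
    gcongr
    linarith
  nlinarith

theorem integral_gaussian_euc {b : ℝ} (hb : 0 < b) :
    ∫ k : Euc d, Real.exp (-b * ‖k‖ ^ 2) = (Real.pi / b) ^ ((d : ℝ) / 2) := by
  have := GaussianFourier.integral_rexp_neg_mul_sq_norm (V := Euc d) hb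
  simpa using this

theorem integrable_gaussian_euc {b : ℝ} (hb : 0 < b) :
    Integrable fun k : Euc d => Real.exp (-b * ‖k‖ ^ 2) := by
  refine Integrable.of_integral_ne_zero ?_
  rw [integral_gaussian_euc hb]
  positivity

/-- The convolution exponential of the truncated step distribution decays exponentially on the
diffusive scale around the drifted centre. -/
theorem StepBounds.abs_convExp_near_le {M K : ℝ} (hM : 0 < M) (hK : 0 < K) :
    ∃ C : ℝ, 0 < C ∧ ∀ Q : Lat d → ℝ, StepBounds M K Q → ∀ s : ℝ, 0 < s → ∀ x : Lat d,
      Real.exp (-s) * |convExp (fun y => s * near (Real.sqrt (1 + s)) Q y) (delta d) x| ≤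
        C * ((Real.sqrt (1 + s))⁻¹ ^ d *
          Real.exp (-(‖emb x - s • drift Q‖ / Real.sqrt (1 + s)))) := by
  -- The term `K/2 * (d * π²)` bounds `K/2 * |k|²` on the box. It turns the Gaussian variance `s`
  -- into `1 + s`, which keeps the bound uniform as `s → 0`.
  refine ⟨((2 * Real.pi) ^ d)⁻¹ * (Real.exp (2 * M + M ^ 2 / (2 * K) + K / 2 * (d * Real.pi ^ 2)) *
    (2 * Real.pi / K) ^ ((d : ℝ) / 2)), by positivity, fun Q h s hs x => ?_⟩
  set L := Real.sqrt (1 + s) with hLdef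
  have hL : 0 < L := Real.sqrt_pos.2 (by linarith)
  have hL2 : L ^ 2 = 1 + s := Real.sq_sqrt (by linarith)
  set E := 2 * M + M ^ 2 / (2 * K)
  set z := emb x - s • drift Q with hz
  -- the tilt along the displacement from the drifted centre gives the exponential decay
  set θ : Euc d := (L⁻¹ * ‖z‖⁻¹) • z with hθdef
  have hθ : ‖θ‖ ≤ L⁻¹ := by
    rw [hθdef, norm_smul, Real.norm_of_nonneg (by positivity), mul_assoc]
    refine mul_le_of_le_one_right (by positivity) ?_
    rcases eq_or_ne ‖z‖ 0 with h0 | h0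
    · simp [h0]
    · rw [inv_mul_cancel₀ h0]
  have hθz : inner ℝ θ z = ‖z‖ / L := by
    rw [hθdef, real_inner_smul_left, real_inner_self_eq_norm_sq]
    rcases eq_or_ne ‖z‖ 0 with h0 | h0
    · simp [h0]
    · field_simp
  set f : Lat d → ℝ := fun y => s * near L Q y
  have hA := summable_tilt_near h.summable hL hθ
  have htf : tilt f θ = fun y => s * tilt (near L Q) θ y := by
    funext y; simp only [tilt, f]; ring
  have hsf : Summable (tilt f θ) := by rw [htf]; exact hA.mul_left s
  have hinv := fourier_inversion (summable_convExp hsf (summable_delta (d := d))) x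
  have hP : convExp (tilt f θ) (delta d) x =
      convExp f (delta d) x * Real.exp (inner ℝ θ (emb x)) := by
    conv_lhs => rw [← tilt_delta θ, ← tilt_convExp]
    rfl
  have hnorm := congrArg norm hinv
  rw [norm_mul, Complex.norm_real, norm_pow, norm_mul, Complex.norm_real, Complex.norm_ofNat,
    Real.norm_of_nonneg Real.pi_pos.le, hP, norm_mul, Real.norm_of_nonneg (Real.exp_pos _).le,
    Real.norm_eq_abs] at hnorm
  have hb : ‖∫ k in box d, char k (-x) * latFourier (convExp (tilt f θ) (delta d)) k‖ ≤
      ∫ k : Euc d, Real.exp (s + s * inner ℝ θ (drift Q) + E + K / 2 * (d * Real.pi ^ 2)) *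
        Real.exp (-((1 + s) * K / 2) * ‖k‖ ^ 2) := by
    have hint : Integrable fun k : Euc d =>
        Real.exp (s + s * inner ℝ θ (drift Q) + E + K / 2 * (d * Real.pi ^ 2)) *
          Real.exp (-((1 + s) * K / 2) * ‖k‖ ^ 2) :=
      (integrable_gaussian_euc (by positivity)).const_mul _
    refine (norm_integral_le_of_norm_le hint.integrableOn ?_).trans
      (setIntegral_le_integral hint (Filter.Eventually.of_forall fun k => by positivity))
    refine (ae_restrict_iff' measurableSet_box).2 (Filter.Eventually.of_forall fun k hk => ?_)
    rw [norm_mul, norm_char, one_mul, latFourier_convExp hsf summable_delta, latFourier_delta,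
      mul_one, Complex.norm_exp, ← Real.exp_add]
    refine Real.exp_le_exp.2 ?_
    rw [htf, latFourier_const_mul, Complex.re_ofReal_mul]
    have h1 := h.near_exponent_le hM hK hs hθ hk
    have h2 := mul_le_mul_of_nonneg_left (norm_sq_le_of_mem_box hk) (by positivity : 0 ≤ K / 2)
    change s * (latFourier (tilt (near L Q) θ) k).re ≤ _
    simp only [E]
    nlinarith
  rw [hnorm, integral_const_mul, integral_gaussian_euc (by positivity)] at hb
  have hg : (Real.pi / ((1 + s) * K / 2)) ^ ((d : ℝ) / 2) =
      L⁻¹ ^ d * (2 * Real.pi / K) ^ ((d : ℝ) / 2) := by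
    have e1 : Real.pi / ((1 + s) * K / 2) = (L⁻¹ ^ 2) * (2 * Real.pi / K) := by
      rw [inv_pow, hL2]; field_simp
    rw [e1, Real.mul_rpow (by positivity) (by positivity)]
    congr 1
    rw [← Real.rpow_natCast, ← Real.rpow_mul (by positivity)]
    rw [← Real.rpow_natCast]; congr 1; push_cast; ring
  rw [hg] at hb
  have hexp : inner ℝ θ (emb x) = ‖z‖ / L + s * inner ℝ θ (drift Q) := by
    rw [← hθz, hz, inner_sub_right, real_inner_smul_right]; ring
  rw [hexp, Real.exp_add] at hb
  have e2 : Real.exp (s + s * inner ℝ θ (drift Q) + E + K / 2 * (d * Real.pi ^ 2)) =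
      Real.exp s * Real.exp (s * inner ℝ θ (drift Q)) * Real.exp (E + K / 2 * (d * Real.pi ^ 2)) := by
    rw [← Real.exp_add, ← Real.exp_add]; congr 1; ring
  rw [e2] at hb
  set p := |convExp f (delta d) x|
  set a := Real.exp (s * inner ℝ θ (drift Q))
  have ha : 0 < a := Real.exp_pos _
  rw [Real.exp_neg, Real.exp_neg]
  have hpi : (0 : ℝ) < (2 * Real.pi) ^ d := by positivity
  rw [inv_mul_le_iff₀ (Real.exp_pos _)]
  have hzp : 0 < Real.exp (‖z‖ / L) := Real.exp_pos _
  refine le_of_mul_le_mul_left (a := (2 * Real.pi) ^ d * (Real.exp (‖z‖ / L) * a)) ?_ (by positivity)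
  calc _ = (2 * Real.pi) ^ d * (p * (Real.exp (‖z‖ / L) * a)) := by ring
    _ ≤ _ := hb
    _ = _ := by field_simp

end Kernel

section KernelBound

variable {d : ℕ}

theorem hasSum_pow_natAbs {r : ℝ} (h0 : 0 ≤ r) (h1 : r < 1) :
    HasSum (fun n : ℤ => r ^ n.natAbs) ((1 - r)⁻¹ + r * (1 - r)⁻¹) := by
  have hg := hasSum_geometric_of_lt_one h0 h1
  refine HasSum.of_nat_of_neg_add_one (by simpa using hg) ?_
  have h2 : (fun n : ℕ => r ^ (-((n : ℤ) + 1)).natAbs) = fun n : ℕ => r * r ^ n := by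
    funext n
    rw [← pow_succ', show (-((n : ℤ) + 1)).natAbs = n + 1 by omega]
  rw [h2]
  exact hg.mul_left r

theorem tsum_exp_int_le {a : ℝ} (ha : 0 < a) (ha1 : a ≤ 1) (z : ℝ) :
    ∑' n : ℤ, ENNReal.ofReal (Real.exp (-(a * |(n : ℝ) - z|))) ≤ ENNReal.ofReal (12 / a) := by
  set r := Real.exp (-a) with hr
  have hr0 : 0 < r := Real.exp_pos _
  have hr1 : r ≤ 1 - a / 2 := by
    rw [hr, Real.exp_neg]
    have h1 : 1 + a ≤ Real.exp a := by linarith [Real.add_one_le_exp a]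
    refine (inv_anti₀ (by linarith) h1).trans ?_
    rw [inv_le_iff_one_le_mul₀ (by linarith)]
    nlinarith
  have hs := hasSum_pow_natAbs hr0.le (by linarith : r < 1)
  have hterm : ∀ n : ℤ, Real.exp (-(a * |((n + ⌊z⌋ : ℤ) : ℝ) - z|)) ≤
      Real.exp 1 * r ^ n.natAbs := by
    intro n
    rw [hr, ← Real.exp_nat_mul, ← Real.exp_add]
    refine Real.exp_le_exp.2 ?_
    have h1 := Int.floor_le z
    have h2 := (Int.lt_floor_add_one z).le
    have h3 : ((n.natAbs : ℕ) : ℝ) = |(n : ℝ)| := by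
      rw [Nat.cast_natAbs]; push_cast; rfl
    rw [h3]
    have h4 : |(n : ℝ)| ≤ |((n + ⌊z⌋ : ℤ) : ℝ) - z| + 1 := by
      push_cast
      have : (n : ℝ) = ((n : ℝ) + ⌊z⌋ - z) + (z - ⌊z⌋) := by ring
      calc |(n : ℝ)| = |((n : ℝ) + ⌊z⌋ - z) + (z - ⌊z⌋)| := by rw [← this]
        _ ≤ _ := (abs_add_le _ _).trans (by
          gcongr; rw [abs_of_nonneg (by linarith)]; linarith)
    nlinarith
  rw [← (Equiv.addRight ⌊z⌋).tsum_eq]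
  calc _ ≤ ∑' n : ℤ, ENNReal.ofReal (Real.exp 1 * r ^ n.natAbs) :=
        ENNReal.tsum_le_tsum fun n => ENNReal.ofReal_le_ofReal (hterm n)
    _ = ENNReal.ofReal (Real.exp 1 * ((1 - r)⁻¹ + r * (1 - r)⁻¹)) := by
        rw [← ENNReal.ofReal_tsum_of_nonneg (fun n => by positivity) (hs.mul_left _).summable,
          (hs.mul_left _).tsum_eq]
    _ ≤ _ := by
        refine ENNReal.ofReal_le_ofReal ?_
        have h1 : (1 - r)⁻¹ ≤ 2 / a := by
          rw [inv_le_comm₀ (by linarith) (by positivity), inv_div]; linarith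
        have h0 : 0 < (1 - r)⁻¹ := inv_pos.2 (by linarith)
        have h2 : r * (1 - r)⁻¹ ≤ 1 * (2 / a) := mul_le_mul (by linarith) h1 h0.le zero_le_one
        have h3 := Real.exp_one_lt_d9.le
        calc Real.exp 1 * ((1 - r)⁻¹ + r * (1 - r)⁻¹) ≤ 3 * (2 / a + 1 * (2 / a)) := by
              refine mul_le_mul (by linarith) (add_le_add h1 h2) ?_ (by norm_num)
              positivity
          _ = 12 / a := by ring

theorem tsum_pi_prod_le (f : Fin d → ℤ → ENNReal) :
    ∑' y : Lat d, ∏ i, f i (y i) ≤ ∏ i, ∑' n, f i n := by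
  rw [ENNReal.tsum_eq_iSup_sum]
  refine iSup_le fun F => ?_
  calc ∑ y ∈ F, ∏ i, f i (y i)
      ≤ ∑ y ∈ Fintype.piFinset fun i => F.image fun y => y i, ∏ i, f i (y i) := by
        refine Finset.sum_le_sum_of_subset fun y hy => ?_
        exact Fintype.mem_piFinset.2 fun i => Finset.mem_image_of_mem (fun y : Lat d => y i) hy
    _ = ∏ i, ∑ n ∈ F.image fun y => y i, f i n := (Finset.prod_univ_sum _ _).symm
    _ ≤ _ := Finset.prod_le_prod' fun i _ => ENNReal.sum_le_tsum _

theorem tsum_exp_lat_le (hd : 1 ≤ d) {L : ℝ} (hL : 1 ≤ L) (z : Euc d) :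
    ∑' y : Lat d, ENNReal.ofReal (Real.exp (-(‖emb y - z‖ / L))) ≤
      ENNReal.ofReal ((12 * d) ^ d * L ^ d) := by
  have hd' : (1 : ℝ) ≤ d := by exact_mod_cast hd
  set a : ℝ := (d * L)⁻¹ with ha
  have ha0 : 0 < a := by positivity
  have ha1 : a ≤ 1 := inv_le_one_of_one_le₀ (by nlinarith)
  calc _ ≤ ∑' y : Lat d, ∏ i, ENNReal.ofReal (Real.exp (-(a * |(y i : ℝ) - z i|))) := by
        refine ENNReal.tsum_le_tsum fun y => ?_
        rw [← ENNReal.ofReal_prod_of_nonneg fun i _ => (Real.exp_pos _).le, ← Real.exp_sum]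
        refine ENNReal.ofReal_le_ofReal (Real.exp_le_exp.2 ?_)
        rw [Finset.sum_neg_distrib, neg_le_neg_iff, ← Finset.mul_sum]
        have h1 : ∑ i, |(y i : ℝ) - z i| ≤ d * ‖emb y - z‖ := by
          refine (Finset.sum_le_card_nsmul _ _ ‖emb y - z‖ fun i _ => ?_).trans_eq (by simp)
          simpa using abs_apply_le_norm (emb y - z) i
        calc a * ∑ i, |(y i : ℝ) - z i| ≤ a * (d * ‖emb y - z‖) := by gcongr
          _ = ‖emb y - z‖ / L := by rw [ha]; field_simp
    _ ≤ ∏ i : Fin d, ∑' n : ℤ, ENNReal.ofReal (Real.exp (-(a * |(n : ℝ) - z i|))) :=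
        tsum_pi_prod_le fun i n => ENNReal.ofReal (Real.exp (-(a * |(n : ℝ) - z i|)))
    _ ≤ ∏ _i : Fin d, ENNReal.ofReal (12 / a) :=
        Finset.prod_le_prod' fun i _ => tsum_exp_int_le ha0 ha1 (z i)
    _ = _ := by
        rw [Finset.prod_const, Finset.card_univ, Fintype.card_fin,
          ← ENNReal.ofReal_pow (by positivity), ← mul_pow]
        congr 2
        rw [ha]; field_simp

/-- The profile `L^{-d} e^{-|x-z|/L}` that dominates the truncated kernel. -/
noncomputable def profile (L : ℝ) (z : Euc d) (x : Lat d) : ENNReal :=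
  ENNReal.ofReal (L⁻¹ ^ d * Real.exp (-(‖emb x - z‖ / L)))

/-- The polynomial weight `(1 + |y|/L)^m`, `m = max(2, d-1)`. -/
noncomputable def weight (L : ℝ) (y : Lat d) : ENNReal :=
  ENNReal.ofReal ((1 + ‖emb y‖ / L) ^ decayExp d)

theorem profile_le {L : ℝ} (hL : 1 ≤ L) (z : Euc d) (x : Lat d) :
    profile L z x ≤ ENNReal.ofReal (L⁻¹ ^ d) := by
  refine ENNReal.ofReal_le_ofReal (mul_le_of_le_one_right (by positivity) ?_)
  exact Real.exp_le_one_iff.2 (by simp; positivity)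

theorem pow_add_le_two_pow {a b : ℝ} (ha : 0 ≤ a) (hb : 0 ≤ b) (m : ℕ) :
    (a + b) ^ m ≤ 2 ^ m * (a ^ m + b ^ m) := by
  rcases le_total a b with h | h
  · calc (a + b) ^ m ≤ (2 * b) ^ m := by gcongr; linarith
      _ = 2 ^ m * b ^ m := mul_pow _ _ _
      _ ≤ _ := by gcongr; linarith [pow_nonneg ha m]
  · calc (a + b) ^ m ≤ (2 * a) ^ m := by gcongr; linarith
      _ = 2 ^ m * a ^ m := mul_pow _ _ _
      _ ≤ _ := by gcongr; linarith [pow_nonneg hb m]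

theorem weight_real_le {L : ℝ} (hL : 0 < L) (v w : Euc d) (m : ℕ) :
    (1 + ‖v + w‖ / L) ^ m ≤ 2 ^ m * ((1 + ‖v‖ / L) ^ m + (1 + ‖w‖ / L) ^ m) := by
  refine le_trans ?_ (pow_add_le_two_pow (by positivity) (by positivity) m)
  have : ‖v + w‖ / L ≤ ‖v‖ / L + ‖w‖ / L := by
    rw [← add_div]; gcongr; exact norm_add_le v w
  exact pow_le_pow_left₀ (by positivity) (by linarith) m

theorem weight_add_le {L : ℝ} (hL : 0 < L) (y z : Lat d) :
    weight L (y + z) ≤ ENNReal.ofReal (2 ^ decayExp d) * (weight L y + weight L z) := by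
  unfold weight
  rw [← ENNReal.ofReal_add (by positivity) (by positivity), ← ENNReal.ofReal_mul (by positivity),
    emb_add]
  exact ENNReal.ofReal_le_ofReal (weight_real_le hL _ _ _)

theorem supConv_le_l1 {L : ℝ} (hL : 1 ≤ L) (z : Euc d) (a : Lat d → ENNReal) :
    supConv (profile L z) a ≤ ENNReal.ofReal (L⁻¹ ^ d) * ∑' y, a y := by
  refine iSup_le fun x => ?_
  rw [← ENNReal.tsum_mul_left]
  exact ENNReal.tsum_le_tsum fun y => mul_le_mul_left (profile_le hL z _) _

/-- The `q`-th power of the profile is essentially supported in a ball of radius `L`. -/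
theorem tsum_profile_le (hd : 1 ≤ d) {L : ℝ} (hL : 1 ≤ L) (z : Euc d) {q : ℝ} (hq : 1 ≤ q)
    (x : Lat d) :
    ∑' y, profile L z (x - y) ^ q ≤
      ENNReal.ofReal (L⁻¹ ^ (d * q) * ((12 * d) ^ d * L ^ d)) := by
  have h1 : ∀ y, profile L z (x - y) ^ q ≤ ENNReal.ofReal (L⁻¹ ^ (d * q)) *
      ENNReal.ofReal (Real.exp (-(‖emb y - (emb x - z)‖ / L))) := by
    intro y
    rw [profile, ENNReal.ofReal_rpow_of_nonneg (by positivity) (by linarith),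
      ← ENNReal.ofReal_mul (by positivity)]
    refine ENNReal.ofReal_le_ofReal ?_
    rw [Real.mul_rpow (by positivity) (Real.exp_pos _).le, ← Real.rpow_natCast,
      ← Real.rpow_mul (by positivity)]
    gcongr
    have h2 : ‖emb (x - y) - z‖ = ‖emb y - (emb x - z)‖ := by
      rw [emb_sub, ← norm_neg]; congr 1; abel
    rw [h2]
    exact Real.rpow_le_self_of_le_one (Real.exp_pos _).le
      (Real.exp_le_one_iff.2 (by simp; positivity)) hq
  refine (ENNReal.tsum_le_tsum h1).trans ?_
  rw [ENNReal.tsum_mul_left, ENNReal.ofReal_mul (by positivity)]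
  gcongr
  exact tsum_exp_lat_le hd hL _

/-- Hölder's inequality against the profile, whose `ℓ^q` norm is of order `L^{-d/p}`. -/
theorem supConv_le_lp (hd : 1 ≤ d) {L : ℝ} (hL : 1 ≤ L) (z : Euc d) {p q : ℝ}
    (hpq : p.HolderConjugate q) (a : Lat d → ENNReal) :
    supConv (profile L z) a ≤
      ENNReal.ofReal ((12 * d) ^ d * L ^ (-(d / p))) * (∑' y, a y ^ p) ^ (1 / p) := by
  have hd' : (1 : ℝ) ≤ d := by exact_mod_cast hd
  have hL0 : 0 < L := by linarith
  refine iSup_le fun x => ?_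
  have h1 := ENNReal.lintegral_mul_le_Lp_mul_Lq (Measure.count : Measure (Lat d)) hpq.symm
    (f := fun y => profile L z (x - y)) (g := a) (Measurable.of_discrete).aemeasurable
    (Measurable.of_discrete).aemeasurable
  simp only [lintegral_count_lat, Pi.mul_apply] at h1
  refine h1.trans ?_
  gcongr
  have hq : 1 < q := hpq.symm.lt
  have hC : (1 : ℝ) ≤ (12 * d) ^ d := one_le_pow₀ (by linarith)
  calc (∑' y, profile L z (x - y) ^ q) ^ (1 / q)
      ≤ (ENNReal.ofReal (L⁻¹ ^ (d * q) * ((12 * d) ^ d * L ^ d))) ^ (1 / q) := by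
        gcongr; exact tsum_profile_le hd hL z hq.le x
    _ = ENNReal.ofReal (((12 * d) ^ d) ^ (1 / q) * L ^ (-(d / p))) := by
        rw [ENNReal.ofReal_rpow_of_nonneg (by positivity) (by positivity)]
        congr 1
        have e1 : L⁻¹ ^ ((d : ℝ) * q) * ((12 * d : ℝ) ^ d * L ^ d) =
            (12 * d : ℝ) ^ d * L ^ ((d : ℝ) - d * q) := by
          rw [Real.inv_rpow hL0.le, Real.rpow_sub hL0, Real.rpow_natCast]; field_simp
        rw [e1, Real.mul_rpow (by positivity) (by positivity), ← Real.rpow_mul hL0.le]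
        congr 2
        have h3 := hpq.inv_add_inv_eq_one
        have hp0 := hpq.pos
        have hq0 := hpq.symm.pos
        field_simp at h3 ⊢
        nlinarith
    _ ≤ _ := by
        refine ENNReal.ofReal_le_ofReal ?_
        gcongr
        exact Real.rpow_le_self_of_one_le hC (by rw [div_le_one (by linarith)]; linarith)

theorem StepBounds.of_inQ {M K ζ : ℝ} (hM : 0 < M) (hζ : 0 < ζ) {Q g : Lat d → ℝ}
    (h : InQ M K ζ Q g) (hQ : ∑' y, Q y ≤ 1) : StepBounds M K Q :=
  ⟨h.sum_Q hM, h.sum_norm_Q hM hζ, h.sum_sq_Q hM hζ, h.infrared, hQ⟩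

/-- On steps longer than `L`, the weight is at most `(2|y|/L)^m`. -/
theorem abs_mul_le_of_far {L : ℝ} (hL : 0 < L) {Q : Lat d → ℝ} {m : ℕ} (y : Lat d) :
    (1 + ‖emb y‖ / L) ^ m * |far L Q y| ≤ 2 ^ m * L⁻¹ ^ m * (‖emb y‖ ^ m * |Q y|) := by
  by_cases hy : ‖emb y‖ ≤ L
  · simp only [far, hy, if_true, abs_zero, mul_zero]; positivity
  · simp only [far, hy, if_false]
    push Not at hy
    have h1 : 1 ≤ ‖emb y‖ / L := by rw [one_le_div hL]; exact hy.le
    calc _ ≤ (2 * (‖emb y‖ / L)) ^ m * |Q y| := by gcongr; linarith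
      _ = _ := by rw [mul_pow, div_eq_mul_inv, mul_pow]; ring

/-- The long steps of the semigroup at time `s` have bounded weighted norm on the diffusive scale
`L = √(1+s)`: by a second moment, the rate `s` is compensated by `L^{-2}`. -/
theorem wnorm_far_le (hd : 1 ≤ d) {M K ζ : ℝ} (hM : 0 < M) (hζ : 0 < ζ) :
    ∃ C : ℝ, 0 < C ∧ ∀ Q g : Lat d → ℝ, InQ M K ζ Q g → ∀ s : ℝ, 0 < s → ∀ z : Euc d,
      wnorm (ENNReal.ofReal (Real.sqrt (1 + s) ^ d)) (profile (Real.sqrt (1 + s)) z)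
        (weight (Real.sqrt (1 + s))) (fun y => s * far (Real.sqrt (1 + s)) Q y) ≤
          ENNReal.ofReal C := by
  have hd' : (1 : ℝ) ≤ d := by exact_mod_cast hd
  set m := decayExp d with hm
  refine ⟨M + (12 * d) ^ d * (2 ^ m * M), by positivity, fun Q g h s hs z => ?_⟩
  set L := Real.sqrt (1 + s) with hLdef
  have hL1 : 1 ≤ L := Real.one_le_sqrt.2 (by linarith)
  have hL : 0 < L := by linarith
  have hL2 : L ^ 2 = 1 + s := Real.sq_sqrt (by linarith)
  have hC1 : (1 : ℝ) ≤ (12 * d) ^ d := one_le_pow₀ (by linarith)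
  have hsL : s * L⁻¹ ^ 2 ≤ 1 := by
    rw [inv_pow, hL2, mul_inv_le_iff₀ (by linarith)]; linarith
  have hfar : ∀ y, ‖s * far L Q y‖ₑ = ENNReal.ofReal (s * |far L Q y|) := fun y => by
    rw [Real.enorm_eq_ofReal_abs, abs_mul, abs_of_pos hs]
  have hwf : ∀ y, weight L y * ‖s * far L Q y‖ₑ ≤
      ENNReal.ofReal (2 ^ m * (s * L⁻¹ ^ m) * (‖emb y‖ ^ m * |Q y|)) := fun y => by
    rw [hfar, weight, ← ENNReal.ofReal_mul (by positivity)]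
    refine ENNReal.ofReal_le_ofReal ?_
    have := mul_le_mul_of_nonneg_left (abs_mul_le_of_far hL (Q := Q) (m := m) y) hs.le
    linarith
  rw [wnorm, ENNReal.ofReal_add (by positivity) (by positivity)]
  refine add_le_add ?_ ?_
  · have h2 := h.sum_sq_Q hM hζ
    have h1 : ∀ y, ‖s * far L Q y‖ₑ ≤ ENNReal.ofReal (‖emb y‖ ^ 2 * |Q y|) := fun y => by
      rw [hfar]
      refine ENNReal.ofReal_le_ofReal ?_
      by_cases hy : ‖emb y‖ ≤ L
      · simp only [far, hy, if_true, abs_zero, mul_zero]; positivity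
      · simp only [far, hy, if_false]
        push Not at hy
        have : s ≤ ‖emb y‖ ^ 2 := by nlinarith
        gcongr
    refine (ENNReal.tsum_le_tsum h1).trans ?_
    rw [← ENNReal.ofReal_tsum_of_nonneg (fun y => by positivity) h2.1]
    exact ENNReal.ofReal_le_ofReal h2.2
  · rcases lt_or_ge d 4 with h4 | h4
    · -- In dimensions up to three `m = 2`, and the second moment in `ℓ^1` suffices.
      have hm2 : m = 2 := by rw [hm]; unfold decayExp; omega
      have h2 := h.sum_sq_Q hM hζ
      have h3 := (supConv_le_l1 hL1 z fun y => weight L y * ‖s * far L Q y‖ₑ).trans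
        (mul_le_mul_right (ENNReal.tsum_le_tsum hwf) _)
      rw [hm2] at h3 ⊢
      rw [← ENNReal.ofReal_tsum_of_nonneg (fun y => by positivity) (h2.1.mul_left _),
        tsum_mul_left, ← ENNReal.ofReal_mul (by positivity)] at h3
      refine (mul_le_mul_right h3 _).trans ?_
      rw [← ENNReal.ofReal_mul (by positivity)]
      refine ENNReal.ofReal_le_ofReal ?_
      rw [← mul_assoc, ← mul_pow, mul_inv_cancel₀ hL.ne', one_pow, one_mul]
      calc 2 ^ 2 * (s * L⁻¹ ^ 2) * ∑' y, ‖emb y‖ ^ 2 * |Q y| ≤ 2 ^ 2 * 1 * M := by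
            gcongr; exact h2.2
        _ = 1 * (2 ^ 2 * M) := by ring
        _ ≤ _ := by gcongr
    · -- From dimension four on, the moment of order `d - 1` is controlled in `ℓ^p` with
      -- `p = min (d/3) 2`, and Hölder's inequality provides the factor `L^{-d/p} ≤ L^{-3}`.
      have hm2 : m = d - 1 := by rw [hm]; unfold decayExp; omega
      have hd4 : (4 : ℝ) ≤ d := by exact_mod_cast h4
      set p : ℝ := min (d / 3) 2 with hp
      have hp1 : 1 < p := lt_min (by linarith) one_lt_two
      have hpd : p ≤ d / 3 := min_le_left _ _
      have hpq := Real.HolderConjugate.conjExponent hp1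
      have h2 := sumLE_of_latNorm (by linarith) hM.le (h.Q_high h4)
      have h3 := (supConv_le_lp hd hL1 z hpq fun y => weight L y * ‖s * far L Q y‖ₑ)
      have h5 : (∑' y, (weight L y * ‖s * far L Q y‖ₑ) ^ p) ^ (1 / p) ≤
          ENNReal.ofReal (2 ^ m * (s * L⁻¹ ^ m) * M) := by
        have h6 : ∑' y, (weight L y * ‖s * far L Q y‖ₑ) ^ p ≤
            ENNReal.ofReal ((2 ^ m * (s * L⁻¹ ^ m) * M) ^ p) := by
          calc _ ≤ ∑' y, ENNReal.ofReal ((2 ^ m * (s * L⁻¹ ^ m)) ^ p *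
                |‖emb y‖ ^ (d - 1) * Q y| ^ p) := by
                refine ENNReal.tsum_le_tsum fun y => ?_
                refine (ENNReal.rpow_le_rpow (hwf y) (by linarith)).trans_eq ?_
                rw [ENNReal.ofReal_rpow_of_nonneg (by positivity) (by linarith),
                  Real.mul_rpow (by positivity) (by positivity), abs_mul,
                  abs_of_nonneg (by positivity : 0 ≤ ‖emb y‖ ^ (d - 1)), hm2]
            _ ≤ _ := by
                rw [← ENNReal.ofReal_tsum_of_nonneg (fun y => by positivity) (h2.1.mul_left _),
                  tsum_mul_left, Real.mul_rpow (by positivity) hM.le]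
                refine ENNReal.ofReal_le_ofReal ?_
                gcongr
                exact h2.2
        refine (ENNReal.rpow_le_rpow h6 (by positivity)).trans_eq ?_
        rw [ENNReal.ofReal_rpow_of_nonneg (by positivity) (by positivity),
          ← Real.rpow_mul (by positivity), mul_one_div_cancel (by linarith), Real.rpow_one]
      refine (mul_le_mul_right (h3.trans (mul_le_mul_right h5 _)) _).trans ?_
      rw [← ENNReal.ofReal_mul (by positivity), ← ENNReal.ofReal_mul (by positivity)]
      refine ENNReal.ofReal_le_ofReal ?_
      -- the powers of `L` combine to `L^{3 - d/p} ≤ 1`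
      have h7 : L ^ d * L ^ (-(d / p)) * (s * L⁻¹ ^ m) ≤ 1 := by
        have e1 : L ^ d * L⁻¹ ^ m = L := by
          rw [hm2]
          obtain ⟨e, rfl⟩ : ∃ e, d = e + 1 := ⟨d - 1, by omega⟩
          simp only [Nat.add_sub_cancel]
          rw [pow_succ, mul_right_comm, ← mul_pow, mul_inv_cancel₀ hL.ne', one_pow, one_mul]
        have e2 : L ^ (-(d / p)) ≤ L ^ (-3 : ℝ) := by
          refine Real.rpow_le_rpow_of_exponent_le hL1 ?_
          rw [neg_le_neg_iff, le_div_iff₀ (by linarith)]; linarith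
        have e3 : L ^ (-3 : ℝ) = L⁻¹ ^ 3 := by
          rw [Real.rpow_neg hL.le, inv_pow]; norm_cast
        calc L ^ d * L ^ (-(d / p)) * (s * L⁻¹ ^ m) = (L ^ d * L⁻¹ ^ m) * s * L ^ (-(d / p)) := by
              ring
          _ ≤ L * s * L⁻¹ ^ 3 := by rw [e1, ← e3]; gcongr
          _ = s * L⁻¹ ^ 2 := by field_simp
          _ ≤ 1 := hsL
      calc L ^ d * ((12 * d) ^ d * L ^ (-(d / p)) * (2 ^ m * (s * L⁻¹ ^ m) * M))
          = (12 * d) ^ d * (2 ^ m * M) * (L ^ d * L ^ (-(d / p)) * (s * L⁻¹ ^ m)) := by ring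
        _ ≤ (12 * d) ^ d * (2 ^ m * M) * 1 := by gcongr
        _ = _ := by ring

/-- The source has bounded weighted norm: its `ℓ^1` norm bounds the part with weight `1`, and the
`ℓ^2` norm of its moment of order `m ≥ d/2` the part with weight `(|y|/L)^m`. -/
theorem wnorm_source_le (hd : 1 ≤ d) {M K ζ : ℝ} (hM : 0 < M) (hζ : 0 < ζ) :
    ∃ C : ℝ, 0 < C ∧ ∀ Q g : Lat d → ℝ, InQ M K ζ Q g → ∀ L : ℝ, 1 ≤ L → ∀ z : Euc d,
      wnorm (ENNReal.ofReal (L ^ d)) (profile L z) (weight L) g ≤ ENNReal.ofReal C := by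
  have hd' : (1 : ℝ) ≤ d := by exact_mod_cast hd
  set m := decayExp d with hm
  refine ⟨M + (2 ^ m * M + (12 * d) ^ d * (2 ^ m * M)), by positivity, fun Q g h L hL1 z => ?_⟩
  have hL : 0 < L := by linarith
  have h1 := h.sum_g hM
  have h2 := h.sum_sq_moment_g hM hζ hd
  have hn : ∀ y, ‖g y‖ₑ = ENNReal.ofReal |g y| := fun y => Real.enorm_eq_ofReal_abs _
  have hs1 : ∑' y, ENNReal.ofReal |g y| ≤ ENNReal.ofReal M := by
    rw [← ENNReal.ofReal_tsum_of_nonneg (fun y => abs_nonneg _) h1.1]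
    exact ENNReal.ofReal_le_ofReal h1.2
  have hw : ∀ y, weight L y * ‖g y‖ₑ ≤ ENNReal.ofReal (2 ^ m) * ENNReal.ofReal |g y| +
      ENNReal.ofReal (2 ^ m * L⁻¹ ^ m) * ENNReal.ofReal (‖emb y‖ ^ m * |g y|) := fun y => by
    rw [hn, weight, ← ENNReal.ofReal_mul (by positivity), ← ENNReal.ofReal_mul (by positivity),
      ← ENNReal.ofReal_mul (by positivity), ← ENNReal.ofReal_add (by positivity) (by positivity)]
    refine ENNReal.ofReal_le_ofReal ?_
    have e1 := pow_add_le_two_pow zero_le_one (by positivity : 0 ≤ ‖emb y‖ / L) m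
    have e2 := mul_le_mul_of_nonneg_right e1 (abs_nonneg (g y))
    rw [one_pow, div_eq_mul_inv, mul_pow] at e2
    rw [div_eq_mul_inv]
    linarith
  have hA := supConv_le_l1 hL1 z fun y => ENNReal.ofReal (2 ^ m) * ENNReal.ofReal |g y|
  have hB := supConv_le_lp hd hL1 z (Real.HolderConjugate.two_two) fun y =>
    ENNReal.ofReal (2 ^ m * L⁻¹ ^ m) * ENNReal.ofReal (‖emb y‖ ^ m * |g y|)
  have hsum : supConv (profile L z) (fun y => weight L y * ‖g y‖ₑ) ≤
      supConv (profile L z) (fun y => ENNReal.ofReal (2 ^ m) * ENNReal.ofReal |g y|) +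
        supConv (profile L z) (fun y =>
          ENNReal.ofReal (2 ^ m * L⁻¹ ^ m) * ENNReal.ofReal (‖emb y‖ ^ m * |g y|)) := by
    refine iSup_le fun x => ?_
    refine (ENNReal.tsum_le_tsum fun y => mul_le_mul_right (hw y) _).trans ?_
    simp_rw [mul_add]
    rw [ENNReal.tsum_add]
    exact add_le_add (le_iSup (fun x => ∑' y, profile L z (x - y) *
      (ENNReal.ofReal (2 ^ m) * ENNReal.ofReal |g y|)) x) (le_iSup (fun x => ∑' y,
        profile L z (x - y) * (ENNReal.ofReal (2 ^ m * L⁻¹ ^ m) *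
          ENNReal.ofReal (‖emb y‖ ^ m * |g y|))) x)
  rw [wnorm, ENNReal.ofReal_add (by positivity) (by positivity),
    ENNReal.ofReal_add (by positivity) (by positivity)]
  refine add_le_add (by simpa only [hn] using hs1) ?_
  refine (mul_le_mul_right hsum _).trans ?_
  rw [mul_add]
  refine add_le_add ?_ ?_
  · refine (mul_le_mul_right hA _).trans ?_
    rw [ENNReal.tsum_mul_left, ← mul_assoc, ← mul_assoc, ← ENNReal.ofReal_mul (by positivity),
      ← mul_pow, mul_inv_cancel₀ hL.ne', one_pow, ENNReal.ofReal_one, one_mul,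
      ENNReal.ofReal_mul (by positivity)]
    exact mul_le_mul_right hs1 _
  · have hB2 : (∑' y, (ENNReal.ofReal (2 ^ m * L⁻¹ ^ m) *
        ENNReal.ofReal (‖emb y‖ ^ m * |g y|)) ^ (2 : ℝ)) ^ (1 / (2 : ℝ)) ≤
          ENNReal.ofReal (2 ^ m * L⁻¹ ^ m * M) := by
      have h6 : ∑' y, (ENNReal.ofReal (2 ^ m * L⁻¹ ^ m) *
          ENNReal.ofReal (‖emb y‖ ^ m * |g y|)) ^ (2 : ℝ) ≤
            ENNReal.ofReal ((2 ^ m * L⁻¹ ^ m * M) ^ (2 : ℝ)) := by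
        calc _ = ∑' y, ENNReal.ofReal ((2 ^ m * L⁻¹ ^ m) ^ 2 * (‖emb y‖ ^ m * |g y|) ^ 2) := by
              refine tsum_congr fun y => ?_
              rw [← ENNReal.ofReal_mul (by positivity),
                ENNReal.ofReal_rpow_of_nonneg (by positivity) (by norm_num),
                Real.rpow_two, mul_pow (2 ^ m * L⁻¹ ^ m)]
          _ ≤ _ := by
              rw [← ENNReal.ofReal_tsum_of_nonneg (fun y => by positivity) (h2.1.mul_left _),
                tsum_mul_left, Real.rpow_two, mul_pow _ M]
              refine ENNReal.ofReal_le_ofReal ?_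
              gcongr
              exact h2.2
      refine (ENNReal.rpow_le_rpow h6 (by positivity)).trans_eq ?_
      rw [ENNReal.ofReal_rpow_of_nonneg (by positivity) (by positivity),
        ← Real.rpow_mul (by positivity), mul_one_div_cancel (by norm_num), Real.rpow_one]
    refine (mul_le_mul_right (hB.trans (mul_le_mul_right hB2 _)) _).trans ?_
    rw [← ENNReal.ofReal_mul (by positivity), ← ENNReal.ofReal_mul (by positivity)]
    refine ENNReal.ofReal_le_ofReal ?_
    -- the powers of `L` combine to `L^{d/2 - m} ≤ 1`
    have h7 : L ^ d * L ^ (-((d : ℝ) / 2)) * L⁻¹ ^ m ≤ 1 := by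
      have hdm : (d : ℝ) ≤ 2 * m := by
        have : d ≤ 2 * m := by rw [hm]; unfold decayExp; omega
        exact_mod_cast this
      rw [← Real.rpow_natCast L d, ← Real.rpow_natCast L⁻¹ m, Real.inv_rpow hL.le,
        ← Real.rpow_neg hL.le, ← Real.rpow_add hL, ← Real.rpow_add hL]
      exact Real.rpow_le_one_of_one_le_of_nonpos hL1 (by linarith)
    calc L ^ d * ((12 * d) ^ d * L ^ (-((d : ℝ) / 2)) * (2 ^ m * L⁻¹ ^ m * M))
        = (12 * d) ^ d * (2 ^ m * M) * (L ^ d * L ^ (-((d : ℝ) / 2)) * L⁻¹ ^ m) := by ring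
      _ ≤ (12 * d) ^ d * (2 ^ m * M) * 1 := by gcongr
      _ = _ := by ring

end KernelBound

section SemiKernel

variable {d : ℕ}

/-- The kernel `q_s(x) = (2π)^{-d} ∫ e^{ik·x} ĝ(k) e^{-s(1 - Q̂(k))} dk` of the semigroup generated
by `Q - δ`, applied to `g`. Formally `∫_0^∞ q_s(x) ds` has Fourier transform `ĝ/(1 - Q̂)`. -/
noncomputable def semiKernel (Q g : Lat d → ℝ) (s : ℝ) (x : Lat d) : ℂ :=
  ((2 * (Real.pi : ℂ)) ^ d)⁻¹ * ∫ k in box d, char k (-x) *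
    (latFourier g k * Complex.exp (-(s : ℂ) * (1 - latFourier Q k)))

theorem summable_near {L : ℝ} {Q : Lat d → ℝ} (hQ : Summable Q) : Summable (near L Q) :=
  Summable.of_norm_bounded hQ.abs fun y => abs_near_le L Q y

theorem summable_far {L : ℝ} {Q : Lat d → ℝ} (hQ : Summable Q) : Summable (far L Q) :=
  Summable.of_norm_bounded hQ.abs fun y => abs_far_le L Q y

/-- The semigroup factorises over a splitting of the steps into short and long ones. -/
theorem semiKernel_eq_latConv {Q g : Lat d → ℝ} (hQ : Summable Q) (hg : Summable g) (s L : ℝ)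
    (x : Lat d) : semiKernel Q g s x =
      ((Real.exp (-s) * latConv (convExp (fun y => s * near L Q y) (delta d))
        (convExp (fun y => s * far L Q y) g) x : ℝ) : ℂ) := by
  have hn : Summable fun y => s * near L Q y := (summable_near hQ).mul_left s
  have hf : Summable fun y => s * far L Q y := (summable_far hQ).mul_left s
  have hP := summable_convExp hn (summable_delta (d := d))
  have hH := summable_convExp hf hg
  have hinv := fourier_inversion (summable_latConv hP hH) x
  have hpi : ((2 * (Real.pi : ℂ)) ^ d) ≠ 0 :=
    pow_ne_zero _ (by simp [Real.pi_ne_zero])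
  have hsum : ∀ k, latFourier (near L Q) k + latFourier (far L Q) k = latFourier Q k := by
    intro k
    rw [latFourier_eq, latFourier_eq, latFourier_eq,
      ← (summable_mul_char (summable_near hQ) k).tsum_add (summable_mul_char (summable_far hQ) k)]
    refine tsum_congr fun y => ?_
    rw [← near_add_far L Q y]; push_cast; ring
  have hint : ∀ k : Euc d, char k (-x) *
      (latFourier g k * Complex.exp (-(s : ℂ) * (1 - latFourier Q k))) =
      Complex.exp (-s) * (char k (-x) * latFourier (latConv (convExp (fun y => s * near L Q y)
        (delta d)) (convExp (fun y => s * far L Q y) g)) k) := by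
    intro k
    rw [latFourier_latConv hP hH, latFourier_convExp hn summable_delta, latFourier_convExp hf hg,
      latFourier_delta, latFourier_const_mul, latFourier_const_mul, ← hsum k]
    have : -(s : ℂ) * (1 - (latFourier (near L Q) k + latFourier (far L Q) k)) =
        -s + s * latFourier (near L Q) k + s * latFourier (far L Q) k := by ring
    rw [this, Complex.exp_add, Complex.exp_add]; ring
  rw [semiKernel]
  simp_rw [hint]
  rw [integral_const_mul, hinv]
  push_cast
  field_simp

theorem one_add_pow_mul_exp_neg_le (m : ℕ) {u : ℝ} (hu : 0 ≤ u) :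
    (1 + u) ^ m * Real.exp (-u) ≤ m.factorial * Real.exp 1 := by
  have h1 := Real.pow_div_factorial_le_exp (1 + u) (by linarith) m
  rw [div_le_iff₀ (by positivity), Real.exp_add] at h1
  calc (1 + u) ^ m * Real.exp (-u) ≤
      (Real.exp 1 * Real.exp u * m.factorial) * Real.exp (-u) := by gcongr
    _ = m.factorial * Real.exp 1 * (Real.exp u * Real.exp (-u)) := by ring
    _ = _ := by rw [← Real.exp_add]; simp

/-- The kernels live on the diffusive scale around the drifted centre, with polynomial decay
beyond. Short steps are tilted, which gives exponential decay for them; long steps enter through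
their weighted norm. -/
theorem norm_semiKernel_le (hd : 1 ≤ d) {M K ζ : ℝ} (hM : 0 < M) (hK : 0 < K) (hζ : 0 < ζ) :
    ∃ C : ℝ, 0 < C ∧ ∀ Q g : Lat d → ℝ, InQ M K ζ Q g → ∑' y, Q y ≤ 1 →
      ∀ s : ℝ, 0 < s → ∀ x : Lat d, ‖semiKernel Q g s x‖ *
        (1 + ‖emb x - s • drift Q‖ / Real.sqrt (1 + s)) ^ decayExp d ≤
          C * (Real.sqrt (1 + s))⁻¹ ^ d := by
  obtain ⟨C1, hC1, hP⟩ := StepBounds.abs_convExp_near_le (d := d) hM hK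
  obtain ⟨C2, hC2, hfar⟩ := wnorm_far_le (d := d) (K := K) hd hM hζ
  obtain ⟨C3, hC3, hsrc⟩ := wnorm_source_le (d := d) (K := K) hd hM hζ
  set m := decayExp d with hm
  set C4 : ℝ := Real.exp (2 ^ m * C2) * C3
  set C5 : ℝ := m.factorial * Real.exp 1
  refine ⟨C1 * 2 ^ m * (C5 * C4 + C4), by positivity, fun Q g h hQ s hs x => ?_⟩
  set L := Real.sqrt (1 + s) with hLdef
  have hL1 : 1 ≤ L := Real.one_le_sqrt.2 (by linarith)
  have hL : 0 < L := by linarith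
  have hSB := StepBounds.of_inQ hM hζ h hQ
  set z := s • drift Q
  set P := convExp (fun y => s * near L Q y) (delta d)
  set H := convExp (fun y => s * far L Q y) g
  set c := ENNReal.ofReal (L ^ d)
  have hH : wnorm c (profile L z) (weight L) H ≤ ENNReal.ofReal C4 := by
    have h1 := wnorm_convExp_le (c := c) (G := profile L z) (w := weight L)
      (D := ENNReal.ofReal (2 ^ m)) (by simpa using one_le_pow₀ one_le_two)
      (weight_add_le hL) (fun y => s * far L Q y) g (κ := 2 ^ m * C2) (by positivity)
      (by rw [ENNReal.ofReal_mul (by positivity)]; gcongr; exact hfar Q g h s hs z)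
    refine h1.trans ?_
    rw [ENNReal.ofReal_mul (by positivity)]
    gcongr
    exact hsrc Q g h L hL1 z
  have hH1 : ∑' y, ‖H y‖ₑ ≤ ENNReal.ofReal C4 := le_self_add.trans hH
  have hHw : supConv (profile L z) (fun y => weight L y * ‖H y‖ₑ) ≤
      ENNReal.ofReal (L⁻¹ ^ d * C4) := by
    have h1 : c * supConv (profile L z) (fun y => weight L y * ‖H y‖ₑ) ≤ ENNReal.ofReal C4 :=
      (le_add_self).trans hH
    rw [ENNReal.ofReal_mul (by positivity)]
    have h2 : ENNReal.ofReal (L⁻¹ ^ d) * c = 1 := by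
      rw [← ENNReal.ofReal_mul (by positivity), ← mul_pow, inv_mul_cancel₀ hL.ne', one_pow,
        ENNReal.ofReal_one]
    calc _ = ENNReal.ofReal (L⁻¹ ^ d) *
          (c * supConv (profile L z) (fun y => weight L y * ‖H y‖ₑ)) := by
          rw [← mul_assoc, h2, one_mul]
      _ ≤ _ := by gcongr
  have hPe : ∀ y, ENNReal.ofReal (Real.exp (-s)) * ‖P y‖ₑ ≤
      ENNReal.ofReal C1 * profile L z y := fun y => by
    rw [Real.enorm_eq_ofReal_abs, ← ENNReal.ofReal_mul (Real.exp_pos _).le, profile,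
      ← ENNReal.ofReal_mul hC1.le]
    exact ENNReal.ofReal_le_ofReal (hP Q hSB s hs y)
  set W : ENNReal := ENNReal.ofReal ((1 + ‖emb x - z‖ / L) ^ m) with hW
  have hmain : ENNReal.ofReal (Real.exp (-s)) * ‖latConv P H x‖ₑ * W ≤
      ENNReal.ofReal (C1 * 2 ^ m * (C5 * C4 + C4) * L⁻¹ ^ d) := by
    have hterm : ∀ y, ENNReal.ofReal (Real.exp (-s)) * (‖P (x - y)‖ₑ * ‖H y‖ₑ) * W ≤
        ENNReal.ofReal (C1 * 2 ^ m) * (ENNReal.ofReal (L⁻¹ ^ d * C5) * ‖H y‖ₑ +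
          profile L z (x - y) * (weight L y * ‖H y‖ₑ)) := by
      intro y
      have h1 : W ≤ ENNReal.ofReal (2 ^ m) *
          (ENNReal.ofReal ((1 + ‖emb (x - y) - z‖ / L) ^ m) + weight L y) := by
        rw [hW, weight, ← ENNReal.ofReal_add (by positivity) (by positivity),
          ← ENNReal.ofReal_mul (by positivity)]
        refine ENNReal.ofReal_le_ofReal ?_
        have h2 := weight_real_le hL (emb (x - y) - z) (emb y) m
        rwa [show emb (x - y) - z + emb y = emb x - z by rw [emb_sub]; abel] at h2
      have h2 : profile L z (x - y) * ENNReal.ofReal ((1 + ‖emb (x - y) - z‖ / L) ^ m) ≤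
          ENNReal.ofReal (L⁻¹ ^ d * C5) := by
        rw [profile, ← ENNReal.ofReal_mul (by positivity)]
        refine ENNReal.ofReal_le_ofReal ?_
        have h3 := one_add_pow_mul_exp_neg_le m
          (by positivity : 0 ≤ ‖emb (x - y) - z‖ / L)
        calc _ = L⁻¹ ^ d * ((1 + ‖emb (x - y) - z‖ / L) ^ m *
              Real.exp (-(‖emb (x - y) - z‖ / L))) := by ring
          _ ≤ _ := by gcongr
      calc _ = (ENNReal.ofReal (Real.exp (-s)) * ‖P (x - y)‖ₑ) * ‖H y‖ₑ * W := by ring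
        _ ≤ (ENNReal.ofReal C1 * profile L z (x - y)) * ‖H y‖ₑ * (ENNReal.ofReal (2 ^ m) *
          (ENNReal.ofReal ((1 + ‖emb (x - y) - z‖ / L) ^ m) + weight L y)) :=
            mul_le_mul' (mul_le_mul' (hPe _) le_rfl) h1
        _ = ENNReal.ofReal (C1 * 2 ^ m) * ((profile L z (x - y) *
              ENNReal.ofReal ((1 + ‖emb (x - y) - z‖ / L) ^ m)) * ‖H y‖ₑ +
              profile L z (x - y) * (weight L y * ‖H y‖ₑ)) := by
            rw [ENNReal.ofReal_mul hC1.le]; ring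
        _ ≤ _ := by gcongr
    calc ENNReal.ofReal (Real.exp (-s)) * ‖latConv P H x‖ₑ * W
        ≤ ENNReal.ofReal (Real.exp (-s)) * (∑' y, ‖P (x - y)‖ₑ * ‖H y‖ₑ) * W := by
          gcongr; exact enorm_latConv_le P H x
      _ = ∑' y, ENNReal.ofReal (Real.exp (-s)) * (‖P (x - y)‖ₑ * ‖H y‖ₑ) * W := by
          rw [← ENNReal.tsum_mul_left, ← ENNReal.tsum_mul_right]
      _ ≤ _ := ENNReal.tsum_le_tsum hterm
      _ = ENNReal.ofReal (C1 * 2 ^ m) * (ENNReal.ofReal (L⁻¹ ^ d * C5) * ∑' y, ‖H y‖ₑ +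
          ∑' y, profile L z (x - y) * (weight L y * ‖H y‖ₑ)) := by
          rw [ENNReal.tsum_mul_left, ENNReal.tsum_add, ENNReal.tsum_mul_left]
      _ ≤ ENNReal.ofReal (C1 * 2 ^ m) * (ENNReal.ofReal (L⁻¹ ^ d * C5) * ENNReal.ofReal C4 +
          ENNReal.ofReal (L⁻¹ ^ d * C4)) := by
          gcongr
          exact (le_iSup (fun x => ∑' y, profile L z (x - y) * (weight L y * ‖H y‖ₑ)) x).trans hHw
      _ = _ := by
          rw [← ENNReal.ofReal_mul (by positivity), ← ENNReal.ofReal_add (by positivity)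
            (by positivity), ← ENNReal.ofReal_mul (by positivity)]
          congr 1; ring
  rw [Real.enorm_eq_ofReal_abs, hW, ← ENNReal.ofReal_mul (by positivity),
    ← ENNReal.ofReal_mul (by positivity), ENNReal.ofReal_le_ofReal_iff (by positivity)] at hmain
  rw [semiKernel_eq_latConv hSB.summable (summable_abs_iff.1 (h.sum_g hM).1) s L x,
    Complex.norm_real, norm_mul, Real.norm_of_nonneg (Real.exp_pos _).le]
  exact hmain

end SemiKernel

/-! ### Heat kernels -/

section Heat

variable {d : ℕ}

/-- The quadratic form `v ↦ v·Λv`. -/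
noncomputable def quad (Λ : Matrix (Fin d) (Fin d) ℝ) (v : Euc d) : ℝ :=
  v.ofLp ⬝ᵥ (Matrix.mulVec Λ v.ofLp)

theorem quad_eq_inner (Λ : Matrix (Fin d) (Fin d) ℝ) (v : Euc d) :
    quad Λ v = inner ℝ v (WithLp.toLp 2 (Matrix.mulVec Λ v.ofLp)) := by
  rw [EuclideanSpace.inner_eq_star_dotProduct, star_trivial, dotProduct_comm]
  rfl

theorem quad_eq_sum_of_basis {A : Matrix (Fin d) (Fin d) ℝ} (hA : A.IsSymm)
    (b : OrthonormalBasis (Fin d) ℝ (Euc d)) (c : Fin d → ℝ)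
    (hb : ∀ i, Matrix.mulVec A (b i).ofLp = c i • (b i).ofLp) (v : Euc d) :
    quad A v = ∑ i, c i * (b.repr v i) ^ 2 := by
  rw [quad_eq_inner, ← b.sum_inner_mul_inner]
  refine Finset.sum_congr rfl fun i _ => ?_
  have h1 : inner ℝ (b i) (WithLp.toLp 2 (Matrix.mulVec A v.ofLp)) = c i * inner ℝ (b i) v := by
    rw [EuclideanSpace.inner_eq_star_dotProduct, EuclideanSpace.inner_eq_star_dotProduct,
      star_trivial, dotProduct_comm, Matrix.dotProduct_mulVec, ← Matrix.mulVec_transpose, hA.eq, hb,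
      smul_dotProduct, dotProduct_comm, smul_eq_mul]
  rw [h1, b.repr_apply_apply, real_inner_comm]; ring

/-- `Λ` is symmetric with eigenvalues in `[a, b]`. -/
structure Elliptic (a b : ℝ) (Λ : Matrix (Fin d) (Fin d) ℝ) : Prop where
  symm : Λ.IsSymm
  lower : ∀ v : Euc d, a * ‖v‖ ^ 2 ≤ quad Λ v
  upper : ∀ v : Euc d, quad Λ v ≤ b * ‖v‖ ^ 2

theorem Elliptic.posDef {a b : ℝ} {Λ : Matrix (Fin d) (Fin d) ℝ} (h : Elliptic a b Λ) (ha : 0 < a) :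
    Λ.PosDef := by
  refine Matrix.PosDef.of_dotProduct_mulVec_pos ?_ fun x hx => ?_
  · rw [Matrix.IsHermitian, Matrix.conjTranspose_eq_transpose_of_trivial, h.symm.eq]
  · have h1 := h.lower (WithLp.toLp 2 x)
    have h2 : (WithLp.toLp 2 x : Euc d) ≠ 0 := by simpa using hx
    rw [star_trivial]
    refine lt_of_lt_of_le ?_ h1
    positivity

/-- Simultaneous diagonalisation of the quadratic forms of `Λ` and `Λ⁻¹`. -/
theorem Elliptic.exists_diag {a b : ℝ} {Λ : Matrix (Fin d) (Fin d) ℝ} (h : Elliptic a b Λ)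
    (ha : 0 < a) : ∃ (e : Euc d ≃ₗᵢ[ℝ] Euc d) (c : Fin d → ℝ), (∀ i, a ≤ c i ∧ c i ≤ b) ∧
      (∀ v, quad Λ v = ∑ i, c i * (e v i) ^ 2) ∧ (∀ v, quad Λ⁻¹ v = ∑ i, (c i)⁻¹ * (e v i) ^ 2) ∧
        Λ.det = ∏ i, c i := by
  have hpd := h.posDef ha
  have hH := hpd.isHermitian
  set B := hH.eigenvectorBasis
  have hB : ∀ i, Matrix.mulVec Λ (B i).ofLp = hH.eigenvalues i • (B i).ofLp :=
    fun i => hH.mulVec_eigenvectorBasis i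
  have hq : ∀ v, quad Λ v = ∑ i, hH.eigenvalues i * (B.repr v i) ^ 2 :=
    quad_eq_sum_of_basis h.symm B _ hB
  have hc : ∀ i, a ≤ hH.eigenvalues i ∧ hH.eigenvalues i ≤ b := by
    intro i
    have h1 : quad Λ (B i) = hH.eigenvalues i := by
      rw [hq, Finset.sum_eq_single i]
      · simp
      · intro j _ hj; simp [hj]
      · simp
    have h2 := h.lower (B i)
    have h3 := h.upper (B i)
    rw [h1, B.norm_eq_one] at h2 h3
    constructor <;> linarith
  have hinv : ∀ i, Matrix.mulVec Λ⁻¹ (B i).ofLp = (hH.eigenvalues i)⁻¹ • (B i).ofLp := by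
    intro i
    have h0 : hH.eigenvalues i ≠ 0 := (ha.trans_le (hc i).1).ne'
    have h1 : Matrix.mulVec Λ⁻¹ (Matrix.mulVec Λ (B i).ofLp) = (B i).ofLp := by
      rw [Matrix.mulVec_mulVec, Matrix.nonsing_inv_mul _ hpd.det_pos.ne'.isUnit, Matrix.one_mulVec]
    rw [hB, Matrix.mulVec_smul] at h1
    rw [eq_inv_smul_iff₀ h0, h1]
  refine ⟨B.repr, hH.eigenvalues, hc, hq, quad_eq_sum_of_basis ?_ B _ hinv, ?_⟩
  · rw [Matrix.IsSymm, Matrix.transpose_nonsing_inv, h.symm.eq]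
  · simpa using hH.det_eq_prod_eigenvalues

theorem sum_sq_eq_norm (e : Euc d ≃ₗᵢ[ℝ] Euc d) (v : Euc d) : ∑ i, (e v i) ^ 2 = ‖v‖ ^ 2 := by
  rw [← e.norm_map v, EuclideanSpace.norm_sq_eq]
  simp

theorem heatKernel_eq (t : ℝ) (x η : Euc d) (Λ : Matrix (Fin d) (Fin d) ℝ) :
    heatKernel t x η Λ = 1 / Real.sqrt Λ.det * (1 / (2 * Real.pi * t) ^ ((d : ℝ) / 2)) *
      Real.exp (-(1 / (2 * t)) * quad Λ⁻¹ (x - t • η)) := rfl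

theorem Elliptic.quad_inv_le {a b : ℝ} {Λ : Matrix (Fin d) (Fin d) ℝ} (h : Elliptic a b Λ)
    (ha : 0 < a) (v : Euc d) : quad Λ⁻¹ v ≤ a⁻¹ * ‖v‖ ^ 2 := by
  obtain ⟨e, c, hc, -, hi, -⟩ := h.exists_diag ha
  rw [hi, ← sum_sq_eq_norm e, Finset.mul_sum]
  refine Finset.sum_le_sum fun i _ => ?_
  gcongr
  exact (hc i).1

theorem Elliptic.le_quad_inv {a b : ℝ} {Λ : Matrix (Fin d) (Fin d) ℝ} (h : Elliptic a b Λ)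
    (ha : 0 < a) (v : Euc d) : b⁻¹ * ‖v‖ ^ 2 ≤ quad Λ⁻¹ v := by
  obtain ⟨e, c, hc, -, hi, -⟩ := h.exists_diag ha
  rw [hi, ← sum_sq_eq_norm e, Finset.mul_sum]
  refine Finset.sum_le_sum fun i _ => ?_
  have := ha.trans_le (hc i).1
  gcongr
  exact (hc i).2

theorem Elliptic.det_bounds {a b : ℝ} {Λ : Matrix (Fin d) (Fin d) ℝ} (h : Elliptic a b Λ)
    (ha : 0 < a) : a ^ d ≤ Λ.det ∧ Λ.det ≤ b ^ d := by
  obtain ⟨e, c, hc, -, -, hdet⟩ := h.exists_diag ha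
  rw [hdet]
  constructor
  · calc a ^ d = ∏ _i : Fin d, a := by simp
      _ ≤ _ := Finset.prod_le_prod (fun i _ => ha.le) fun i _ => (hc i).1
  · calc _ ≤ ∏ _i : Fin d, b :=
          Finset.prod_le_prod (fun i _ => (ha.trans_le (hc i).1).le) fun i _ => (hc i).2
      _ = b ^ d := by simp

theorem heatKernel_pos {a b : ℝ} {Λ : Matrix (Fin d) (Fin d) ℝ} (h : Elliptic a b Λ) (ha : 0 < a)
    {t : ℝ} (ht : 0 < t) (x η : Euc d) : 0 < heatKernel t x η Λ := by
  have := (h.posDef ha).det_pos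
  rw [heatKernel_eq]
  positivity

theorem heatKernel_le {a b : ℝ} {Λ : Matrix (Fin d) (Fin d) ℝ} (h : Elliptic a b Λ) (ha : 0 < a)
    {t : ℝ} (ht : 0 < t) (x η : Euc d) : heatKernel t x η Λ ≤
      (Real.sqrt (a ^ d))⁻¹ * t ^ (-((d : ℝ) / 2)) *
        Real.exp (-((2 * b)⁻¹ * (‖x - t • η‖ ^ 2 / t))) := by
  have h1 := h.le_quad_inv ha (x - t • η)
  have h2 := (h.det_bounds ha).1
  rw [heatKernel_eq, one_div, one_div, Real.rpow_neg ht.le]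
  gcongr
  · nlinarith [Real.pi_gt_three]
  · rw [neg_mul, neg_le_neg_iff]
    calc (2 * b)⁻¹ * (‖x - t • η‖ ^ 2 / t) = 1 / (2 * t) * (b⁻¹ * ‖x - t • η‖ ^ 2) := by
          rw [mul_inv, one_div, mul_inv]; ring
      _ ≤ _ := by gcongr

theorem le_heatKernel {a b : ℝ} {Λ : Matrix (Fin d) (Fin d) ℝ} (h : Elliptic a b Λ) (ha : 0 < a)
    {t : ℝ} (ht : 0 < t) (x η : Euc d) :
    (Real.sqrt (b ^ d))⁻¹ * (2 * Real.pi) ^ (-((d : ℝ) / 2)) * t ^ (-((d : ℝ) / 2)) *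
        Real.exp (-((2 * a)⁻¹ * (‖x - t • η‖ ^ 2 / t))) ≤ heatKernel t x η Λ := by
  have h1 := h.quad_inv_le ha (x - t • η)
  have h2 := (h.det_bounds ha).2
  have h3 := (h.posDef ha).det_pos
  rw [heatKernel_eq, one_div, one_div, Real.rpow_neg ht.le, Real.rpow_neg (by positivity),
    Real.mul_rpow (by positivity) ht.le, mul_inv ((2 * Real.pi) ^ ((d : ℝ) / 2)), ← mul_assoc]
  gcongr
  rw [neg_mul, neg_le_neg_iff]
  calc _ ≤ 1 / (2 * t) * (a⁻¹ * ‖x - t • η‖ ^ 2) := by gcongr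
    _ = _ := by rw [mul_inv, one_div, mul_inv]; ring

/-- The heat kernel as a Fourier integral over `ℝ^d`. -/
theorem heatKernel_fourier {a b : ℝ} {Λ : Matrix (Fin d) (Fin d) ℝ} (h : Elliptic a b Λ)
    (ha : 0 < a) {t : ℝ} (ht : 0 < t) (x η : Euc d) :
    ∫ k : Euc d, Complex.exp (-((t / 2 * quad Λ k : ℝ) : ℂ) +
      Complex.I * ((inner ℝ k (x - t • η) : ℝ) : ℂ)) =
        (2 * (Real.pi : ℂ)) ^ d * (heatKernel t x η Λ : ℂ) := by
  obtain ⟨e, c, hc, hq, hi, hdet⟩ := h.exists_diag ha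
  set z := x - t • η with hz
  have hc0 : ∀ i, 0 < c i := fun i => ha.trans_le (hc i).1
  rw [← e.symm.measurePreserving.integral_comp e.symm.toHomeomorph.measurableEmbedding,
    ← (PiLp.volume_preserving_toLp (Fin d)).integral_comp
      (MeasurableEquiv.toLp 2 (Fin d → ℝ)).measurableEmbedding]
  have h1 : ∀ v : Fin d → ℝ, Complex.exp (-((t / 2 * quad Λ (e.symm (WithLp.toLp 2 v)) : ℝ) : ℂ) +
      Complex.I * ((inner ℝ (e.symm (WithLp.toLp 2 v)) z : ℝ) : ℂ)) =
      Complex.exp (-∑ i, ((t / 2 * c i : ℝ) : ℂ) * (v i : ℂ) ^ 2 +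
        ∑ i, (Complex.I * (e z i : ℂ)) * (v i : ℂ)) := by
    intro v
    congr 1
    rw [hq, LinearIsometryEquiv.apply_symm_apply, ← e.inner_map_map,
      LinearIsometryEquiv.apply_symm_apply, PiLp.inner_apply, Finset.mul_sum]
    push_cast
    rw [Finset.mul_sum]
    congr 1
    · congr 1
      exact Finset.sum_congr rfl fun i _ => by ring
    · refine Finset.sum_congr rfl fun i _ => ?_
      simp; ring
  simp_rw [h1]
  rw [GaussianFourier.integral_cexp_neg_sum_mul_add (fun i => by
    rw [Complex.ofReal_re]; exact mul_pos (by positivity) (hc0 i))]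
  have h2 : ∀ i, ((Real.pi : ℂ) / ((t / 2 * c i : ℝ) : ℂ)) ^ (1 / 2 : ℂ) *
      Complex.exp ((Complex.I * (e z i : ℂ)) ^ 2 / (4 * ((t / 2 * c i : ℝ) : ℂ))) =
      ((2 * Real.pi * (Real.sqrt (2 * Real.pi * t))⁻¹ * (Real.sqrt (c i))⁻¹ *
        Real.exp (-(1 / (2 * t)) * ((c i)⁻¹ * (e z i) ^ 2)) : ℝ) : ℂ) := by
    intro i
    have e1 : (Real.pi : ℂ) / ((t / 2 * c i : ℝ) : ℂ) = ((Real.pi / (t / 2 * c i) : ℝ) : ℂ) := by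
      push_cast; rfl
    have e2 : (1 / 2 : ℂ) = ((1 / 2 : ℝ) : ℂ) := by push_cast; rfl
    have e3 : (Complex.I * (e z i : ℂ)) ^ 2 / (4 * ((t / 2 * c i : ℝ) : ℂ)) =
        ((-(1 / (2 * t)) * ((c i)⁻¹ * (e z i) ^ 2) : ℝ) : ℂ) := by
      rw [mul_pow, Complex.I_sq]
      have := hc0 i
      push_cast
      have h4 : (t : ℂ) ≠ 0 := by exact_mod_cast ht.ne'
      have h5 : (c i : ℂ) ≠ 0 := by exact_mod_cast this.ne'
      field_simp
      norm_num
    have e4 : (Real.pi / (t / 2 * c i)) ^ (1 / 2 : ℝ) =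
        2 * Real.pi * (Real.sqrt (2 * Real.pi * t))⁻¹ * (Real.sqrt (c i))⁻¹ := by
      have := hc0 i
      have hp := Real.pi_pos
      rw [← Real.sqrt_eq_rpow, mul_assoc, ← mul_inv, ← Real.sqrt_mul (by positivity),
        ← Real.sqrt_inv]
      rw [Real.sqrt_eq_iff_mul_self_eq (by positivity) (by positivity)]
      symm
      have h6 := Real.mul_self_sqrt (by positivity : 0 ≤ (2 * Real.pi * t * c i)⁻¹)
      calc _ = (2 * Real.pi) ^ 2 * (Real.sqrt (2 * Real.pi * t * c i)⁻¹ *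
            Real.sqrt (2 * Real.pi * t * c i)⁻¹) := by ring
        _ = _ := by rw [h6]; field_simp
    rw [e1, e2, e3, ← Complex.ofReal_cpow (by have := hc0 i; have := Real.pi_pos; positivity), e4,
      ← Complex.ofReal_exp, ← Complex.ofReal_mul]
  simp_rw [h2]
  rw [← Complex.ofReal_prod]
  have h3 : ∏ i, (2 * Real.pi * (Real.sqrt (2 * Real.pi * t))⁻¹ * (Real.sqrt (c i))⁻¹ *
      Real.exp (-(1 / (2 * t)) * ((c i)⁻¹ * (e z i) ^ 2))) =
      (2 * Real.pi) ^ d * heatKernel t x η Λ := by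
    rw [Finset.prod_mul_distrib, Finset.prod_mul_distrib, Finset.prod_const, Finset.card_univ,
      Fintype.card_fin, ← Real.exp_sum, ← Finset.mul_sum, ← hi, heatKernel_eq, mul_pow, hdet,
      Finset.prod_inv_distrib, ← Real.sqrt_prod _ (fun i _ => (hc0 i).le)]
    have : (Real.sqrt (2 * Real.pi * t))⁻¹ ^ d = 1 / (2 * Real.pi * t) ^ ((d : ℝ) / 2) := by
      rw [inv_pow, one_div, Real.sqrt_eq_rpow, ← Real.rpow_natCast, ← Real.rpow_mul
        (by have := Real.pi_pos; positivity)]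
      congr 2; ring
    rw [this]
    ring
  rw [h3]
  push_cast
  rfl

end Heat

/-! ### The local central limit theorem -/

section LCLT

variable {d : ℕ}

/-- The third order remainder is bounded by `|u|^3` for small `u` and by `|u|^2` for large `u`, which
allows any power in between. -/
theorem norm_exp_neg_I_taylor_le {z : ℝ} (hz : 0 ≤ z) (hz1 : z ≤ 1) (u : ℝ) :
    ‖1 - Complex.exp (-Complex.I * (u : ℂ)) - Complex.I * u - u ^ 2 / 2‖ ≤ 4 * |u| ^ (2 + z) := by
  rcases le_total |u| 1 with hu | hu
  · rcases eq_or_ne u 0 with rfl | hu0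
    · simp [Real.zero_rpow (by linarith : 2 + z ≠ 0)]
    have h0 : 0 < |u| := abs_pos.2 hu0
    have h1 := Complex.exp_bound (x := -Complex.I * (u : ℂ)) (by simpa using hu) (n := 3)
      (by norm_num)
    have h2 : Complex.exp (-Complex.I * (u : ℂ)) -
        ∑ m ∈ Finset.range 3, (-Complex.I * (u : ℂ)) ^ m / (m.factorial : ℂ) =
        -(1 - Complex.exp (-Complex.I * (u : ℂ)) - Complex.I * u - u ^ 2 / 2) := by
      simp only [Finset.sum_range_succ, Finset.sum_range_zero]
      simp [Nat.factorial, mul_pow]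
      ring
    rw [h2, norm_neg] at h1
    refine h1.trans ?_
    have h3 : ‖-Complex.I * (u : ℂ)‖ = |u| := by simp
    rw [h3]
    have h4 : |u| ^ 3 ≤ |u| ^ (2 + z) := by
      rw [← Real.rpow_natCast]
      exact Real.rpow_le_rpow_of_exponent_ge h0 hu (by push_cast; linarith)
    have h5 : (0 : ℝ) ≤ |u| ^ 3 := by positivity
    norm_num [Nat.factorial]
    nlinarith
  · have h1 : |u| ^ 2 ≤ |u| ^ (2 + z) := by
      rw [← Real.rpow_natCast]
      exact Real.rpow_le_rpow_of_exponent_le hu (by push_cast; linarith)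
    have h2 : ‖Complex.exp (-Complex.I * (u : ℂ))‖ = 1 := by
      rw [Complex.norm_exp]; simp
    calc _ ≤ ‖(1 : ℂ)‖ + ‖Complex.exp (-Complex.I * (u : ℂ))‖ + ‖Complex.I * (u : ℂ)‖ +
          ‖(u : ℂ) ^ 2 / 2‖ := by
          refine (norm_sub_le _ _).trans ?_
          gcongr
          refine (norm_sub_le _ _).trans ?_
          gcongr
          exact norm_sub_le _ _
      _ = 1 + 1 + |u| + |u| ^ 2 / 2 := by rw [h2]; simp
      _ ≤ _ := by nlinarith

/-- Interpolation between the Lipschitz bound `|k·y|` and the trivial bound `2`. -/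
theorem norm_one_sub_char_le {z : ℝ} (hz : 0 < z) (hz1 : z ≤ 1) (k : Euc d) (y : Lat d) :
    ‖char k y - 1‖ ≤ 2 * (‖k‖ ^ z * ‖emb y‖ ^ z) := by
  rw [← Real.mul_rpow (norm_nonneg _) (norm_nonneg _)]
  set u : ℝ := -(inner ℝ k (emb y)) with hu
  have hk : |u| ≤ ‖k‖ * ‖emb y‖ := by rw [hu, abs_neg]; exact abs_real_inner_le_norm _ _
  have h1 : |u| ^ z ≤ (‖k‖ * ‖emb y‖) ^ z := by gcongr
  refine le_trans ?_ (mul_le_mul_of_nonneg_left h1 two_pos.le)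
  rw [char_eq, ← hu]
  rcases le_total |u| 1 with h | h
  · have h2 : ‖Complex.exp ((u : ℂ) * Complex.I) - 1‖ ≤ |u| := by
      rw [mul_comm]; exact Real.norm_exp_I_mul_ofReal_sub_one_le
    have h3 : |u| ≤ |u| ^ z := by
      rcases (abs_nonneg u).eq_or_lt with h0 | h0
      · rw [← h0, Real.zero_rpow hz.ne']
      · simpa using Real.rpow_le_rpow_of_exponent_ge h0 h hz1
    linarith [Real.rpow_nonneg (abs_nonneg u) z]
  · have h2 := Real.one_le_rpow h hz.le
    refine (norm_sub_le _ _).trans ?_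
    rw [Complex.norm_exp_ofReal_mul_I]
    norm_num; linarith

theorem summable_inner_mul {Q : Lat d → ℝ} (h : Summable fun y => ‖emb y‖ * |Q y|) (v : Euc d) :
    Summable fun y => inner ℝ v (emb y) * Q y :=
  Summable.of_norm_bounded (h.mul_left ‖v‖) fun y => by
    rw [norm_mul, ← mul_assoc]
    exact mul_le_mul_of_nonneg_right (norm_inner_le_norm _ _) (abs_nonneg _)

theorem inner_sq_le (v : Euc d) (y : Lat d) :
    inner ℝ v (emb y) ^ 2 ≤ ‖v‖ ^ 2 * ‖emb y‖ ^ 2 := by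
  rw [← sq_abs, ← mul_pow]
  gcongr
  exact abs_real_inner_le_norm _ _

theorem summable_inner_sq_mul {Q : Lat d → ℝ} (h : Summable fun y => ‖emb y‖ ^ 2 * |Q y|)
    (v : Euc d) : Summable fun y => inner ℝ v (emb y) ^ 2 * Q y :=
  Summable.of_norm_bounded (h.mul_left (‖v‖ ^ 2)) fun y => by
    rw [norm_mul, Real.norm_of_nonneg (sq_nonneg _), ← mul_assoc]
    exact mul_le_mul_of_nonneg_right (inner_sq_le v y) (abs_nonneg _)

theorem quad_covMatrix {Q : Lat d → ℝ} (h : Summable fun y => ‖emb y‖ ^ 2 * |Q y|) (v : Euc d) :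
    quad (covMatrix Q) v = ∑' y, inner ℝ v (emb y) ^ 2 * Q y := by
  have hs : ∀ j l, Summable fun y : Lat d => v j * (((y j : ℝ) * (y l : ℝ) * Q y) * v l) := by
    intro j l
    refine (Summable.of_norm_bounded h fun y => ?_).mul_right (v l) |>.mul_left (v j)
    rw [norm_mul, norm_mul, sq]
    gcongr
    · exact abs_apply_le_norm (emb y) j
    · exact abs_apply_le_norm (emb y) l
    · exact le_rfl
  have h1 : ∀ y : Lat d, inner ℝ v (emb y) ^ 2 * Q y =
      ∑ j, ∑ l, v j * (((y j : ℝ) * (y l : ℝ) * Q y) * v l) := by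
    intro y
    rw [inner_emb, sq, Finset.sum_mul_sum, Finset.sum_mul]
    refine Finset.sum_congr rfl fun j _ => ?_
    rw [Finset.sum_mul]
    exact Finset.sum_congr rfl fun l _ => by ring
  simp_rw [h1]
  rw [Summable.tsum_finsetSum fun j _ => summable_sum fun l _ => hs j l]
  simp only [quad, dotProduct, Matrix.mulVec, covMatrix, Matrix.of_apply]
  refine Finset.sum_congr rfl fun j _ => ?_
  rw [Summable.tsum_finsetSum fun l _ => hs j l, Finset.mul_sum]
  refine Finset.sum_congr rfl fun l _ => ?_
  rw [tsum_mul_left, tsum_mul_right]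

/-- The second order Taylor expansion of `1 - e^{-iu}`, summed over the steps. -/
theorem norm_latFourier_taylor_le {Q : Lat d → ℝ} {M z : ℝ} (hz : 0 < z) (hz1 : z ≤ 1)
    (h0 : Summable Q) (h1 : Summable fun y => ‖emb y‖ * |Q y|)
    (h2 : Summable fun y => ‖emb y‖ ^ 2 * |Q y|)
    (hM : SumLE (fun y => ‖emb y‖ ^ (2 + z) * |Q y|) M) (k : Euc d) :
    ‖latFourier Q 0 - latFourier Q k - (Complex.I * ((inner ℝ k (drift Q) : ℝ) : ℂ) +
      ((quad (covMatrix Q) k / 2 : ℝ) : ℂ))‖ ≤ 4 * M * ‖k‖ ^ (2 + z) := by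
  have s0 := summable_mul_char h0 0
  have sk := summable_mul_char h0 k
  have s1 := (Complex.hasSum_ofReal.2 (summable_inner_mul h1 k).hasSum).mul_left Complex.I
  have s2 := (Complex.hasSum_ofReal.2 ((summable_inner_sq_mul h2 k).hasSum.div_const 2))
  have hs := ((s0.hasSum.sub sk.hasSum).sub (s1.add s2))
  rw [← inner_drift h1, ← quad_covMatrix h2, ← latFourier_eq, ← latFourier_eq] at hs
  rw [← hs.tsum_eq]
  have hb : ∀ y, ‖(Q y : ℂ) * char 0 y - Q y * char k y - (Complex.I *
      ((inner ℝ k (emb y) * Q y : ℝ) : ℂ) + ((inner ℝ k (emb y) ^ 2 * Q y / 2 : ℝ) : ℂ))‖ ≤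
      4 * ‖k‖ ^ (2 + z) * (‖emb y‖ ^ (2 + z) * |Q y|) := by
    intro y
    have e1 : (Q y : ℂ) * char 0 y - Q y * char k y - (Complex.I *
      ((inner ℝ k (emb y) * Q y : ℝ) : ℂ) + ((inner ℝ k (emb y) ^ 2 * Q y / 2 : ℝ) : ℂ)) =
      Q y * (1 - Complex.exp (-Complex.I * ((inner ℝ k (emb y) : ℝ) : ℂ)) -
        Complex.I * ((inner ℝ k (emb y) : ℝ) : ℂ) - ((inner ℝ k (emb y) : ℝ) : ℂ) ^ 2 / 2) := by
      rw [char_zero_left, char]; push_cast; ring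
    rw [e1, norm_mul, Complex.norm_real, Real.norm_eq_abs]
    have e2 := norm_exp_neg_I_taylor_le hz.le hz1 (inner ℝ k (emb y))
    have e3 : |inner ℝ k (emb y)| ^ (2 + z) ≤ ‖k‖ ^ (2 + z) * ‖emb y‖ ^ (2 + z) := by
      rw [← Real.mul_rpow (norm_nonneg _) (norm_nonneg _)]
      gcongr
      exact abs_real_inner_le_norm _ _
    calc |Q y| * _ ≤ |Q y| * (4 * (‖k‖ ^ (2 + z) * ‖emb y‖ ^ (2 + z))) := by
          gcongr; exact e2.trans (by gcongr)
      _ = _ := by ring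
  refine (tsum_of_norm_bounded (hM.1.mul_left _).hasSum hb).trans ?_
  rw [tsum_mul_left]
  calc _ ≤ 4 * ‖k‖ ^ (2 + z) * M := by gcongr; exact hM.2
    _ = _ := by ring

/-- The covariance matrix is elliptic. The lower bound is the infrared bound at `k = tv` as `t → 0`,
where `Re (Q̂(0) - Q̂(tv))` is `t²/2` times the quadratic form. -/
theorem InQ.elliptic {M K ζ : ℝ} (hM : 0 < M) (hζ : 0 < ζ) {Q g : Lat d → ℝ}
    (h : InQ M K ζ Q g) : Elliptic (2 * K) M (covMatrix Q) := by
  have h2 := h.sum_sq_Q hM hζ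
  have h1 := h.sum_norm_Q hM hζ
  have h0 : Summable Q := summable_abs_iff.1 (h.sum_Q hM).1
  set z := min ζ 1 with hz
  have hz0 : 0 < z := lt_min hζ one_pos
  have hz1 : z ≤ 1 := min_le_right _ _
  have h3 := h.sum_rpow_Q hM (a := 2 + z) (by linarith)
    (by have := min_le_left ζ 1; linarith)
  refine ⟨?_, fun v => ?_, fun v => ?_⟩
  · ext j l
    simp only [Matrix.transpose_apply, covMatrix, Matrix.of_apply]
    exact tsum_congr fun y => by ring
  · have hev : ∀ᶠ t in nhdsWithin (0 : ℝ) (Ioi 0),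
        K * ‖v‖ ^ 2 ≤ quad (covMatrix Q) v / 2 + 4 * M * ‖v‖ ^ (2 + z) * t ^ z := by
      have hmem : ∀ᶠ t in nhdsWithin (0 : ℝ) (Ioi 0), t * ‖v‖ < Real.pi := by
        have : Filter.Tendsto (fun t : ℝ => t * ‖v‖) (nhdsWithin 0 (Ioi 0)) (nhds (0 * ‖v‖)) :=
          ((continuous_id.mul continuous_const).tendsto 0).mono_left nhdsWithin_le_nhds
        rw [zero_mul] at this
        exact this.eventually (gt_mem_nhds Real.pi_pos)
      filter_upwards [hmem, self_mem_nhdsWithin] with t ht (ht0 : 0 < t)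
      have hnorm : ‖t • v‖ = t * ‖v‖ := by rw [norm_smul, Real.norm_of_nonneg ht0.le]
      have hbox : t • v ∈ box d := by
        by_contra hc
        have := pi_le_norm_of_notMem_box hc
        rw [hnorm] at this
        linarith
      have e1 := h.infrared (t • v) hbox
      have e2 := norm_latFourier_taylor_le hz0 hz1 h0 h1.1 h2.1 h3 (t • v)
      have e3 := (Complex.abs_re_le_norm _).trans e2
      have e4 : (Complex.I * ((inner ℝ (t • v) (drift Q) : ℝ) : ℂ) +
          ((quad (covMatrix Q) (t • v) / 2 : ℝ) : ℂ)).re = quad (covMatrix Q) (t • v) / 2 := by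
        simp
      rw [Complex.sub_re, e4] at e3
      have e5 := (le_abs_self _).trans e3
      have e6 : quad (covMatrix Q) (t • v) = t ^ 2 * quad (covMatrix Q) v := by
        rw [quad_covMatrix h2.1, quad_covMatrix h2.1, ← tsum_mul_left]
        refine tsum_congr fun y => ?_
        rw [real_inner_smul_left]; ring
      rw [e6, hnorm, Real.mul_rpow ht0.le (norm_nonneg _), Real.rpow_add ht0, Real.rpow_two] at e5
      rw [hnorm] at e1
      have e7 : t ^ 2 * (K * ‖v‖ ^ 2) ≤
          t ^ 2 * (quad (covMatrix Q) v / 2 + 4 * M * ‖v‖ ^ (2 + z) * t ^ z) := by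
        nlinarith
      exact le_of_mul_le_mul_left e7 (by positivity)
    have hlim : Filter.Tendsto (fun t : ℝ => quad (covMatrix Q) v / 2 +
        4 * M * ‖v‖ ^ (2 + z) * t ^ z) (nhdsWithin 0 (Ioi 0))
          (nhds (quad (covMatrix Q) v / 2 + 4 * M * ‖v‖ ^ (2 + z) * 0)) := by
      refine tendsto_const_nhds.add (tendsto_const_nhds.mul ?_)
      have := (Real.continuousAt_rpow_const 0 z (Or.inr hz0.le)).tendsto
      rw [Real.zero_rpow hz0.ne'] at this
      exact this.mono_left nhdsWithin_le_nhds
    have := ge_of_tendsto hlim hev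
    linarith
  · rw [quad_covMatrix h2.1]
    have hs := summable_inner_sq_mul h2.1 v
    calc _ ≤ ∑' y, ‖v‖ ^ 2 * (‖emb y‖ ^ 2 * |Q y|) := by
          refine hs.tsum_le_tsum (fun y => ?_) (h2.1.mul_left _)
          rw [← mul_assoc]
          exact (mul_le_mul_of_nonneg_left (le_abs_self _) (sq_nonneg _)).trans
            (mul_le_mul_of_nonneg_right (inner_sq_le v y) (abs_nonneg _))
      _ = ‖v‖ ^ 2 * ∑' y, ‖emb y‖ ^ 2 * |Q y| := tsum_mul_left
      _ ≤ ‖v‖ ^ 2 * M := by gcongr; exact h2.2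
      _ = _ := mul_comm _ _

theorem norm_exp_sub_exp_le {u v : ℂ} {c : ℝ} (hu : u.re ≤ c) (hv : v.re ≤ c) :
    ‖Complex.exp u - Complex.exp v‖ ≤ Real.exp c * ‖u - v‖ := by
  have hconv : Convex ℝ {w : ℂ | w.re ≤ c} := convex_halfSpace_re_le c
  refine hconv.norm_image_sub_le_of_norm_hasDerivWithin_le (f := Complex.exp) (f' := Complex.exp)
    (fun w _ => (Complex.hasDerivAt_exp w).hasDerivWithinAt) (fun w hw => ?_) hv hu
  rw [Complex.norm_exp]
  exact Real.exp_le_exp.2 hw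

/-- Powers up to the third are absorbed by half of the Gaussian factor `e^{-K w²}`. -/
theorem rpow_le_exp {K : ℝ} (hK : 0 < K) {a w : ℝ} (ha : 0 < a) (ha3 : a ≤ 3) (hw : 0 ≤ w) :
    w ^ a ≤ (2 + 8 / K ^ 2) * Real.exp (K / 2 * w ^ 2) := by
  have h1 : w ^ a ≤ 1 + w ^ 3 := by
    rcases le_total w 1 with h | h
    · have := Real.rpow_le_one hw h ha.le
      have : 0 ≤ w ^ 3 := by positivity
      linarith
    · have h2 : w ^ a ≤ w ^ ((3 : ℕ) : ℝ) := Real.rpow_le_rpow_of_exponent_le h (by exact_mod_cast ha3)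
      rw [Real.rpow_natCast] at h2
      linarith
  have h2 : w ^ 3 ≤ 1 + w ^ 4 := by nlinarith [sq_nonneg (w ^ 2 - w), sq_nonneg (w - 1), sq_nonneg w]
  have h3 := Real.pow_div_factorial_le_exp (K / 2 * w ^ 2) (by positivity) 2
  have h4 : w ^ 4 ≤ 8 / K ^ 2 * Real.exp (K / 2 * w ^ 2) := by
    calc w ^ 4 = 8 / K ^ 2 * ((K / 2 * w ^ 2) ^ 2 / (Nat.factorial 2)) := by
          simp [Nat.factorial]; field_simp; norm_num
      _ ≤ _ := by gcongr
  have h5 := Real.one_le_exp (by positivity : 0 ≤ K / 2 * w ^ 2)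
  nlinarith

/-- Local central limit theorem for the semigroup kernels, at the boundary `∑ Q = 1`. -/
theorem norm_semiKernel_sub_le {M K ζ : ℝ} (hM : 0 < M) (hK : 0 < K) (hζ : 0 < ζ) :
    ∃ C : ℝ, 0 < C ∧ ∀ Q g : Lat d → ℝ, InQ M K ζ Q g → ∑' y, Q y = 1 →
      ∀ s : ℝ, 0 < s → ∀ x : Lat d, ‖semiKernel Q g s x - (((∑' y, g y) *
        heatKernel s (emb x) (drift Q) (covMatrix Q) : ℝ) : ℂ)‖ ≤
          C * (s ^ (-((d : ℝ) / 2)) * s ^ (-(min ζ 1 / 2))) := by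
  set z := min ζ 1 with hz
  have hz0 : 0 < z := lt_min hζ one_pos
  have hz1 : z ≤ 1 := min_le_right _ _
  have hzζ : z ≤ ζ := min_le_left _ _
  set B := 2 + 8 / K ^ 2
  have hpi := Real.pi_pos
  refine ⟨((2 * Real.pi) ^ d)⁻¹ * ((2 * M + 4 * M ^ 2) * B * (2 * Real.pi / K) ^ ((d : ℝ) / 2)),
    by positivity, fun Q g h hQ s hs x => ?_⟩
  have h2 := h.sum_sq_Q hM hζ
  have h1 := h.sum_norm_Q hM hζ
  have h0 : Summable Q := summable_abs_iff.1 (h.sum_Q hM).1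
  have h3 := h.sum_rpow_Q hM (a := 2 + z) (by linarith) (by linarith)
  have hg := h.sum_g hM
  have hgs : Summable g := summable_abs_iff.1 hg.1
  have hgz := h.sum_rpow_g hM hz0 hzζ
  have hell := h.elliptic hM hζ
  set Λ := covMatrix Q
  set η := drift Q
  set G : ℝ := ∑' y, g y with hG
  have hG0 : latFourier g 0 = (G : ℂ) := latFourier_zero g
  have hGM : |G| ≤ M := by
    have := norm_latFourier_le hgs 0
    rw [hG0, Complex.norm_real] at this
    exact this.trans hg.2
  -- both kernels as Fourier integrals over the whole space
  set F1 : Euc d → ℂ := (box d).indicator fun k => char k (-x) *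
    (latFourier g k * Complex.exp (-(s : ℂ) * (1 - latFourier Q k))) with hF1
  set A : Euc d → ℂ := fun k => Complex.I * ((inner ℝ k η : ℝ) : ℂ) + ((quad Λ k / 2 : ℝ) : ℂ)
    with hA
  set F2 : Euc d → ℂ := fun k => char k (-x) * ((G : ℂ) * Complex.exp (-(s : ℂ) * A k)) with hF2
  have hq : semiKernel Q g s x = ((2 * (Real.pi : ℂ)) ^ d)⁻¹ * ∫ k, F1 k := by
    rw [semiKernel, hF1, integral_indicator measurableSet_box]
  have hF2' : ∀ k, F2 k = (G : ℂ) * Complex.exp (-((s / 2 * quad Λ k : ℝ) : ℂ) +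
      Complex.I * ((inner ℝ k (emb x - s • η) : ℝ) : ℂ)) := by
    intro k
    have : Complex.exp (-((s / 2 * quad Λ k : ℝ) : ℂ) +
      Complex.I * ((inner ℝ k (emb x - s • η) : ℝ) : ℂ)) =
        char k (-x) * Complex.exp (-(s : ℂ) * A k) := by
      rw [char, ← Complex.exp_add, hA, inner_sub_right, real_inner_smul_right]
      congr 1
      have : emb (-x) = -emb x := by ext i; simp
      rw [this, inner_neg_right]
      push_cast; ring
    rw [this, hF2]; ring
  have hρ : ((G * heatKernel s (emb x) η Λ : ℝ) : ℂ) =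
      ((2 * (Real.pi : ℂ)) ^ d)⁻¹ * ∫ k, F2 k := by
    simp_rw [hF2']
    rw [integral_const_mul, heatKernel_fourier hell (by positivity) hs]
    have : ((2 * (Real.pi : ℂ)) ^ d) ≠ 0 := pow_ne_zero _ (by simp [Real.pi_ne_zero])
    push_cast
    field_simp
  have hquad : ∀ k, K * ‖k‖ ^ 2 ≤ quad Λ k / 2 := fun k => by
    have := hell.lower k; linarith
  have hArea : ∀ k, (-(s : ℂ) * A k).re ≤ -(s * K * ‖k‖ ^ 2) := fun k => by
    have e1 : (-(s : ℂ) * A k).re = -(s * (quad Λ k / 2)) := by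
      simp [hA]
    rw [e1, neg_le_neg_iff, mul_assoc]
    exact mul_le_mul_of_nonneg_left (hquad k) hs.le
  have hexpA : ∀ k, ‖Complex.exp (-(s : ℂ) * A k)‖ ≤ Real.exp (-(s * K * ‖k‖ ^ 2)) := fun k => by
    rw [Complex.norm_exp]; exact Real.exp_le_exp.2 (hArea k)
  have hdiff : ∀ k, ‖F1 k - F2 k‖ ≤ (2 * M * ‖k‖ ^ z + 4 * M ^ 2 * (s * ‖k‖ ^ (2 + z))) *
      Real.exp (-(s * K * ‖k‖ ^ 2)) := by
    intro k
    by_cases hk : k ∈ box d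
    · have e0 : (1 : ℂ) = latFourier Q 0 := by rw [latFourier_zero, hQ]; simp
      have e1 : F1 k - F2 k = char k (-x) * ((latFourier g k - G) * Complex.exp (-(s : ℂ) * A k) +
          latFourier g k * (Complex.exp (-(s : ℂ) * (1 - latFourier Q k)) -
            Complex.exp (-(s : ℂ) * A k))) := by
        rw [hF1, indicator_of_mem hk]; ring
      rw [e1, norm_mul, norm_char, one_mul, add_mul]
      refine (norm_add_le _ _).trans (add_le_add ?_ ?_)
      · rw [norm_mul]
        gcongr
        · rw [← hG0, latFourier_eq, latFourier_eq,
            ← (summable_mul_char hgs k).tsum_sub (summable_mul_char hgs 0)]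
          have e2 : ∀ y, ‖(g y : ℂ) * char k y - g y * char 0 y‖ ≤
              2 * ‖k‖ ^ z * (‖emb y‖ ^ z * |g y|) := fun y => by
            rw [char_zero_left, ← mul_sub, norm_mul, Complex.norm_real, Real.norm_eq_abs]
            calc _ ≤ |g y| * (2 * (‖k‖ ^ z * ‖emb y‖ ^ z)) := by
                  gcongr; exact norm_one_sub_char_le hz0 hz1 k y
              _ = _ := by ring
          refine (tsum_of_norm_bounded (hgz.1.mul_left _).hasSum e2).trans ?_
          rw [tsum_mul_left]
          calc _ ≤ 2 * ‖k‖ ^ z * M := by gcongr; exact hgz.2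
            _ = _ := by ring
        · exact hexpA k
      · rw [norm_mul]
        have e3 := norm_latFourier_le hgs k
        have e4 : (-(s : ℂ) * (1 - latFourier Q k)).re ≤ -(s * K * ‖k‖ ^ 2) := by
          have := h.infrared k hk
          rw [← e0] at this
          rw [← Complex.ofReal_neg, Complex.re_ofReal_mul]
          nlinarith
        have e5 := norm_exp_sub_exp_le e4 (hArea k)
        have e6 := norm_latFourier_taylor_le hz0 hz1 h0 h1.1 h2.1 h3 k
        rw [← e0] at e6
        rw [← mul_sub, norm_mul, norm_neg, Complex.norm_real, Real.norm_of_nonneg hs.le] at e5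
        calc _ ≤ M * (Real.exp (-(s * K * ‖k‖ ^ 2)) * (s * (4 * M * ‖k‖ ^ (2 + z)))) := by
              gcongr
              · exact e3.trans hg.2
              · exact e5.trans (by gcongr)
          _ = _ := by ring
    · -- Outside the box only the Gaussian is left; there `|k| ≥ π ≥ 1`, so that the factor
      -- `|k|^z` may be inserted.
      have e1 : F1 k = 0 := by rw [hF1, indicator_of_notMem hk]
      have hk1 : 1 ≤ ‖k‖ := by
        have := pi_le_norm_of_notMem_box hk
        linarith [Real.pi_gt_three]
      have e2 := Real.one_le_rpow hk1 hz0.le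
      rw [e1, zero_sub, norm_neg, hF2, norm_mul, norm_char, one_mul, norm_mul, Complex.norm_real,
        Real.norm_eq_abs]
      gcongr
      · have e3 : 0 ≤ 4 * M ^ 2 * (s * ‖k‖ ^ (2 + z)) := by positivity
        nlinarith
      · exact hexpA k
  have hdiff2 : ∀ k, ‖F1 k - F2 k‖ ≤ (2 * M + 4 * M ^ 2) * B * s ^ (-(z / 2)) *
      Real.exp (-(s * K / 2) * ‖k‖ ^ 2) := by
    intro k
    refine (hdiff k).trans ?_
    set w := Real.sqrt s * ‖k‖ with hw
    have hw0 : 0 ≤ w := by positivity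
    have hw2 : w ^ 2 = s * ‖k‖ ^ 2 := by rw [hw, mul_pow, Real.sq_sqrt hs.le]
    have hsz : Real.sqrt s ^ z = s ^ (z / 2) := by
      rw [Real.sqrt_eq_rpow, ← Real.rpow_mul hs.le]; congr 1; ring
    have e1 : ‖k‖ ^ z = s ^ (-(z / 2)) * w ^ z := by
      rw [hw, Real.mul_rpow (by positivity) (by positivity), hsz, ← mul_assoc, ← Real.rpow_add hs]
      simp
    have e2 : s * ‖k‖ ^ (2 + z) = s ^ (-(z / 2)) * w ^ (2 + z) := by
      rw [hw, Real.mul_rpow (by positivity) (by positivity), Real.rpow_add (Real.sqrt_pos.2 hs), hsz,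
        Real.rpow_two, Real.sq_sqrt hs.le]
      have : s ^ (-(z / 2)) * s ^ (z / 2) = 1 := by rw [← Real.rpow_add hs]; simp
      linear_combination (-(s * ‖k‖ ^ (2 + z))) * this
    have e3 := rpow_le_exp hK hz0 (by linarith) hw0
    have e4 := rpow_le_exp hK (a := 2 + z) (by linarith) (by linarith) hw0
    rw [e1, e2]
    have e5 : Real.exp (-(s * K * ‖k‖ ^ 2)) =
        Real.exp (-(K / 2 * w ^ 2)) * Real.exp (-(s * K / 2) * ‖k‖ ^ 2) := by
      rw [← Real.exp_add, hw2]; congr 1; ring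
    have e6 : Real.exp (K / 2 * w ^ 2) * Real.exp (-(K / 2 * w ^ 2)) = 1 := by
      rw [← Real.exp_add]; simp
    calc (2 * M * (s ^ (-(z / 2)) * w ^ z) + 4 * M ^ 2 * (s ^ (-(z / 2)) * w ^ (2 + z))) *
          Real.exp (-(s * K * ‖k‖ ^ 2))
        ≤ (2 * M * (s ^ (-(z / 2)) * (B * Real.exp (K / 2 * w ^ 2))) +
          4 * M ^ 2 * (s ^ (-(z / 2)) * (B * Real.exp (K / 2 * w ^ 2)))) *
            Real.exp (-(s * K * ‖k‖ ^ 2)) := by gcongr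
      _ = (2 * M + 4 * M ^ 2) * B * s ^ (-(z / 2)) * Real.exp (-(s * K / 2) * ‖k‖ ^ 2) *
          (Real.exp (K / 2 * w ^ 2) * Real.exp (-(K / 2 * w ^ 2))) := by rw [e5]; ring
      _ = _ := by rw [e6, mul_one]
  have hgauss : Integrable fun k : Euc d => (2 * M + 4 * M ^ 2) * B * s ^ (-(z / 2)) *
      Real.exp (-(s * K / 2) * ‖k‖ ^ 2) := (integrable_gaussian_euc (by positivity)).const_mul _
  have hF1i : Integrable F1 := by
    rw [hF1, integrable_indicator_iff measurableSet_box]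
    refine integrableOn_box ?_
    have := continuous_latFourier hgs
    have := continuous_latFourier h0
    fun_prop
  have hF12 : Integrable fun k => F1 k - F2 k := by
    refine hgauss.mono' (hF1i.aestronglyMeasurable.sub ?_) (Filter.Eventually.of_forall hdiff2)
    have hc : Continuous fun k : Euc d => quad Λ k := by
      unfold quad dotProduct Matrix.mulVec dotProduct; fun_prop
    have : Continuous F2 := by rw [hF2, hA]; fun_prop
    exact this.aestronglyMeasurable
  have hF2i : Integrable F2 := by
    have := hF1i.sub hF12
    refine this.congr (Filter.Eventually.of_forall fun k => ?_)
    simp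
  rw [hq, hρ, ← mul_sub, ← integral_sub hF1i hF2i, norm_mul, norm_inv, norm_pow, norm_mul,
    Complex.norm_real, Complex.norm_ofNat, Real.norm_of_nonneg hpi.le, mul_assoc]
  gcongr ?_ * ?_
  refine (norm_integral_le_of_norm_le hgauss (Filter.Eventually.of_forall hdiff2)).trans_eq ?_
  rw [integral_const_mul, integral_gaussian_euc (by positivity)]
  have e7 : Real.pi / (s * K / 2) = s⁻¹ * (2 * Real.pi / K) := by field_simp
  rw [e7, Real.mul_rpow (by positivity) (by positivity), Real.inv_rpow hs.le,
    ← Real.rpow_neg hs.le]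
  ring

end LCLT

/-! ### Geometry of the Wulff shape -/

section Wulff

variable {d : ℕ}

theorem tilt_zero (f : Lat d → ℝ) : tilt f 0 = f := by funext y; simp [tilt]

theorem tilt_nonneg {S : Lat d → ℝ} (hS : ∀ x, 0 ≤ S x) (μ : Euc d) (y : Lat d) : 0 ≤ tilt S μ y :=
  mul_nonneg (hS y) (Real.exp_pos _).le

theorem convex_Omega {S : Lat d → ℝ} (hS : ∀ x, 0 ≤ S x) : Convex ℝ (Omega S) := by
  intro μ hμ ν hν a b ha hb hab
  refine Summable.of_nonneg_of_le (fun y => tilt_nonneg hS _ y) (fun y => ?_)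
    ((Summable.mul_left a hμ).add (Summable.mul_left b hν))
  have h1 := convexOn_exp.2 (mem_univ (inner ℝ μ (emb y))) (mem_univ (inner ℝ ν (emb y))) ha hb hab
  simp only [tilt, inner_add_left, real_inner_smul_left]
  simp only [smul_eq_mul] at h1
  calc _ ≤ S y * (a * Real.exp (inner ℝ μ (emb y)) + b * Real.exp (inner ℝ ν (emb y))) := by
        gcongr; exact hS y
    _ = _ := by ring

section Symmetry

variable {S : Lat d → ℝ}

/-- Change the signs of the coordinates in `s`. -/
def flip (s : Finset (Fin d)) (y : Lat d) : Lat d := fun j => if j ∈ s then -y j else y j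

theorem flip_flip (s : Finset (Fin d)) (y : Lat d) : flip s (flip s y) = y := by
  funext j; simp only [flip]; split_ifs <;> simp

theorem LatSymmetric.flip_eq (h : LatSymmetric S) (s : Finset (Fin d)) (y : Lat d) :
    S (flip s y) = S y := by
  induction s using Finset.induction_on with
  | empty => congr 1
  | insert i s hi ih =>
    rw [← ih, ← h.1 (flip s y) i]
    congr 1
    funext j
    rcases eq_or_ne j i with rfl | hj
    · simp [flip, hi]
    · simp [flip, hj]

theorem inner_single (i : Fin d) (t : ℝ) (y : Lat d) :
    inner ℝ (EuclideanSpace.single i t : Euc d) (emb y) = t * y i := by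
  rw [inner_emb, Finset.sum_eq_single i]
  · simp
  · intro j _ hj; simp [hj]
  · simp

/-- The projection of a point of `Ω` to a coordinate axis is in `Ω`: it is the midpoint of the point
and its reflection in all other coordinates. -/
theorem LatSymmetric.single_mem_of_apply (h : LatSymmetric S) (hS : ∀ x, 0 ≤ S x) {μ : Euc d}
    (hμ : μ ∈ Omega S) (i : Fin d) : (EuclideanSpace.single i (μ i) : Euc d) ∈ Omega S := by
  set s : Finset (Fin d) := {i}ᶜ
  set ν : Euc d := WithLp.toLp 2 fun j => if j ∈ s then -μ j else μ j with hν
  have hin : ∀ y, inner ℝ ν (emb y) = inner ℝ μ (emb (flip s y)) := fun y => by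
    rw [inner_emb, inner_emb]
    refine Finset.sum_congr rfl fun j _ => ?_
    simp only [hν, flip]
    split_ifs <;> simp
  have hνm : ν ∈ Omega S := by
    have h1 := (Equiv.summable_iff ⟨flip s, flip s, flip_flip s, flip_flip s⟩).2
      (show Summable (tilt S μ) from hμ)
    refine h1.congr fun y => ?_
    simp only [Function.comp_apply, Equiv.coe_fn_mk, tilt, h.flip_eq, hin]
  have h2 := convex_Omega hS hμ hνm (by norm_num : (0 : ℝ) ≤ 1 / 2) (by norm_num : (0 : ℝ) ≤ 1 / 2)
    (by norm_num)
  convert h2 using 1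
  ext j
  rcases eq_or_ne j i with rfl | hj
  · simp [hν, s]; ring
  · simp [hν, s, hj]

theorem LatSymmetric.single_neg_mem (h : LatSymmetric S) {i : Fin d} {t : ℝ}
    (hm : (EuclideanSpace.single i t : Euc d) ∈ Omega S) :
    (EuclideanSpace.single i (-t) : Euc d) ∈ Omega S := by
  have h1 := (Equiv.summable_iff ⟨flip {i}, flip {i}, flip_flip {i}, flip_flip {i}⟩).2
    (show Summable (tilt S _) from hm)
  refine h1.congr fun y => ?_
  simp only [Function.comp_apply, Equiv.coe_fn_mk, tilt, h.flip_eq, inner_single]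
  simp [flip]

theorem LatSymmetric.single_swap_mem (h : LatSymmetric S) {i : Fin d} (j : Fin d) {t : ℝ}
    (hm : (EuclideanSpace.single i t : Euc d) ∈ Omega S) :
    (EuclideanSpace.single j t : Euc d) ∈ Omega S := by
  have h1 := (Equiv.summable_iff (Equiv.arrowCongr (Equiv.swap i j) (Equiv.refl ℤ))).2
    (show Summable (tilt S _) from hm)
  refine h1.congr fun y => ?_
  have h2 : (Equiv.arrowCongr (Equiv.swap i j) (Equiv.refl ℤ)) y = y ∘ (Equiv.swap i j) := by
    funext k; simp [Equiv.arrowCongr]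
  simp only [Function.comp_apply, tilt, inner_single]
  rw [h2, h.2]
  simp

end Symmetry

variable {S J h : Lat d → ℝ} {M K ζ : ℝ}

/-- Sums against a tilted function are continuous along rays up to the boundary point. -/
theorem tendsto_tsum_tilt {E : Type*} [NormedAddCommGroup E] [NormedSpace ℝ E] [CompleteSpace E]
    {F : Lat d → ℝ} {c : Lat d → E} {μ : Euc d} (h0 : Summable fun y => ‖c y‖ * |F y|)
    (h1 : Summable fun y => ‖c y‖ * |tilt F μ y|) :
    Filter.Tendsto (fun t : ℝ => ∑' y, tilt F (t • μ) y • c y) (nhdsWithin 1 (Iio 1))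
      (nhds (∑' y, tilt F μ y • c y)) := by
  have hmem : ∀ᶠ t in nhdsWithin (1 : ℝ) (Iio 1), 0 < t ∧ t < 1 := by
    filter_upwards [Ioo_mem_nhdsLT (zero_lt_one' ℝ)] with t ht using ht
  refine tendsto_tsum_of_dominated_convergence (h0.add h1) (fun y => ?_) ?_
  · refine Filter.Tendsto.mono_left ?_ nhdsWithin_le_nhds
    have hc : Continuous fun t : ℝ => tilt F (t • μ) y • c y := by
      unfold tilt
      simp only [real_inner_smul_left]
      fun_prop
    have := hc.tendsto 1
    simpa using this
  · filter_upwards [hmem] with t ht y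
    rw [norm_smul, mul_comm, ← mul_add]
    gcongr
    simp only [tilt, real_inner_smul_left, norm_mul, abs_mul, Real.norm_eq_abs, Real.abs_exp]
    set u := inner ℝ μ (emb y)
    have h2 : Real.exp (t * u) ≤ 1 + Real.exp u := by
      rcases le_total u 0 with hu | hu
      · have : Real.exp (t * u) ≤ 1 := Real.exp_le_one_iff.2 (mul_nonpos_of_nonneg_of_nonpos ht.1.le hu)
        linarith [Real.exp_pos u]
      · have : Real.exp (t * u) ≤ Real.exp u := Real.exp_le_exp.2 (by nlinarith [ht.2])
        linarith
    calc |F y| * Real.exp (t * u) ≤ |F y| * (1 + Real.exp u) := by gcongr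
      _ = _ := by ring

theorem oz_tilt (hB : OZBounds M K ζ S J h) (μ : Euc d) (x : Lat d) :
    tilt S μ x = tilt h μ x + latConv (tilt J μ) (tilt S μ) x := by
  rw [← tilt_latConv, tilt, tilt, tilt, hB.oz x]; ring

/-- The Ornstein-Zernike equation in Fourier space, for tilts inside `Ω`. -/
theorem latFourier_oz (hM : 0 < M) (hB : OZBounds M K ζ S J h)
    {μ : Euc d} (hμ : μ ∈ Omega S) (k : Euc d) :
    latFourier (tilt S μ) k * (1 - latFourier (tilt J μ) k) = latFourier (tilt h μ) k := by
  have hQ := hB.mem_Q μ (subset_closure hμ)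
  have hJ : Summable (tilt J μ) := summable_abs_iff.1 (hQ.sum_Q hM).1
  have hh : Summable (tilt h μ) := summable_abs_iff.1 (hQ.sum_g hM).1
  have hS : Summable (tilt S μ) := hμ
  have h1 : latFourier (tilt S μ) k =
      latFourier (tilt h μ) k + latFourier (latConv (tilt J μ) (tilt S μ)) k := by
    rw [latFourier_eq, latFourier_eq, latFourier_eq, ← (summable_mul_char hh k).tsum_add
      (summable_mul_char (summable_latConv hJ hS) k)]
    refine tsum_congr fun x => ?_
    rw [oz_tilt hB]; push_cast; ring
  rw [latFourier_latConv hJ hS] at h1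
  linear_combination h1

theorem tsum_oz (hM : 0 < M) (hB : OZBounds M K ζ S J h) {μ : Euc d}
    (hμ : μ ∈ Omega S) :
    (∑' y, tilt S μ y) * (1 - ∑' y, tilt J μ y) = ∑' y, tilt h μ y := by
  have := latFourier_oz hM hB hμ 0
  rw [latFourier_zero, latFourier_zero, latFourier_zero] at this
  exact_mod_cast this

theorem tsum_h_pos (hB : OZBounds M K ζ S J h) {μ : Euc d} (hμ : μ ∈ closure (Omega S)) :
    0 < ∑' y, tilt h μ y := by
  have := hB.h_pos μ hμ
  rwa [latFourier_zero, Complex.ofReal_re] at this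

variable [NeZero d]

theorem AveragedDecay.single_mem_iff (hA : AveragedDecay S) (i : Fin d) (t : ℝ) :
    (EuclideanSpace.single i t : Euc d) ∈ Omega S ↔ axis |t| ∈ Omega S := by
  unfold axis
  constructor
  · intro h
    rcases abs_cases t with ⟨h1, -⟩ | ⟨h1, -⟩ <;> rw [h1]
    · exact hA.symm.single_swap_mem 0 h
    · exact hA.symm.single_swap_mem 0 (hA.symm.single_neg_mem h)
  · intro h
    rcases abs_cases t with ⟨h1, -⟩ | ⟨h1, -⟩ <;> rw [h1] at h
    · exact hA.symm.single_swap_mem i h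
    · have := hA.symm.single_neg_mem (hA.symm.single_swap_mem i h)
      rwa [neg_neg] at this

/-- `Ω` is an open convex neighbourhood of the origin, hence contains the half-open segment from the
origin to any point of its closure. -/
theorem AveragedDecay.smul_mem (hA : AveragedDecay S) {μ : Euc d} (hμ : μ ∈ closure (Omega S))
    {t : ℝ} (ht0 : 0 ≤ t) (ht1 : t < 1) : t • μ ∈ Omega S := by
  have h1 := (convex_Omega hA.nonneg).combo_interior_closure_mem_interior
    (hA.isOpen.interior_eq.symm ▸ hA.zero_mem) hμ (sub_pos.2 ht1) ht0 (by ring)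
  rwa [smul_zero, zero_add, hA.isOpen.interior_eq] at h1

theorem axis_smul (a t : ℝ) : (axis (a * t) : Euc d) = a • axis t := by
  ext j; simp [axis]

theorem AveragedDecay.axis_mem_of_le (hA : AveragedDecay S) {s t : ℝ} (hs : 0 ≤ s) (hst : s ≤ t)
    (ht : axis t ∈ Omega S) : axis s ∈ Omega S := by
  rcases hst.eq_or_lt with rfl | hlt
  · exact ht
  have ht0 : 0 < t := hs.trans_lt hlt
  have := hA.smul_mem (subset_closure ht) (t := s / t) (by positivity) ((div_lt_one ht0).2 hlt)
  rwa [← axis_smul, div_mul_cancel₀ _ ht0.ne'] at this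

theorem AveragedDecay.isLUB_mass (hA : AveragedDecay S) : IsLUB (massSet S) (mass S) := by
  refine Real.isLUB_sSup ⟨0, le_rfl, ?_⟩ ?_
  · have : (axis 0 : Euc d) = 0 := by ext j; simp [axis]
    rw [this]; exact hA.zero_mem
  · obtain ⟨m, hm, hn⟩ := hA.exists_notMem
    refine ⟨m, fun t ht => ?_⟩
    by_contra hc
    push Not at hc
    exact hn (hA.axis_mem_of_le hm.le hc.le ht.2)

theorem AveragedDecay.mass_pos (hA : AveragedDecay S) : 0 < mass S := by
  have hc : Continuous fun t : ℝ => (axis t : Euc d) := by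
    have : (fun t : ℝ => (axis t : Euc d)) = fun t => t • axis 1 := by
      funext t; rw [← axis_smul, mul_one]
    rw [this]; fun_prop
  have h0 : (axis 0 : Euc d) = 0 := by ext j; simp [axis]
  have h1 : ∀ᶠ t in nhds (0 : ℝ), axis t ∈ Omega S :=
    hc.continuousAt.eventually_mem (by rw [h0]; exact hA.isOpen.mem_nhds hA.zero_mem)
  have h2 : ∀ᶠ t in nhdsWithin (0 : ℝ) (Ioi 0), axis t ∈ Omega S := h1.filter_mono nhdsWithin_le_nhds
  obtain ⟨t, ht, ht0⟩ := (h2.and self_mem_nhdsWithin).exists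
  exact lt_of_lt_of_le ht0 (hA.isLUB_mass.1 ⟨le_of_lt ht0, ht⟩)

theorem AveragedDecay.axis_mem_of_lt_mass (hA : AveragedDecay S) {s : ℝ} (hs : 0 ≤ s)
    (hsm : s < mass S) : axis s ∈ Omega S := by
  obtain ⟨t, ht, hst⟩ := (lt_isLUB_iff hA.isLUB_mass).1 hsm
  exact hA.axis_mem_of_le hs hst.le ht.2

theorem AveragedDecay.abs_apply_le_mass (hA : AveragedDecay S) {μ : Euc d} (hμ : μ ∈ Omega S)
    (i : Fin d) : |μ i| ≤ mass S :=
  hA.isLUB_mass.1 ⟨abs_nonneg _, (hA.single_mem_iff i (μ i)).1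
    (hA.symm.single_mem_of_apply hA.nonneg hμ i)⟩

theorem AveragedDecay.isCompact_closure (hA : AveragedDecay S) : IsCompact (closure (Omega S)) := by
  refine Bornology.IsBounded.isCompact_closure ?_
  refine (Metric.isBounded_closedBall (x := (0 : Euc d))
    (r := Real.sqrt (d * mass S ^ 2))).subset fun μ hμ => ?_
  rw [mem_closedBall_zero_iff]
  refine Real.le_sqrt_of_sq_le ?_
  rw [EuclideanSpace.norm_sq_eq]
  refine (Finset.sum_le_card_nsmul _ _ (mass S ^ 2) fun i _ => ?_).trans_eq (by simp)
  rw [Real.norm_eq_abs]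
  have := hA.abs_apply_le_mass hμ i
  gcongr

theorem AveragedDecay.mem_frontier_iff (hA : AveragedDecay S) {μ : Euc d} :
    μ ∈ frontier (Omega S) ↔ μ ∈ closure (Omega S) ∧ μ ∉ Omega S := by
  rw [frontier, hA.isOpen.interior_eq]; rfl

/-- Boundary points of the Wulff shape are at distance comparable to the mass from the origin. -/
theorem AveragedDecay.mass_le_norm (hA : AveragedDecay S) {μ : Euc d}
    (hμ : μ ∉ Omega S) : mass S ≤ d * ‖μ‖ := by
  by_contra hc
  push Not at hc
  apply hμ
  have hd : (0 : ℝ) < d := by exact_mod_cast Nat.pos_of_ne_zero (NeZero.ne d)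
  have h1 : ∀ i, (EuclideanSpace.single i (d * μ i) : Euc d) ∈ Omega S := fun i => by
    rw [hA.single_mem_iff]
    refine hA.axis_mem_of_lt_mass (abs_nonneg _) (lt_of_le_of_lt ?_ hc)
    rw [abs_mul, abs_of_pos hd]
    gcongr
    exact abs_apply_le_norm μ i
  have h2 := (convex_Omega hA.nonneg).sum_mem (t := Finset.univ) (w := fun _ : Fin d => (d : ℝ)⁻¹)
    (fun i _ => by positivity) (by simp [hd.ne']) (fun i _ => h1 i)
  convert h2 using 1
  ext j
  rw [WithLp.ofLp_sum, Finset.sum_apply, Finset.sum_eq_single j]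
  · simp [hd.ne']
  · intro i _ hi; simp [hi.symm]
  · simp

/-- Inside `Ω` the Ornstein-Zernike equation at `k = 0` reads `(∑ S^{(μ)}) (1 - ∑ J^{(μ)}) = ∑ h^{(μ)}`
with a positive right-hand side and a nonnegative first factor. -/
theorem tsum_J_lt_one (hM : 0 < M) (hA : AveragedDecay S) (hB : OZBounds M K ζ S J h) {μ : Euc d}
    (hμ : μ ∈ Omega S) : ∑' y, tilt J μ y < 1 := by
  have h1 := tsum_oz hM hB hμ
  have h2 := tsum_h_pos hB (subset_closure hμ)
  have h3 : 0 ≤ ∑' y, tilt S μ y := tsum_nonneg fun y => tilt_nonneg hA.nonneg μ y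
  by_contra hc
  push Not at hc
  nlinarith

theorem tendsto_tsum_J (hM : 0 < M) (hA : AveragedDecay S) (hB : OZBounds M K ζ S J h) {μ : Euc d}
    (hμ : μ ∈ closure (Omega S)) :
    Filter.Tendsto (fun t : ℝ => ∑' y, tilt J (t • μ) y) (nhdsWithin 1 (Iio 1))
      (nhds (∑' y, tilt J μ y)) := by
  have h0 := ((hB.mem_Q 0 (subset_closure hA.zero_mem)).sum_Q hM).1
  have h1 := ((hB.mem_Q μ hμ).sum_Q hM).1
  rw [tilt_zero] at h0
  simpa using tendsto_tsum_tilt (F := J) (c := fun _ => (1 : ℝ)) (μ := μ) (by simpa using h0)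
    (by simpa using h1)

theorem eventually_smul_mem (hA : AveragedDecay S) {μ : Euc d} (hμ : μ ∈ closure (Omega S)) :
    ∀ᶠ t in nhdsWithin (1 : ℝ) (Iio 1), t • μ ∈ Omega S := by
  filter_upwards [Ioo_mem_nhdsLT (zero_lt_one' ℝ)] with t ht
  exact hA.smul_mem hμ ht.1.le ht.2

theorem tsum_J_le_one (hM : 0 < M) (hA : AveragedDecay S) (hB : OZBounds M K ζ S J h) {μ : Euc d}
    (hμ : μ ∈ closure (Omega S)) : ∑' y, tilt J μ y ≤ 1 :=
  le_of_tendsto (tendsto_tsum_J hM hA hB hμ) <| by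
    filter_upwards [eventually_smul_mem hA hμ] with t ht using (tsum_J_lt_one hM hA hB ht).le

/-- On the boundary of the Wulff shape the tilted susceptibility diverges, so that `∑ J^{(μ)} = 1`. -/
theorem tsum_J_eq_one (hM : 0 < M) (hA : AveragedDecay S) (hB : OZBounds M K ζ S J h) {μ : Euc d}
    (hμ : μ ∈ frontier (Omega S)) : ∑' y, tilt J μ y = 1 := by
  obtain ⟨hc, hn⟩ := hA.mem_frontier_iff.1 hμ
  refine (tsum_J_le_one hM hA hB hc).antisymm (le_of_not_gt fun hlt => hn ?_)
  set a := ∑' y, tilt J μ y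
  have hev : ∀ᶠ t in nhdsWithin (1 : ℝ) (Iio 1), ∑' y, tilt S (t • μ) y ≤ M / ((1 - a) / 2) := by
    have h1 := (tendsto_tsum_J hM hA hB hc).eventually (gt_mem_nhds (by linarith : a < (1 + a) / 2))
    filter_upwards [h1, eventually_smul_mem hA hc] with t ht hm
    have h2 := tsum_oz hM hB hm
    have h3 := (hB.mem_Q _ (subset_closure hm)).sum_g hM
    have h4 : ∑' y, tilt h (t • μ) y ≤ M :=
      ((summable_abs_iff.1 h3.1).tsum_le_tsum (fun y => le_abs_self _) h3.1).trans h3.2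
    have h5 : 0 ≤ ∑' y, tilt S (t • μ) y := tsum_nonneg fun y => tilt_nonneg hA.nonneg _ y
    rw [le_div_iff₀ (by linarith)]
    nlinarith
  -- if `∑ J^{(μ)} < 1`, the sums `∑ S^{(tμ)}` stay bounded as `t → 1`, against `μ ∉ Ω`
  refine summable_of_sum_le (fun y => tilt_nonneg hA.nonneg μ y) (c := M / ((1 - a) / 2)) fun F => ?_
  have hlim : Filter.Tendsto (fun t : ℝ => ∑ y ∈ F, tilt S (t • μ) y) (nhdsWithin 1 (Iio 1))
      (nhds (∑ y ∈ F, tilt S μ y)) := by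
    refine Filter.Tendsto.mono_left ?_ nhdsWithin_le_nhds
    have hcont : Continuous fun t : ℝ => ∑ y ∈ F, tilt S (t • μ) y := by
      unfold tilt
      simp only [real_inner_smul_left]
      fun_prop
    simpa using hcont.tendsto 1
  refine le_of_tendsto hlim ?_
  filter_upwards [hev, eventually_smul_mem hA hc] with t ht hm
  exact (Summable.sum_le_tsum F (fun y _ => tilt_nonneg hA.nonneg _ y) hm).trans ht

theorem integral_taylor_exp (u : ℝ) :
    ∫ t in (0 : ℝ)..1, (1 - t) * (u ^ 2 * Real.exp (t * u)) = Real.exp u - 1 - u := by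
  have hder : ∀ t ∈ uIcc (0 : ℝ) 1, HasDerivAt (fun t : ℝ => ((1 - t) * u + 1) * Real.exp (t * u))
      ((1 - t) * (u ^ 2 * Real.exp (t * u))) t := by
    intro t _
    have h1 : HasDerivAt (fun t : ℝ => (1 - t) * u + 1) (-1 * u) t :=
      (((hasDerivAt_id t).const_sub 1).mul_const u).add_const 1
    have h2 : HasDerivAt (fun t : ℝ => Real.exp (t * u)) (Real.exp (t * u) * (1 * u)) t :=
      ((hasDerivAt_id t).mul_const u).exp
    exact (h1.mul h2).congr_deriv (by ring)
  rw [intervalIntegral.integral_eq_sub_of_hasDerivAt hder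
    (by apply Continuous.intervalIntegrable; fun_prop)]
  norm_num
  linarith

/-- `μ ↦ ∑ J^{(μ)}` is uniformly convex on the Wulff shape, with second order Taylor bounds. The
Hessian is the covariance matrix, which is at least `2K` by the infrared bound. -/
theorem taylor_tsum_J (hM : 0 < M) (hζ : 0 < ζ) (hA : AveragedDecay S)
    (hB : OZBounds M K ζ S J h) {μ ν : Euc d} (hμ : μ ∈ closure (Omega S))
    (hν : ν ∈ closure (Omega S)) :
    K * ‖ν - μ‖ ^ 2 ≤ (∑' y, tilt J ν y) - (∑' y, tilt J μ y) - inner ℝ (ν - μ) (drift (tilt J μ)) ∧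
      (∑' y, tilt J ν y) - (∑' y, tilt J μ y) - inner ℝ (ν - μ) (drift (tilt J μ)) ≤
        M / 2 * ‖ν - μ‖ ^ 2 := by
  set v := ν - μ with hv
  have qμ := hB.mem_Q μ hμ
  have qν := hB.mem_Q ν hν
  have sμ : Summable (tilt J μ) := summable_abs_iff.1 (qμ.sum_Q hM).1
  have sν : Summable (tilt J ν) := summable_abs_iff.1 (qν.sum_Q hM).1
  have s1 := qμ.sum_norm_Q hM hζ
  have s2μ := qμ.sum_sq_Q hM hζ
  have s2ν := qν.sum_sq_Q hM hζ
  set F : Lat d → ℝ → ℝ := fun y t =>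
    (1 - t) * (inner ℝ v (emb y) ^ 2 * tilt J (μ + t • v) y) with hF
  have hFeq : ∀ y t, F y t = tilt J μ y *
      ((1 - t) * (inner ℝ v (emb y) ^ 2 * Real.exp (t * inner ℝ v (emb y)))) := by
    intro y t
    simp only [hF, tilt, inner_add_left, real_inner_smul_left, Real.exp_add]; ring
  have hb : Summable fun y => ‖v‖ ^ 2 * (‖emb y‖ ^ 2 * |tilt J μ y| + ‖emb y‖ ^ 2 * |tilt J ν y|) :=
    (s2μ.1.add s2ν.1).mul_left _
  have hFb : ∀ y, ∀ t ∈ Icc (0 : ℝ) 1, ‖F y t‖ ≤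
      ‖v‖ ^ 2 * (‖emb y‖ ^ 2 * |tilt J μ y| + ‖emb y‖ ^ 2 * |tilt J ν y|) := by
    intro y t ht
    have e1 : |tilt J (μ + t • v) y| ≤ |tilt J μ y| + |tilt J ν y| := by
      have hin : inner ℝ (μ + t • v) (emb y) =
          (1 - t) * inner ℝ μ (emb y) + t * inner ℝ ν (emb y) := by
        rw [inner_add_left, real_inner_smul_left, hv, inner_sub_left]; ring
      have e2 := convexOn_exp.2 (mem_univ (inner ℝ μ (emb y))) (mem_univ (inner ℝ ν (emb y)))
        (sub_nonneg.2 ht.2) ht.1 (by ring)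
      simp only [smul_eq_mul] at e2
      simp only [tilt, abs_mul, Real.abs_exp, hin, ← mul_add]
      gcongr
      have e3 := Real.exp_pos (inner ℝ μ (emb y))
      have e4 := Real.exp_pos (inner ℝ ν (emb y))
      nlinarith [ht.1, ht.2]
    rw [hF, norm_mul, norm_mul, Real.norm_of_nonneg (sub_nonneg.2 ht.2),
      Real.norm_of_nonneg (sq_nonneg _), ← mul_add]
    calc (1 - t) * (inner ℝ v (emb y) ^ 2 * ‖tilt J (μ + t • v) y‖)
        ≤ 1 * ((‖v‖ ^ 2 * ‖emb y‖ ^ 2) * (|tilt J μ y| + |tilt J ν y|)) := by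
          gcongr
          · linarith [ht.1]
          · exact inner_sq_le v y
          · exact e1
      _ = _ := by ring
  have hFc : ∀ y, Continuous (F y) := fun y => by
    have : F y = fun t => tilt J μ y *
      ((1 - t) * (inner ℝ v (emb y) ^ 2 * Real.exp (t * inner ℝ v (emb y)))) := funext (hFeq y)
    rw [this]; fun_prop
  have hint : ∀ y, ∫ t in (0 : ℝ)..1, F y t =
      tilt J μ y * (Real.exp (inner ℝ v (emb y)) - 1 - inner ℝ v (emb y)) := fun y => by
    simp_rw [hFeq]
    rw [intervalIntegral.integral_const_mul, integral_taylor_exp]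
  have hsum : HasSum (fun y => ∫ t in (0 : ℝ)..1, F y t) (∫ t in (0 : ℝ)..1, ∑' y, F y t) := by
    refine intervalIntegral.hasSum_integral_of_dominated_convergence
      (fun y _ => ‖v‖ ^ 2 * (‖emb y‖ ^ 2 * |tilt J μ y| + ‖emb y‖ ^ 2 * |tilt J ν y|))
      (fun y => (hFc y).aestronglyMeasurable) (fun y => Filter.Eventually.of_forall fun t ht => ?_)
      (Filter.Eventually.of_forall fun t _ => hb) ?_
      (Filter.Eventually.of_forall fun t ht => ?_)
    · rw [uIoc_of_le zero_le_one] at ht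
      exact hFb y t ⟨ht.1.le, ht.2⟩
    · exact intervalIntegrable_const
    · rw [uIoc_of_le zero_le_one] at ht
      exact (Summable.of_norm_bounded hb fun y => hFb y t ⟨ht.1.le, ht.2⟩).hasSum
  have hlhs : HasSum (fun y => ∫ t in (0 : ℝ)..1, F y t)
      ((∑' y, tilt J ν y) - (∑' y, tilt J μ y) - inner ℝ v (drift (tilt J μ))) := by
    rw [inner_drift s1.1]
    refine HasSum.congr_fun ((sν.hasSum.sub sμ.hasSum).sub (summable_inner_mul s1.1 v).hasSum) ?_
    intro y
    have hνv : tilt J ν y = tilt J μ y * Real.exp (inner ℝ v (emb y)) := by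
      rw [tilt, tilt, mul_assoc, ← Real.exp_add, ← inner_add_left, hv, add_sub_cancel]
    rw [hint y, hνv]
    ring
  rw [hlhs.unique hsum]
  have hquad : ∀ t ∈ Icc (0 : ℝ) 1, (1 - t) * (2 * K * ‖v‖ ^ 2) ≤ ∑' y, F y t ∧
      ∑' y, F y t ≤ (1 - t) * (M * ‖v‖ ^ 2) := by
    intro t ht
    have hm : μ + t • v ∈ closure (Omega S) := by
      have := (convex_Omega hA.nonneg).closure hμ hν (sub_nonneg.2 ht.2) ht.1 (by ring)
      convert this using 1
      rw [hv]; module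
    have qt := hB.mem_Q _ hm
    have he := qt.elliptic hM hζ
    have : ∑' y, F y t = (1 - t) * quad (covMatrix (tilt J (μ + t • v))) v := by
      rw [quad_covMatrix (qt.sum_sq_Q hM hζ).1, ← tsum_mul_left]
    rw [this]
    have h1t : 0 ≤ 1 - t := sub_nonneg.2 ht.2
    exact ⟨mul_le_mul_of_nonneg_left (he.lower v) h1t, mul_le_mul_of_nonneg_left (he.upper v) h1t⟩
  have hcont : IntervalIntegrable (fun t => ∑' y, F y t) volume 0 1 := by
    refine ContinuousOn.intervalIntegrable ?_
    rw [uIcc_of_le zero_le_one]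
    exact continuousOn_tsum (fun y => (hFc y).continuousOn) hb fun y t ht => hFb y t ht
  have hlin : ∀ c : ℝ, ∫ t in (0 : ℝ)..1, (1 - t) * c = c / 2 := fun c => by
    rw [intervalIntegral.integral_mul_const, intervalIntegral.integral_sub (by simp) (by simp)]
    simp; ring
  have hli : ∀ c : ℝ, IntervalIntegrable (fun t : ℝ => (1 - t) * c) volume 0 1 := fun c => by
    apply Continuous.intervalIntegrable; fun_prop
  constructor
  · have := intervalIntegral.integral_mono_on zero_le_one (hli (2 * K * ‖v‖ ^ 2)) hcont
      fun t ht => (hquad t ht).1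
    rw [hlin] at this
    linarith
  · have := intervalIntegral.integral_mono_on zero_le_one hcont (hli (M * ‖v‖ ^ 2))
      fun t ht => (hquad t ht).2
    rw [hlin] at this
    linarith

end Wulff

/-! ### The optimal tilt and the direction of its drift -/

section OptimalTilt

variable {d : ℕ} {S J h : Lat d → ℝ} {M K ζ : ℝ} {x μ : Euc d}

theorem InQ.norm_drift_le (hM : 0 < M) (hζ : 0 < ζ) {Q g : Lat d → ℝ} (h : InQ M K ζ Q g) :
    ‖drift Q‖ ≤ M := by
  have h1 := h.sum_norm_Q hM hζ
  have h2 : ‖drift Q‖ ^ 2 ≤ ‖drift Q‖ * M := by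
    rw [← real_inner_self_eq_norm_sq, inner_drift h1.1]
    have hle : ∀ y, inner ℝ (drift Q) (emb y) * Q y ≤ ‖drift Q‖ * (‖emb y‖ * |Q y|) := fun y => by
      refine (le_abs_self _).trans ?_
      rw [abs_mul, ← mul_assoc]
      gcongr
      exact abs_real_inner_le_norm _ _
    refine ((summable_inner_mul h1.1 _).tsum_le_tsum hle (h1.1.mul_left _)).trans ?_
    rw [tsum_mul_left]
    exact mul_le_mul_of_nonneg_left h1.2 (norm_nonneg _)
  by_contra hlt
  push Not at hlt
  nlinarith

theorem IsOptimalTilt.mem_closure (hμ : IsOptimalTilt S x μ) : μ ∈ closure (Omega S) :=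
  frontier_subset_closure hμ.1

variable [NeZero d]

/-- Linear functionals have no maximiser in the open set `Ω`. -/
theorem AveragedDecay.isOptimalTilt_of_isMaxOn (hA : AveragedDecay S) (hx : x ≠ 0)
    (hμ : μ ∈ closure (Omega S))
    (hmax : IsMaxOn (fun ν : Euc d => inner ℝ ν x) (closure (Omega S)) μ) :
    IsOptimalTilt S x μ := by
  refine ⟨hA.mem_frontier_iff.2 ⟨hμ, fun hin => ?_⟩, hmax⟩
  have hc : Continuous fun ε : ℝ => μ + ε • x := by fun_prop
  have hev : ∀ᶠ ε in nhds (0 : ℝ), μ + ε • x ∈ Omega S :=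
    (hc.tendsto' 0 μ (by simp)).eventually (hA.isOpen.mem_nhds hin)
  obtain ⟨ε, h1, hε⟩ := ((hev.filter_mono nhdsWithin_le_nhds).and
    (self_mem_nhdsWithin : Ioi (0 : ℝ) ∈ nhdsWithin 0 (Ioi 0))).exists
  have h2 : inner ℝ (μ + ε • x) x ≤ inner ℝ μ x := hmax (subset_closure h1)
  rw [inner_add_left, real_inner_smul_left] at h2
  have h3 : 0 < inner ℝ x x := real_inner_self_pos.2 hx
  have h4 : 0 < ε * inner ℝ x x := mul_pos hε h3
  linarith

theorem AveragedDecay.exists_isOptimalTilt (hA : AveragedDecay S) (hx : x ≠ 0) :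
    ∃ μ, IsOptimalTilt S x μ := by
  obtain ⟨μ, hμ, hmax⟩ := hA.isCompact_closure.exists_isMaxOn
    ⟨0, subset_closure hA.zero_mem⟩
    (f := fun ν : Euc d => inner ℝ ν x) (by fun_prop)
  exact ⟨μ, hA.isOptimalTilt_of_isMaxOn hx hμ hmax⟩

/-- Two maximisers would make their midpoint a maximiser, hence a boundary point, against the
strict convexity of `μ ↦ ∑ J^{(μ)}`. -/
theorem IsOptimalTilt.unique (hM : 0 < M) (hK : 0 < K) (hζ : 0 < ζ) (hA : AveragedDecay S)
    (hB : OZBounds M K ζ S J h) (hx : x ≠ 0) {ν : Euc d} (hμ : IsOptimalTilt S x μ)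
    (hν : IsOptimalTilt S x ν) : μ = ν := by
  have hval : inner ℝ μ x = inner ℝ ν x :=
    le_antisymm (hν.2 hμ.mem_closure) (hμ.2 hν.mem_closure)
  set m : Euc d := (1 / 2 : ℝ) • μ + (1 / 2 : ℝ) • ν with hm
  have hmc : m ∈ closure (Omega S) :=
    (convex_Omega hA.nonneg).closure hμ.mem_closure hν.mem_closure (by norm_num) (by norm_num)
      (by norm_num)
  have hmx : inner ℝ m x = inner ℝ μ x := by
    rw [hm, inner_add_left, real_inner_smul_left, real_inner_smul_left, ← hval]; ring
  have hmo : IsOptimalTilt S x m := hA.isOptimalTilt_of_isMaxOn hx hmc fun ν hν => by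
    change inner ℝ ν x ≤ inner ℝ m x
    rw [hmx]
    exact hμ.2 hν
  have e0 := tsum_J_eq_one hM hA hB hmo.1
  have e1 := tsum_J_eq_one hM hA hB hμ.1
  have e2 := tsum_J_eq_one hM hA hB hν.1
  have t1 := (taylor_tsum_J hM hζ hA hB hmc hμ.mem_closure).1
  have t2 := (taylor_tsum_J hM hζ hA hB hmc hν.mem_closure).1
  have f1 : μ - m = (1 / 2 : ℝ) • (μ - ν) := by rw [hm]; module
  have f2 : ν - m = -((1 / 2 : ℝ) • (μ - ν)) := by rw [hm]; module
  rw [e0, e1, f1] at t1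
  rw [e0, e2, f2, norm_neg, inner_neg_left] at t2
  have h0 : ‖(1 / 2 : ℝ) • (μ - ν)‖ ^ 2 ≤ 0 := by nlinarith
  have h1 := pow_eq_zero_iff (two_ne_zero) |>.1 (h0.antisymm (sq_nonneg _))
  rw [norm_smul] at h1
  have h2 : ‖μ - ν‖ = 0 := by simpa using h1
  exact sub_eq_zero.1 (norm_eq_zero.1 h2)

theorem isOptimalTilt_optimalTilt (hA : AveragedDecay S) (hx : x ≠ 0) :
    IsOptimalTilt S x (optimalTilt S x) :=
  Classical.epsilon_spec (hA.exists_isOptimalTilt hx)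

/-- The Taylor bound of `μ ↦ ∑ J^{(μ)}` between a boundary point, where the value is `1`, and the
origin. -/
theorem mul_sq_norm_le_inner_drift (hM : 0 < M) (hζ : 0 < ζ) (hA : AveragedDecay S)
    (hB : OZBounds M K ζ S J h) (hμ : μ ∈ frontier (Omega S)) :
    K * ‖μ‖ ^ 2 + (1 - ∑' y, J y) ≤ inner ℝ μ (drift (tilt J μ)) := by
  have t := (taylor_tsum_J hM hζ hA hB (frontier_subset_closure hμ)
    (subset_closure hA.zero_mem)).1
  rw [tsum_J_eq_one hM hA hB hμ, tilt_zero, zero_sub, norm_neg, inner_neg_left] at t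
  linarith

theorem inner_drift_pos (hM : 0 < M) (hK : 0 < K) (hζ : 0 < ζ) (hA : AveragedDecay S)
    (hB : OZBounds M K ζ S J h) (hμ : μ ∈ frontier (Omega S)) :
    0 < inner ℝ μ (drift (tilt J μ)) := by
  have h1 := mul_sq_norm_le_inner_drift hM hζ hA hB hμ
  have h2 := tsum_J_lt_one hM hA hB hA.zero_mem
  rw [tilt_zero] at h2
  nlinarith [sq_nonneg ‖μ‖]

/-- The drift is at least of the order of the tilt, uniformly in the family. -/
theorem mul_norm_le_norm_drift (hM : 0 < M) (hK : 0 < K) (hζ : 0 < ζ) (hA : AveragedDecay S)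
    (hB : OZBounds M K ζ S J h) (hμ : μ ∈ frontier (Omega S)) :
    K * ‖μ‖ ≤ ‖drift (tilt J μ)‖ := by
  have h1 := mul_sq_norm_le_inner_drift hM hζ hA hB hμ
  have h2 := tsum_J_lt_one hM hA hB hA.zero_mem
  rw [tilt_zero] at h2
  have h3 := real_inner_le_norm μ (drift (tilt J μ))
  have h4 : μ ≠ 0 := by
    rintro rfl
    have := inner_drift_pos hM hK hζ hA hB hμ
    simp at this
  have h5 : 0 < ‖μ‖ := norm_pos_iff.2 h4
  refine le_of_mul_le_mul_left ?_ h5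
  nlinarith

theorem drift_ne_zero (hM : 0 < M) (hK : 0 < K) (hζ : 0 < ζ) (hA : AveragedDecay S)
    (hB : OZBounds M K ζ S J h) (hμ : μ ∈ frontier (Omega S)) :
    drift (tilt J μ) ≠ 0 := by
  intro h0
  have := inner_drift_pos hM hK hζ hA hB hμ
  simp [h0] at this

/-- At the optimal tilt for `x`, the drift points in the direction of `x`. Otherwise some `v` has
`v·x > 0` and `v·η ≤ 0`; then the segment from `(1-κδ)μ` in direction `δv` leaves `Ω`, so it
contains a boundary point, at which the Taylor expansion around `μ` gives `∑ J < 1` for small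
`δ`. -/
theorem IsOptimalTilt.drift_eq (hM : 0 < M) (hK : 0 < K) (hζ : 0 < ζ) (hA : AveragedDecay S)
    (hB : OZBounds M K ζ S J h) (hx : x ≠ 0) (hμ : IsOptimalTilt S x μ) :
    drift (tilt J μ) = (‖drift (tilt J μ)‖ / ‖x‖) • x := by
  set η := drift (tilt J μ) with hη
  have hη0 : η ≠ 0 := drift_ne_zero hM hK hζ hA hB hμ.1
  have hηp : 0 < ‖η‖ := norm_pos_iff.2 hη0
  have hxp : 0 < ‖x‖ := norm_pos_iff.2 hx
  have hβ : 0 < inner ℝ μ η := inner_drift_pos hM hK hζ hA hB hμ.1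
  by_contra hne
  have hlt : inner ℝ x η < ‖x‖ * ‖η‖ := by
    refine lt_of_le_of_ne (real_inner_le_norm x η) fun heq => hne ?_
    have := inner_eq_norm_mul_iff_real.1 heq
    rw [div_eq_inv_mul, mul_smul, this, smul_smul, inv_mul_cancel₀ hxp.ne', one_smul]
  set v : Euc d := (1 / ‖x‖) • x - (1 / ‖η‖) • η with hv
  have hvη : inner ℝ v η ≤ 0 := by
    rw [hv, inner_sub_left, real_inner_smul_left, real_inner_smul_left,
      real_inner_self_eq_norm_sq, sub_nonpos, one_div_mul_eq_div, one_div_mul_eq_div,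
      div_le_div_iff₀ hxp hηp]
    nlinarith
  have hvx : 0 < inner ℝ v x := by
    rw [hv, inner_sub_left, real_inner_smul_left, real_inner_smul_left,
      real_inner_self_eq_norm_sq, sub_pos, one_div_mul_eq_div, one_div_mul_eq_div,
      div_lt_div_iff₀ hηp hxp, real_inner_comm]
    nlinarith
  have hμx : 0 ≤ inner ℝ μ x := by
    have : inner ℝ (0 : Euc d) x ≤ inner ℝ μ x := hμ.2 (subset_closure hA.zero_mem)
    simpa using this
  obtain ⟨κ, hκ, hκx⟩ : ∃ κ : ℝ, 0 < κ ∧ κ * inner ℝ μ x < inner ℝ v x := by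
    refine ⟨inner ℝ v x / (inner ℝ μ x + 1), by positivity, ?_⟩
    rw [div_mul_eq_mul_div, div_lt_iff₀ (by positivity)]
    nlinarith
  set N := ‖v‖ + κ * ‖μ‖ with hN
  have hN0 : 0 ≤ N := by positivity
  obtain ⟨δ, hδ, hδ1, hδ2⟩ : ∃ δ : ℝ, 0 < δ ∧ κ * δ ≤ 1 ∧
      M / 2 * (δ * N ^ 2) < κ * inner ℝ μ η := by
    have hc1 : Continuous fun δ : ℝ => κ * δ := by fun_prop
    have hc2 : Continuous fun δ : ℝ => M / 2 * (δ * N ^ 2) := by fun_prop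
    have l1 := (hc1.tendsto' 0 0 (by simp)).eventually (gt_mem_nhds (zero_lt_one' ℝ))
    have l2 := (hc2.tendsto' 0 0 (by simp)).eventually (gt_mem_nhds (mul_pos hκ hβ))
    obtain ⟨δ, ⟨h1, h2⟩, hδ⟩ := (((l1.and l2).filter_mono nhdsWithin_le_nhds).and
      (self_mem_nhdsWithin : Ioi (0 : ℝ) ∈ nhdsWithin 0 (Ioi 0))).exists
    exact ⟨δ, hδ, h1.le, h2⟩
  have hκδ : 0 < κ * δ := by positivity
  have hstart : (1 - κ * δ) • μ ∈ Omega S :=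
    hA.smul_mem hμ.mem_closure (by linarith) (by linarith)
  have hend : (1 - κ * δ) • μ + δ • v ∉ closure (Omega S) := fun hin => by
    have h1 : inner ℝ ((1 - κ * δ) • μ + δ • v) x ≤ inner ℝ μ x := hμ.2 hin
    rw [inner_add_left, real_inner_smul_left, real_inner_smul_left] at h1
    nlinarith
  obtain ⟨r, hr, hrf⟩ : ∃ r ∈ segment ℝ ((1 - κ * δ) • μ) ((1 - κ * δ) • μ + δ • v),
      r ∈ frontier (Omega S) := by
    by_contra! hno
    obtain ⟨r, -, h1, h2⟩ := (convex_segment (𝕜 := ℝ) ((1 - κ * δ) • μ)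
      ((1 - κ * δ) • μ + δ • v)).isPreconnected (Omega S) (closure (Omega S))ᶜ hA.isOpen
      isClosed_closure.isOpen_compl
      (fun r hr => by
        by_cases hin : r ∈ Omega S
        · exact Or.inl hin
        · exact Or.inr fun hc => hno r hr (hA.mem_frontier_iff.2 ⟨hc, hin⟩))
      ⟨_, left_mem_segment _ _ _, hstart⟩ ⟨_, right_mem_segment _ _ _, hend⟩
    exact h2 (subset_closure h1)
  rw [segment_eq_image'] at hr
  obtain ⟨t, ⟨ht0, ht1⟩, rfl⟩ := hr
  have t2 := (taylor_tsum_J hM hζ hA hB hμ.mem_closure (frontier_subset_closure hrf)).2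
  rw [tsum_J_eq_one hM hA hB hrf, tsum_J_eq_one hM hA hB hμ.1, ← hη] at t2
  have e : (1 - κ * δ) • μ + t • ((1 - κ * δ) • μ + δ • v - (1 - κ * δ) • μ) - μ =
      δ • (t • v - κ • μ) := by module
  rw [e, real_inner_smul_left, inner_sub_left, real_inner_smul_left, real_inner_smul_left,
    norm_smul, Real.norm_of_nonneg hδ.le] at t2
  have hn : ‖t • v - κ • μ‖ ≤ N := by
    refine (norm_sub_le _ _).trans ?_
    rw [norm_smul, norm_smul, Real.norm_of_nonneg ht0, Real.norm_of_nonneg hκ.le, hN]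
    gcongr
    exact mul_le_of_le_one_left (norm_nonneg _) ht1
  have hn2 : M / 2 * (δ * ‖t • v - κ • μ‖) ^ 2 ≤ δ * (M / 2 * (δ * N ^ 2)) := by
    have := mul_self_le_mul_self (norm_nonneg _) hn
    have h3 : 0 ≤ M / 2 * δ ^ 2 := by positivity
    nlinarith
  have h4 : t * inner ℝ v η ≤ 0 := mul_nonpos_of_nonneg_of_nonpos ht0 hvη
  have h5 : δ * (t * inner ℝ v η) ≤ 0 := mul_nonpos_of_nonneg_of_nonpos hδ.le h4
  have h6 := mul_lt_mul_of_pos_left hδ2 hδ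
  linarith

theorem mass_mul_normS (hA : AveragedDecay S) (hx : x ≠ 0) :
    mass S * normS S x = inner ℝ (optimalTilt S x) x := by
  rw [normS, if_neg hx, mul_div_cancel₀ _ hA.mass_pos.ne']

end OptimalTilt

/-! ### The tilted two-point function as a time integral of semigroup kernels -/

section Representation

variable {d : ℕ} {M K ζ : ℝ} {Q g : Lat d → ℝ}

theorem continuous_semiKernel (hQ : Summable Q) (hg : Summable g) (x : Lat d) :
    Continuous fun s : ℝ => semiKernel Q g s x := by
  unfold semiKernel
  refine continuous_const.mul ?_
  refine continuous_parametric_integral_of_continuous (f := fun (s : ℝ) k => char k (-x) *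
    (latFourier g k * Complex.exp (-(s : ℂ) * (1 - latFourier Q k)))) ?_ isCompact_box
  have h1 := continuous_latFourier hQ
  have h2 := continuous_latFourier hg
  have h3 := continuous_char (d := d) (-x)
  simp only [Function.uncurry_def]
  exact (h3.comp continuous_snd).mul ((h2.comp continuous_snd).mul
    (Complex.continuous_exp.comp ((Complex.continuous_ofReal.comp continuous_fst).neg.mul
      (continuous_const.sub (h1.comp continuous_snd)))))

theorem InQ.latFourier_re_le_tsum (hK : 0 < K) (h : InQ M K ζ Q g) {k : Euc d}
    (hk : k ∈ box d) : (latFourier Q k).re ≤ ∑' y, Q y := by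
  have h1 := h.infrared k hk
  rw [latFourier_zero, Complex.sub_re, Complex.ofReal_re] at h1
  nlinarith [sq_nonneg ‖k‖]

theorem norm_exp_symbol_le {c s : ℝ} (hs : 0 ≤ s) {q : ℂ} (hq : q.re ≤ 1 - c) :
    ‖Complex.exp (-(s : ℂ) * (1 - q))‖ ≤ Real.exp (-c * s) := by
  rw [Complex.norm_exp]
  refine Real.exp_le_exp.2 ?_
  simp only [Complex.mul_re, Complex.neg_re, Complex.ofReal_re, Complex.neg_im, Complex.ofReal_im,
    Complex.sub_re, Complex.one_re]
  nlinarith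

/-- In the subcritical case `∑ Q < 1`, a solution of `F = g + Q * F` is the time integral of the
semigroup kernels: `1/(1 - Q̂) = ∫_0^∞ e^{-s(1 - Q̂)} ds` and Fubini's theorem. -/
theorem integral_semiKernel (hM : 0 < M) (hK : 0 < K) (h : InQ M K ζ Q g)
    (hlt : ∑' y, Q y < 1) {F : Lat d → ℝ} (hF : Summable F)
    (hoz : ∀ k, latFourier F k * (1 - latFourier Q k) = latFourier g k) (x : Lat d) :
    ∫ s in Ioi (0 : ℝ), semiKernel Q g s x = (F x : ℂ) := by
  have hQ : Summable Q := summable_abs_iff.1 (h.sum_Q hM).1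
  have hg : Summable g := summable_abs_iff.1 (h.sum_g hM).1
  set c := 1 - ∑' y, Q y with hc
  have hc0 : 0 < c := by linarith
  have hre : ∀ k ∈ box d, (latFourier Q k).re ≤ 1 - c := fun k hk => by
    have := h.latFourier_re_le_tsum hK hk
    linarith
  set f : ℝ → Euc d → ℂ := fun s k => char k (-x) *
    (latFourier g k * Complex.exp (-(s : ℂ) * (1 - latFourier Q k))) with hf
  have h1 := continuous_latFourier hQ
  have h2 := continuous_latFourier hg
  have h3 := continuous_char (d := d) (-x)
  have hfc : Continuous (Function.uncurry f) := by
    simp only [hf, Function.uncurry_def]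
    exact (h3.comp continuous_snd).mul ((h2.comp continuous_snd).mul
      (Complex.continuous_exp.comp ((Complex.continuous_ofReal.comp continuous_fst).neg.mul
        (continuous_const.sub (h1.comp continuous_snd)))))
  have hint : Integrable (Function.uncurry f)
      ((volume.restrict (Ioi (0 : ℝ))).prod (volume.restrict (box d))) := by
    have e1 : Integrable (fun s : ℝ => M * Real.exp (-c * s)) (volume.restrict (Ioi (0 : ℝ))) :=
      (integrableOn_exp_mul_Ioi (neg_lt_zero.2 hc0) 0).const_mul M
    have e2 : Integrable (fun _ : Euc d => (1 : ℝ)) (volume.restrict (box d)) :=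
      integrableOn_const (hs := volume_box_lt_top.ne)
    refine (e1.mul_prod e2).mono' hfc.aestronglyMeasurable ?_
    rw [Measure.prod_restrict]
    refine (ae_restrict_iff' (measurableSet_Ioi.prod measurableSet_box)).2
      (Filter.Eventually.of_forall fun p hp => ?_)
    simp only [Function.uncurry_def, hf, norm_mul, norm_char, one_mul, mul_one]
    gcongr
    · exact (norm_latFourier_le hg _).trans (h.sum_g hM).2
    · exact norm_exp_symbol_le (le_of_lt hp.1) (hre _ hp.2)
  have hswap := integral_integral_swap hint
  have hinner : ∀ k ∈ box d, ∫ s in Ioi (0 : ℝ), f s k = char k (-x) * latFourier F k := by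
    intro k hk
    have hne : 0 < (1 - latFourier Q k).re := by
      have := hre k hk
      rw [Complex.sub_re, Complex.one_re]; linarith
    have hne' : 1 - latFourier Q k ≠ 0 := fun h0 => by rw [h0] at hne; simp at hne
    have e1 : ∀ s : ℝ, f s k = char k (-x) * latFourier g k *
        Complex.exp (-(1 - latFourier Q k) * s) := fun s => by
      simp only [hf]; rw [mul_assoc]; congr 3; ring
    simp_rw [e1]
    rw [integral_const_mul, integral_exp_mul_complex_Ioi (by rw [Complex.neg_re]; linarith), ← hoz k]
    simp only [Complex.ofReal_zero, mul_zero, Complex.exp_zero]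
    field_simp
  have hpi : ((2 * (Real.pi : ℂ)) ^ d) ≠ 0 := pow_ne_zero _ (by simp [Real.pi_ne_zero])
  calc ∫ s in Ioi (0 : ℝ), semiKernel Q g s x
      = ((2 * (Real.pi : ℂ)) ^ d)⁻¹ * ∫ s in Ioi (0 : ℝ), ∫ k in box d, f s k := by
        rw [← integral_const_mul]; rfl
    _ = ((2 * (Real.pi : ℂ)) ^ d)⁻¹ * ∫ k in box d, char k (-x) * latFourier F k := by
        rw [hswap]
        congr 1
        exact setIntegral_congr_fun measurableSet_box hinner
    _ = _ := by rw [fourier_inversion hF, inv_mul_cancel_left₀ hpi]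

/-- A time-integrable bound that only depends on a lower bound for the drift: at time `s` the
centre `s η` is at distance of order `s` from a fixed point. -/
theorem norm_semiKernel_le_rpow {C e : ℝ} (hC : 0 ≤ C) (hd : 1 ≤ d) (he : 0 < e) {s : ℝ}
    (hs : 0 < s) {x : Lat d} (hη : e ≤ ‖drift Q‖)
    (hb : ‖semiKernel Q g s x‖ * (1 + ‖emb x - s • drift Q‖ / Real.sqrt (1 + s)) ^ decayExp d ≤
      C * (Real.sqrt (1 + s))⁻¹ ^ d) :
    ‖semiKernel Q g s x‖ ≤ C * ((1 + ‖emb x‖) / min e 1) ^ 2 * (1 + s) ^ (-(3 / 2) : ℝ) := by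
  set L := Real.sqrt (1 + s) with hL
  set v := ‖emb x - s • drift Q‖ with hv
  set a := min e 1 with ha
  have ha0 : 0 < a := lt_min he one_pos
  have hL1 : 1 ≤ L := Real.one_le_sqrt.2 (by linarith)
  have hL0 : 0 < L := by linarith
  have hLsq : L ^ 2 = 1 + s := Real.sq_sqrt (by linarith)
  have hv0 : 0 ≤ v := norm_nonneg _
  have hX : 0 ≤ ‖emb x‖ := norm_nonneg _
  have hvl : s * e - ‖emb x‖ ≤ v := by
    have h1 := norm_sub_norm_le (s • drift Q) (emb x)
    rw [norm_sub_rev, norm_smul, Real.norm_of_nonneg hs.le, ← hv] at h1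
    nlinarith
  have hkey : a * (1 + s) ≤ (1 + ‖emb x‖) * (L + v) := by
    have h1 : a ≤ e := min_le_left _ _
    have h2 : a ≤ 1 := min_le_right _ _
    nlinarith [mul_nonneg hX hv0, mul_nonneg hX hL0.le, mul_le_mul_of_nonneg_right h1 hs.le,
      mul_le_mul_of_nonneg_left hL1 hX]
  have h1 : ‖semiKernel Q g s x‖ * (1 + v / L) ^ 2 ≤ C * L⁻¹ := by
    have hu : 1 ≤ 1 + v / L := by have : 0 ≤ v / L := by positivity
                                  linarith
    calc _ ≤ ‖semiKernel Q g s x‖ * (1 + v / L) ^ decayExp d := by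
          gcongr
          exact two_le_decayExp d
      _ ≤ _ := hb
      _ ≤ C * L⁻¹ := by
          gcongr
          exact pow_le_of_le_one (by positivity) (inv_le_one_of_one_le₀ hL1) (by omega)
  have h2 : ‖semiKernel Q g s x‖ ≤ C * (L / (L + v) ^ 2) := by
    have h3 : 1 + v / L = (L + v) / L := by field_simp
    rw [h3, div_pow, ← mul_div_assoc, div_le_iff₀ (by positivity)] at h1
    rw [← mul_div_assoc, le_div_iff₀ (by positivity)]
    refine h1.trans_eq ?_
    field_simp
  have h3 : L / (L + v) ^ 2 ≤ ((1 + ‖emb x‖) / a) ^ 2 * (L / (1 + s) ^ 2) := by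
    rw [div_pow, div_mul_div_comm, div_le_div_iff₀ (by positivity) (by positivity)]
    have h4 := pow_le_pow_left₀ (by positivity) hkey 2
    rw [mul_pow, mul_pow] at h4
    nlinarith
  have h4 : L / (1 + s) ^ 2 = (1 + s) ^ (-(3 / 2) : ℝ) := by
    rw [hL, Real.sqrt_eq_rpow, ← Real.rpow_natCast, ← Real.rpow_sub (by linarith)]
    norm_num
  rw [← h4, mul_assoc]
  exact h2.trans (mul_le_mul_of_nonneg_left h3 hC)

theorem integrableOn_one_add_rpow : IntegrableOn (fun s : ℝ => (1 + s) ^ (-(3 / 2) : ℝ)) (Ioi 0) := by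
  have := integrableOn_add_rpow_Ioi_of_lt (a := -(3 / 2)) (m := 1) (c := 0) (by norm_num) (by norm_num)
  simpa [add_comm] using this

variable {S J h : Lat d → ℝ} {μ : Euc d}

theorem tendsto_latFourier_tilt {F : Lat d → ℝ} (h0 : Summable F) (h1 : Summable (tilt F μ))
    (k : Euc d) : Filter.Tendsto (fun t : ℝ => latFourier (tilt F (t • μ)) k)
      (nhdsWithin 1 (Iio 1)) (nhds (latFourier (tilt F μ) k)) := by
  have := tendsto_tsum_tilt (F := F) (c := fun y => char k y) (μ := μ) (by simpa using h0.abs)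
    (by simpa using h1.abs)
  simpa only [latFourier_eq, Complex.real_smul] using this

variable [NeZero d]

theorem tendsto_semiKernel (hM : 0 < M) (hK : 0 < K) (hA : AveragedDecay S)
    (hB : OZBounds M K ζ S J h) (hμ : μ ∈ closure (Omega S)) {s : ℝ} (hs : 0 < s) (x : Lat d) :
    Filter.Tendsto (fun t : ℝ => semiKernel (tilt J (t • μ)) (tilt h (t • μ)) s x)
      (nhdsWithin 1 (Iio 1)) (nhds (semiKernel (tilt J μ) (tilt h μ) s x)) := by
  unfold semiKernel
  refine Filter.Tendsto.const_mul _ ?_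
  have hsJ : ∀ ν ∈ closure (Omega S), Summable (tilt J ν) := fun ν hν =>
    summable_abs_iff.1 ((hB.mem_Q ν hν).sum_Q hM).1
  have hsh : ∀ ν ∈ closure (Omega S), Summable (tilt h ν) := fun ν hν =>
    summable_abs_iff.1 ((hB.mem_Q ν hν).sum_g hM).1
  refine tendsto_integral_filter_of_dominated_convergence (fun _ => M) ?_ ?_ ?_ ?_
  · filter_upwards [eventually_smul_mem hA hμ] with t ht
    have h1 := continuous_latFourier (hsJ _ (subset_closure ht))
    have h2 := continuous_latFourier (hsh _ (subset_closure ht))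
    refine Continuous.aestronglyMeasurable ?_
    fun_prop
  · filter_upwards [eventually_smul_mem hA hμ] with t ht
    refine (ae_restrict_iff' measurableSet_box).2 (Filter.Eventually.of_forall fun k hk => ?_)
    have q := hB.mem_Q _ (subset_closure ht)
    have h1 : (latFourier (tilt J (t • μ)) k).re ≤ 1 - 0 := by
      rw [sub_zero]
      exact (q.latFourier_re_le_tsum hK hk).trans
        (tsum_J_le_one hM hA hB (subset_closure ht))
    have h2 := norm_exp_symbol_le hs.le h1
    rw [neg_zero, zero_mul, Real.exp_zero] at h2
    rw [norm_mul, norm_mul, norm_char, one_mul]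
    have h3 := (norm_latFourier_le (hsh _ (subset_closure ht)) k).trans (q.sum_g hM).2
    nlinarith [norm_nonneg (latFourier (tilt h (t • μ)) k)]
  · exact integrableOn_const (hs := volume_box_lt_top.ne)
  · refine Filter.Eventually.of_forall fun k => ?_
    have h1 := tendsto_latFourier_tilt hB.J_summable (hsJ μ hμ) k
    have h2 := tendsto_latFourier_tilt hB.h_summable (hsh μ hμ) k
    exact (h2.mul ((tendsto_const_nhds.mul (tendsto_const_nhds.sub h1)).cexp)).const_mul _

theorem eventually_norm_drift_ge (hM : 0 < M) (hK : 0 < K) (hζ : 0 < ζ) (hA : AveragedDecay S)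
    (hB : OZBounds M K ζ S J h) (hμ : μ ∈ frontier (Omega S)) :
    ∀ᶠ t in nhdsWithin (1 : ℝ) (Iio 1),
      ‖drift (tilt J μ)‖ / 2 ≤ ‖drift (tilt J (t • μ))‖ := by
  have hμc := frontier_subset_closure hμ
  set η := drift (tilt J μ) with hη
  have hηp : 0 < ‖η‖ := norm_pos_iff.2 (drift_ne_zero hM hK hζ hA hB hμ)
  have q0 := hB.mem_Q 0 (subset_closure hA.zero_mem)
  rw [tilt_zero, tilt_zero] at q0
  have bd : ∀ ν ∈ closure (Omega S),
      Summable fun y => ‖inner ℝ η (emb y)‖ * |tilt J ν y| := fun ν hν => by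
    refine Summable.of_nonneg_of_le (fun y => by positivity) (fun y => ?_)
      (((hB.mem_Q ν hν).sum_norm_Q hM hζ).1.mul_left ‖η‖)
    rw [← mul_assoc]
    gcongr
    exact norm_inner_le_norm _ _
  have h1 := tendsto_tsum_tilt (F := J) (c := fun y => inner ℝ η (emb y)) (μ := μ)
    (by simpa [tilt_zero] using bd 0 (subset_closure hA.zero_mem)) (bd μ hμc)
  have e : ∀ ν ∈ closure (Omega S), ∑' y, tilt J ν y • inner ℝ η (emb y) =
      inner ℝ η (drift (tilt J ν)) := fun ν hν => by
    rw [inner_drift ((hB.mem_Q ν hν).sum_norm_Q hM hζ).1]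
    exact tsum_congr fun y => by rw [smul_eq_mul, mul_comm]
  rw [e μ hμc, ← hη, real_inner_self_eq_norm_sq] at h1
  filter_upwards [h1.eventually (lt_mem_nhds (by nlinarith : ‖η‖ ^ 2 / 2 < ‖η‖ ^ 2)),
    eventually_smul_mem hA hμc] with t ht hm
  rw [e _ (subset_closure hm)] at ht
  have h2 := real_inner_le_norm η (drift (tilt J (t • μ)))
  refine le_of_mul_le_mul_left ?_ hηp
  nlinarith

/-- The representation persists at the boundary of `Ω`, where `∑ J^{(μ)} = 1`: the drift does not
vanish there, which makes the kernels uniformly time-integrable along the ray to `μ`. -/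
theorem integral_semiKernel_of_mem_frontier (hM : 0 < M) (hK : 0 < K) (hζ : 0 < ζ)
    (hA : AveragedDecay S) (hB : OZBounds M K ζ S J h) (hμ : μ ∈ frontier (Omega S)) (x : Lat d) :
    IntegrableOn (fun s => semiKernel (tilt J μ) (tilt h μ) s x) (Ioi 0) ∧
      ∫ s in Ioi (0 : ℝ), semiKernel (tilt J μ) (tilt h μ) s x = (tilt S μ x : ℂ) := by
  have hd : 1 ≤ d := NeZero.one_le
  have hμc := frontier_subset_closure hμ
  obtain ⟨C, hC, hker⟩ := norm_semiKernel_le hd hM hK hζ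
  have hηp : 0 < ‖drift (tilt J μ)‖ := norm_pos_iff.2 (drift_ne_zero hM hK hζ hA hB hμ)
  set e := ‖drift (tilt J μ)‖ / 2 with he
  have he0 : 0 < e := by positivity
  set B : ℝ → ℝ := fun s => C * ((1 + ‖emb x‖) / min e 1) ^ 2 * (1 + s) ^ (-(3 / 2) : ℝ)
  have hBint : Integrable B (volume.restrict (Ioi 0)) := integrableOn_one_add_rpow.const_mul _
  have hbound : ∀ ν ∈ closure (Omega S), e ≤ ‖drift (tilt J ν)‖ →
      ∀ s : ℝ, 0 < s → ‖semiKernel (tilt J ν) (tilt h ν) s x‖ ≤ B s := fun ν hν hη s hs =>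
    norm_semiKernel_le_rpow hC.le hd he0 hs hη
      (hker _ _ (hB.mem_Q ν hν) (tsum_J_le_one hM hA hB hν) s hs x)
  have hmeas : ∀ ν ∈ closure (Omega S), AEStronglyMeasurable
      (fun s => semiKernel (tilt J ν) (tilt h ν) s x) (volume.restrict (Ioi 0)) := fun ν hν =>
    (continuous_semiKernel (summable_abs_iff.1 ((hB.mem_Q ν hν).sum_Q hM).1)
      (summable_abs_iff.1 ((hB.mem_Q ν hν).sum_g hM).1) x).aestronglyMeasurable
  refine ⟨hBint.mono' (hmeas μ hμc) ((ae_restrict_iff' measurableSet_Ioi).2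
    (Filter.Eventually.of_forall fun s hs => hbound μ hμc (by linarith) s hs)), ?_⟩
  have hlim := tendsto_integral_filter_of_dominated_convergence
    (μ := volume.restrict (Ioi (0 : ℝ))) (l := nhdsWithin (1 : ℝ) (Iio 1))
    (F := fun t s => semiKernel (tilt J (t • μ)) (tilt h (t • μ)) s x)
    (f := fun s => semiKernel (tilt J μ) (tilt h μ) s x) B
    (by filter_upwards [eventually_smul_mem hA hμc] with t ht using hmeas _ (subset_closure ht))
    (by
      filter_upwards [eventually_smul_mem hA hμc, eventually_norm_drift_ge hM hK hζ hA hB hμ]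
        with t ht hη
      exact (ae_restrict_iff' measurableSet_Ioi).2
        (Filter.Eventually.of_forall fun s hs => hbound _ (subset_closure ht) hη s hs))
    hBint
    ((ae_restrict_iff' measurableSet_Ioi).2 (Filter.Eventually.of_forall fun s hs =>
      tendsto_semiKernel hM hK hA hB hμc hs x))
  have hval : ∀ᶠ t in nhdsWithin (1 : ℝ) (Iio 1),
      ∫ s in Ioi (0 : ℝ), semiKernel (tilt J (t • μ)) (tilt h (t • μ)) s x =
        (tilt S (t • μ) x : ℂ) := by
    filter_upwards [eventually_smul_mem hA hμc] with t ht
    exact integral_semiKernel hM hK (hB.mem_Q _ (subset_closure ht))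
      (tsum_J_lt_one hM hA hB ht) ht (latFourier_oz hM hB ht) x
  have hS : Filter.Tendsto (fun t : ℝ => (tilt S (t • μ) x : ℂ)) (nhdsWithin 1 (Iio 1))
      (nhds (tilt S μ x : ℂ)) := by
    refine Filter.Tendsto.mono_left ?_ nhdsWithin_le_nhds
    have hcont : Continuous fun t : ℝ => (tilt S (t • μ) x : ℂ) := by
      unfold tilt
      simp only [real_inner_smul_left]
      fun_prop
    simpa using hcont.tendsto 1
  exact tendsto_nhds_unique hlim (hS.congr' (hval.mono fun t ht => ht.symm))

end Representation

/-! ### Time integrals of diffusive kernels -/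

section TimeIntegrals

/-- `f` is integrable on `s` with integral at most `A`. -/
def IntLE (f : ℝ → ℝ) (s : Set ℝ) (A : ℝ) : Prop := IntegrableOn f s ∧ ∫ t in s, f t ≤ A

theorem IntLE.mono {f : ℝ → ℝ} {s : Set ℝ} {A B : ℝ} (h : IntLE f s A) (hAB : A ≤ B) :
    IntLE f s B := ⟨h.1, h.2.trans hAB⟩

theorem IntLE.const_mul {f : ℝ → ℝ} {s : Set ℝ} {A c : ℝ} (h : IntLE f s A) (hc : 0 ≤ c) :
    IntLE (fun t => c * f t) s (c * A) :=
  ⟨h.1.const_mul c, by rw [integral_const_mul]; exact mul_le_mul_of_nonneg_left h.2 hc⟩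

theorem IntLE.of_le {f g : ℝ → ℝ} {s : Set ℝ} {A : ℝ} (h : IntLE g s A) (hs : MeasurableSet s)
    (hf : Measurable f) (h0 : ∀ t ∈ s, 0 ≤ f t) (hle : ∀ t ∈ s, f t ≤ g t) : IntLE f s A := by
  have hi : IntegrableOn f s := by
    refine Integrable.mono' h.1 hf.aestronglyMeasurable
      ((ae_restrict_iff' hs).2 (Filter.Eventually.of_forall fun t ht => ?_))
    rw [Real.norm_of_nonneg (h0 t ht)]
    exact hle t ht
  exact ⟨hi, (setIntegral_mono_on hi h.1 hs hle).trans h.2⟩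

theorem IntLE.union {f : ℝ → ℝ} {s t : Set ℝ} {A B : ℝ} (hs : IntLE f s A) (ht : IntLE f t B)
    (hd : Disjoint s t) (hm : MeasurableSet t) : IntLE f (s ∪ t) (A + B) :=
  ⟨hs.1.union ht.1, by rw [setIntegral_union hd hm hs.1 ht.1]; exact add_le_add hs.2 ht.2⟩

theorem IntLE.union_Ioi {f : ℝ → ℝ} {a b A B : ℝ} (hab : a ≤ b) (hs : IntLE f (Ioc a b) A)
    (ht : IntLE f (Ioi b) B) : IntLE f (Ioi a) (A + B) := by
  rw [← Ioc_union_Ioi_eq_Ioi hab]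
  exact hs.union ht (Set.Ioc_disjoint_Ioi le_rfl) measurableSet_Ioi

theorem IntLE.scale {f : ℝ → ℝ} {c A : ℝ} (hc : 0 < c) (h : IntLE (fun t => f (c * t)) (Ioi 0) A) :
    IntLE f (Ioi 0) (c * A) := by
  have h1 := integral_comp_mul_left_Ioi f 0 hc
  have h2 := (integrableOn_Ioi_comp_mul_left_iff f 0 hc).1 h.1
  rw [mul_zero] at h1 h2
  refine ⟨h2, ?_⟩
  have h3 := h.2
  rw [h1, smul_eq_mul, inv_mul_le_iff₀ hc] at h3
  exact h3

theorem intLE_rpow_Ioc {r b : ℝ} (hr : -1 < r) (hb : 0 ≤ b) :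
    IntLE (fun t => t ^ r) (Ioc 0 b) (b ^ (r + 1) / (r + 1)) := by
  have h1 := intervalIntegral.intervalIntegrable_rpow' (a := 0) (b := b) hr
  refine ⟨(intervalIntegrable_iff_integrableOn_Ioc_of_le hb).1 h1, ?_⟩
  rw [← intervalIntegral.integral_of_le hb, integral_rpow (Or.inl hr),
    Real.zero_rpow (by linarith), sub_zero]

theorem intLE_rpow_Ioi {r b : ℝ} (hr : r < -1) (hb : 0 < b) :
    IntLE (fun t => t ^ r) (Ioi b) (b ^ (r + 1) / (-(r + 1))) := by
  refine ⟨integrableOn_Ioi_rpow_of_lt hr hb, ?_⟩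
  rw [integral_Ioi_rpow_of_lt hr hb, div_neg, neg_div]

/-- The polynomially decaying diffusive kernel with dimension parameter `p = d/2`, seen along the
drift direction: the particle moves at speed `e` towards a point at distance `X`. -/
noncomputable def polyKernel (p m X e s : ℝ) : ℝ :=
  s ^ (-p) * (1 + |X - s * e| / Real.sqrt s) ^ (-m)

/-- The Gaussian diffusive kernel with dimension parameter `p = d/2`. -/
noncomputable def gaussKernel (p κ X e s : ℝ) : ℝ :=
  s ^ (-p) * Real.exp (-(κ * (|X - s * e| ^ 2 / s)))

theorem measurable_polyKernel (p m X e : ℝ) : Measurable (polyKernel p m X e) := by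
  unfold polyKernel; fun_prop

theorem measurable_gaussKernel (p κ X e : ℝ) : Measurable (gaussKernel p κ X e) := by
  unfold gaussKernel; fun_prop

theorem polyKernel_nonneg (p m X e : ℝ) {s : ℝ} (hs : 0 ≤ s) : 0 ≤ polyKernel p m X e s := by
  unfold polyKernel; positivity

theorem gaussKernel_nonneg (p κ X e : ℝ) {s : ℝ} (hs : 0 ≤ s) : 0 ≤ gaussKernel p κ X e s := by
  unfold gaussKernel; positivity

theorem sqrt_sq_mul {X σ : ℝ} (hX : 0 < X) : Real.sqrt (X ^ 2 * σ) = X * Real.sqrt σ := by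
  rw [Real.sqrt_mul (sq_nonneg X), Real.sqrt_sq hX.le]

theorem abs_sub_sq_mul {X e σ : ℝ} (hX : 0 < X) :
    |X - X ^ 2 * σ * e| = X * |1 - σ * (X * e)| := by
  rw [← abs_of_pos hX, ← abs_mul, abs_of_pos hX]
  congr 1; ring

/-- Diffusive scaling reduces everything to distance one. -/
theorem polyKernel_scale {p m X e σ : ℝ} (hX : 0 < X) (hσ : 0 < σ) :
    polyKernel p m X e (X ^ 2 * σ) = (X ^ 2) ^ (-p) * polyKernel p m 1 (X * e) σ := by
  unfold polyKernel
  rw [sqrt_sq_mul hX, abs_sub_sq_mul hX, mul_div_mul_left _ _ hX.ne',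
    Real.mul_rpow (by positivity) hσ.le, mul_assoc]

theorem gaussKernel_scale {p κ X e σ : ℝ} (hX : 0 < X) (hσ : 0 < σ) :
    gaussKernel p κ X e (X ^ 2 * σ) = (X ^ 2) ^ (-p) * gaussKernel p κ 1 (X * e) σ := by
  unfold gaussKernel
  rw [abs_sub_sq_mul hX, mul_pow, mul_div_mul_left _ _ (by positivity),
    Real.mul_rpow (by positivity) hσ.le, mul_assoc]

theorem one_add_div_sqrt_rpow_neg_le {σ m w v : ℝ} (hσ : 0 < σ) (hm : 0 ≤ m) (hw : 0 < w)
    (hwv : w ≤ v) : (1 + v / Real.sqrt σ) ^ (-m) ≤ w ^ (-m) * σ ^ (m / 2) := by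
  have hs : 0 < Real.sqrt σ := Real.sqrt_pos.2 hσ
  have h1 : w / Real.sqrt σ ≤ 1 + v / Real.sqrt σ := by
    have : w / Real.sqrt σ ≤ v / Real.sqrt σ := by gcongr
    linarith
  refine (Real.rpow_le_rpow_of_nonpos (by positivity) h1 (by linarith)).trans_eq ?_
  rw [Real.div_rpow hw.le hs.le, Real.rpow_neg hs.le, Real.sqrt_eq_rpow, ← Real.rpow_mul hσ.le]
  rw [div_inv_eq_mul]
  congr 2; ring

/-- The factor of `polyKernel` that matters at times around `σ = 1/β`, when the particle passes the
target. -/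
theorem exists_intLE_one_add_abs {m : ℝ} (hm : 1 < m) :
    ∃ I : ℝ, 0 < I ∧ ∀ c β : ℝ, 0 < c → 0 < β → ∀ s : Set ℝ,
      IntLE (fun σ => (1 + c * |1 - σ * β|) ^ (-m)) s (I / (c * β)) := by
  have hI : Integrable fun y : ℝ => (1 + ‖y‖) ^ (-m) := integrable_one_add_norm (by simpa using hm)
  refine ⟨(∫ y : ℝ, (1 + ‖y‖) ^ (-m)) + 1, ?_, fun c β hc hβ s => ?_⟩
  · have : 0 ≤ ∫ y : ℝ, (1 + ‖y‖) ^ (-m) := integral_nonneg fun y => by positivity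
    linarith
  have hcβ : 0 < c * β := by positivity
  have e : (fun σ : ℝ => (1 + c * |1 - σ * β|) ^ (-m)) =
      fun σ => (fun y : ℝ => (1 + ‖y - c‖) ^ (-m)) (c * β * σ) := by
    funext σ
    have : c * |1 - σ * β| = |c * β * σ - c| := by
      rw [← abs_of_pos hc, ← abs_mul, abs_of_pos hc, abs_sub_comm]; congr 1; ring
    simp only [Real.norm_eq_abs, this]
  have h1 : Integrable (fun y : ℝ => (1 + ‖y - c‖) ^ (-m)) :=
    Integrable.comp_sub_right (f := fun y : ℝ => (1 + ‖y‖) ^ (-m)) hI c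
  have h2 : Integrable (fun σ : ℝ => (1 + c * |1 - σ * β|) ^ (-m)) := by
    rw [e]; exact h1.comp_mul_left' hcβ.ne'
  refine ⟨h2.integrableOn, (setIntegral_le_integral h2
    (Filter.Eventually.of_forall fun σ => by positivity)).trans ?_⟩
  have h3 : ∫ σ : ℝ, (1 + c * |1 - σ * β|) ^ (-m) = (c * β)⁻¹ * ∫ y : ℝ, (1 + ‖y‖) ^ (-m) := by
    rw [e, Measure.integral_comp_mul_left (fun y : ℝ => (1 + ‖y - c‖) ^ (-m)),
      integral_sub_right_eq_self (fun y : ℝ => (1 + ‖y‖) ^ (-m)), smul_eq_mul,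
      abs_of_pos (by positivity)]
  rw [h3, div_eq_inv_mul]
  gcongr
  linarith

/-- For `β ≥ β₀` the time integral is dominated by the passage through the target. -/
theorem exists_intLE_polyKernel {p m β₀ : ℝ} (hp : 0 ≤ p) (hm : 1 < m) (hpm : -1 < m / 2 - p)
    (hpm' : 1 < p + m / 2) (hβ₀ : 0 < β₀) :
    ∃ A : ℝ, 0 < A ∧ ∀ β : ℝ, β₀ ≤ β →
      IntLE (polyKernel p m 1 β) (Ioi 0) (A * β ^ (p - 3 / 2)) := by
  obtain ⟨I, hI, hmid⟩ := exists_intLE_one_add_abs hm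
  set r := m / 2 - p with hr
  set q := p + m / 2 with hq
  set D := β₀ ^ ((1 - m) / 2) with hD
  set A1 := (1 / 2 : ℝ) ^ (-m) * ((1 / 2 : ℝ) ^ (r + 1) / (r + 1)) * D with hA1
  set A2 := (1 / 2 : ℝ) ^ (-p) * (I / Real.sqrt (1 / 2)) with hA2
  set A3 := (1 / 2 : ℝ) ^ (-m) * ((2 : ℝ) ^ (-q + 1) / (-(-q + 1))) * D with hA3
  have hr1 : 0 < r + 1 := by linarith
  have hq1 : 0 < -(-q + 1) := by linarith
  refine ⟨A1 + (A2 + A3), by positivity, fun β hβ => ?_⟩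
  have hβp : 0 < β := hβ₀.trans_le hβ
  have hDβ : β ^ (p - 1 - m / 2) ≤ D * β ^ (p - 3 / 2) := by
    have h1 : β ^ (p - 1 - m / 2) = β ^ ((1 - m) / 2) * β ^ (p - 3 / 2) := by
      rw [← Real.rpow_add hβp]; congr 1; ring
    rw [h1]
    gcongr
    exact Real.rpow_le_rpow_of_nonpos hβ₀ hβ (by linarith)
  have hW := measurable_polyKernel p m 1 β
  have hearly : IntLE (polyKernel p m 1 β) (Ioc 0 (1 / 2 * β⁻¹)) (A1 * β ^ (p - 3 / 2)) := by
    have h1 := (intLE_rpow_Ioc (r := r) (b := 1 / 2 * β⁻¹) (by linarith) (by positivity)).const_mul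
      (c := (1 / 2 : ℝ) ^ (-m)) (by positivity)
    refine (h1.of_le measurableSet_Ioc hW (fun σ hσ => polyKernel_nonneg _ _ _ _ hσ.1.le)
      fun σ hσ => ?_).mono ?_
    · have h2 : (1 / 2 : ℝ) ≤ |1 - σ * β| := by
        have h3 : σ * β ≤ 1 / 2 := by
          have := mul_le_mul_of_nonneg_right hσ.2 hβp.le
          rwa [mul_assoc, inv_mul_cancel₀ hβp.ne', mul_one] at this
        exact le_trans (by linarith) (le_abs_self _)
      have h3 := one_add_div_sqrt_rpow_neg_le hσ.1 (by linarith : 0 ≤ m) (by norm_num) h2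
      calc polyKernel p m 1 β σ ≤ σ ^ (-p) * ((1 / 2 : ℝ) ^ (-m) * σ ^ (m / 2)) :=
            mul_le_mul_of_nonneg_left h3 (Real.rpow_nonneg hσ.1.le _)
        _ = (1 / 2 : ℝ) ^ (-m) * (σ ^ (m / 2) * σ ^ (-p)) := by ring
        _ = _ := by rw [← Real.rpow_add hσ.1, hr, sub_eq_add_neg]
    · have h2 : (1 / 2 * β⁻¹) ^ (r + 1) = (1 / 2 : ℝ) ^ (r + 1) * β ^ (p - 1 - m / 2) := by
        rw [Real.mul_rpow (by norm_num) (by positivity), Real.inv_rpow hβp.le,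
          ← Real.rpow_neg hβp.le]
        congr 2; rw [hr]; ring
      rw [h2, hA1]
      calc _ = (1 / 2 : ℝ) ^ (-m) * ((1 / 2 : ℝ) ^ (r + 1) / (r + 1)) * β ^ (p - 1 - m / 2) := by
            ring
        _ ≤ (1 / 2 : ℝ) ^ (-m) * ((1 / 2 : ℝ) ^ (r + 1) / (r + 1)) * (D * β ^ (p - 3 / 2)) := by
            gcongr
        _ = _ := by ring
  have hpass : IntLE (polyKernel p m 1 β) (Ioc (1 / 2 * β⁻¹) (2 * β⁻¹)) (A2 * β ^ (p - 3 / 2)) := by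
    set c := Real.sqrt (1 / 2) * Real.sqrt β with hc
    have hcp : 0 < c := by positivity
    have h1 := (hmid c β hcp hβp (Ioc (1 / 2 * β⁻¹) (2 * β⁻¹))).const_mul
      (c := (1 / 2 * β⁻¹) ^ (-p)) (by positivity)
    have hpos : ∀ σ ∈ Ioc (1 / 2 * β⁻¹) (2 * β⁻¹), 0 < σ := fun σ hσ =>
      lt_trans (by positivity) hσ.1
    refine (h1.of_le measurableSet_Ioc hW (fun σ hσ => polyKernel_nonneg _ _ _ _ (hpos σ hσ).le)
      fun σ hσ => ?_).mono ?_
    · have hσ0 := hpos σ hσ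
      have hsσ : 0 < Real.sqrt σ := Real.sqrt_pos.2 hσ0
      have h2 : c * Real.sqrt σ ≤ 1 := by
        rw [hc, ← Real.sqrt_mul (by norm_num), ← Real.sqrt_mul (by positivity), Real.sqrt_le_one]
        have := mul_le_mul_of_nonneg_right hσ.2 hβp.le
        rw [mul_assoc, inv_mul_cancel₀ hβp.ne'] at this
        nlinarith
      unfold polyKernel
      gcongr ?_ * ?_
      · exact Real.rpow_le_rpow_of_nonpos (by positivity) hσ.1.le (by linarith)
      · refine Real.rpow_le_rpow_of_nonpos (by positivity) ?_ (by linarith)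
        gcongr
        rw [le_div_iff₀ hsσ]
        nlinarith [abs_nonneg (1 - σ * β)]
    · have h2 : (1 / 2 * β⁻¹) ^ (-p) = (1 / 2 : ℝ) ^ (-p) * β ^ p := by
        rw [Real.mul_rpow (by norm_num) (by positivity), Real.inv_rpow hβp.le,
          ← Real.rpow_neg hβp.le, neg_neg]
      have h3 : β ^ (p - 3 / 2) = β ^ p / (Real.sqrt β * β) := by
        rw [Real.rpow_sub hβp]
        congr 1
        rw [show (3 / 2 : ℝ) = 1 / 2 + 1 by norm_num, Real.rpow_add hβp, Real.rpow_one,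
          ← Real.sqrt_eq_rpow]
      rw [h2, h3, hA2, hc]
      apply le_of_eq
      have : 0 < Real.sqrt (1 / 2) := by positivity
      have : 0 < Real.sqrt β := by positivity
      field_simp
  have hlate : IntLE (polyKernel p m 1 β) (Ioi (2 * β⁻¹)) (A3 * β ^ (p - 3 / 2)) := by
    have h1 := (intLE_rpow_Ioi (r := -q) (b := 2 * β⁻¹) (by linarith) (by positivity)).const_mul
      (c := (1 / 2 * β) ^ (-m)) (by positivity)
    have hpos : ∀ σ ∈ Ioi (2 * β⁻¹), 0 < σ := fun σ hσ => lt_trans (by positivity) hσ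
    refine (h1.of_le measurableSet_Ioi hW (fun σ hσ => polyKernel_nonneg _ _ _ _ (hpos σ hσ).le)
      fun σ hσ => ?_).mono ?_
    · have hσ0 := hpos σ hσ
      have h2 : 1 / 2 * β * σ ≤ |1 - σ * β| := by
        have h3 : 2 ≤ σ * β := by
          have := mul_le_mul_of_nonneg_right (le_of_lt hσ) hβp.le
          rwa [mul_assoc, inv_mul_cancel₀ hβp.ne', mul_one] at this
        rw [abs_sub_comm]
        exact le_trans (by linarith) (le_abs_self _)
      have h3 := one_add_div_sqrt_rpow_neg_le hσ0 (by linarith : 0 ≤ m) (by positivity) h2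
      rw [Real.mul_rpow (by positivity) hσ0.le] at h3
      calc polyKernel p m 1 β σ ≤ σ ^ (-p) * ((1 / 2 * β) ^ (-m) * σ ^ (-m) * σ ^ (m / 2)) :=
            mul_le_mul_of_nonneg_left h3 (Real.rpow_nonneg hσ0.le _)
        _ = (1 / 2 * β) ^ (-m) * (σ ^ (-p) * σ ^ (-m) * σ ^ (m / 2)) := by ring
        _ = _ := by
            rw [← Real.rpow_add hσ0, ← Real.rpow_add hσ0]
            congr 2; rw [hq]; ring
    · have h2 : (1 / 2 * β) ^ (-m) * (2 * β⁻¹) ^ (-q + 1) =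
          (1 / 2 : ℝ) ^ (-m) * 2 ^ (-q + 1) * β ^ (p - 1 - m / 2) := by
        rw [Real.mul_rpow (by norm_num) hβp.le, Real.mul_rpow (by norm_num) (by positivity),
          Real.inv_rpow hβp.le, ← Real.rpow_neg hβp.le]
        have : β ^ (p - 1 - m / 2) = β ^ (-m) * β ^ (-(-q + 1)) := by
          rw [← Real.rpow_add hβp]; congr 1; rw [hq]; ring
        rw [this]; ring
      rw [← mul_div_assoc, h2, hA3]
      calc _ = (1 / 2 : ℝ) ^ (-m) * ((2 : ℝ) ^ (-q + 1) / (-(-q + 1))) * β ^ (p - 1 - m / 2) := by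
            ring
        _ ≤ (1 / 2 : ℝ) ^ (-m) * ((2 : ℝ) ^ (-q + 1) / (-(-q + 1))) * (D * β ^ (p - 3 / 2)) := by
            gcongr
        _ = _ := by ring
  rw [add_mul, add_mul]
  refine hearly.union_Ioi (by positivity) (hpass.union_Ioi ?_ hlate)
  gcongr
  norm_num

/-- For small drift and `d > 2` the integral is that of driftless diffusion. -/
theorem exists_intLE_polyKernel_of_le_one {p m : ℝ} (hp : 1 < p) (hm : 0 ≤ m)
    (hpm : -1 < m / 2 - p) :
    ∃ A : ℝ, 0 < A ∧ ∀ β : ℝ, 0 < β → β ≤ 1 → IntLE (polyKernel p m 1 β) (Ioi 0) A := by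
  have hr1 : 0 < m / 2 - p + 1 := by linarith
  have hp1 : 0 < -(-p + 1) := by linarith
  refine ⟨(1 / 2 : ℝ) ^ (-m) * ((1 / 2 : ℝ) ^ (m / 2 - p + 1) / (m / 2 - p + 1)) +
    (1 / 2 : ℝ) ^ (-p + 1) / (-(-p + 1)), by positivity, fun β hβ hβ1 => ?_⟩
  have hW := measurable_polyKernel p m 1 β
  refine IntLE.union_Ioi (b := 1 / 2) (by norm_num) ?_ ?_
  · have h1 := (intLE_rpow_Ioc (r := m / 2 - p) (b := 1 / 2) hpm (by norm_num)).const_mul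
      (c := (1 / 2 : ℝ) ^ (-m)) (by positivity)
    refine h1.of_le measurableSet_Ioc hW (fun σ hσ => polyKernel_nonneg _ _ _ _ hσ.1.le)
      fun σ hσ => ?_
    have h2 : (1 / 2 : ℝ) ≤ |1 - σ * β| := by
      have h3 : σ * β ≤ 1 / 2 := by nlinarith [hσ.1, hσ.2]
      exact le_trans (by linarith) (le_abs_self _)
    have h3 := one_add_div_sqrt_rpow_neg_le hσ.1 hm (by norm_num) h2
    calc polyKernel p m 1 β σ ≤ σ ^ (-p) * ((1 / 2 : ℝ) ^ (-m) * σ ^ (m / 2)) :=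
          mul_le_mul_of_nonneg_left h3 (Real.rpow_nonneg hσ.1.le _)
      _ = (1 / 2 : ℝ) ^ (-m) * (σ ^ (m / 2) * σ ^ (-p)) := by ring
      _ = _ := by rw [← Real.rpow_add hσ.1, sub_eq_add_neg]
  · have hpos : ∀ σ ∈ Ioi (1 / 2 : ℝ), 0 < σ := fun σ hσ => lt_trans (by norm_num) hσ
    refine (intLE_rpow_Ioi (r := -p) (by linarith) (by norm_num)).of_le measurableSet_Ioi hW
      (fun σ hσ => polyKernel_nonneg _ _ _ _ (hpos σ hσ).le) fun σ hσ => ?_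
    have hσ0 := hpos σ hσ
    refine mul_le_of_le_one_right (Real.rpow_nonneg hσ0.le _)
      (Real.rpow_le_one_of_one_le_of_nonpos ?_ (by linarith))
    have : 0 ≤ |1 - σ * β| / Real.sqrt σ := by positivity
    linarith

/-- Gaussian decay beats polynomial decay of any order `n`. -/
theorem gaussKernel_le {κ : ℝ} (hκ : 0 < κ) (n : ℕ) : ∃ C : ℝ, 0 < C ∧ ∀ p X e s : ℝ, 0 < s →
    gaussKernel p κ X e s ≤ C * polyKernel p n X e s := by
  refine ⟨n.factorial * Real.exp 1 * Real.exp (1 / (4 * κ)), by positivity, fun p X e s hs => ?_⟩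
  unfold gaussKernel polyKernel
  set u := |X - s * e| / Real.sqrt s with hu
  have hu0 : 0 ≤ u := by positivity
  have h1 : |X - s * e| ^ 2 / s = u ^ 2 := by rw [hu, div_pow, Real.sq_sqrt hs.le]
  rw [h1]
  have h2 : Real.exp (-(κ * u ^ 2)) ≤ Real.exp (1 / (4 * κ)) * Real.exp (-u) := by
    rw [← Real.exp_add, Real.exp_le_exp, ← sub_nonneg]
    have : 1 / (4 * κ) + -u - -(κ * u ^ 2) = (2 * κ * u - 1) ^ 2 / (4 * κ) := by
      field_simp; ring
    rw [this]; positivity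
  have h3 := one_add_pow_mul_exp_neg_le n hu0
  have h4 : Real.exp (-u) ≤ n.factorial * Real.exp 1 * (1 + u) ^ (-(n : ℝ)) := by
    rw [Real.rpow_neg (by positivity), Real.rpow_natCast, ← div_eq_mul_inv,
      le_div_iff₀ (by positivity), mul_comm]
    exact h3
  calc _ ≤ s ^ (-p) * (Real.exp (1 / (4 * κ)) *
        (n.factorial * Real.exp 1 * (1 + u) ^ (-(n : ℝ)))) := by
        gcongr
        exact h2.trans (by gcongr)
    _ = _ := by ring

theorem le_integral_of_le_on_Icc {f : ℝ → ℝ} {a l c : ℝ} (hf : IntegrableOn f (Ioi 0))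
    (h0 : ∀ t, 0 < t → 0 ≤ f t) (ha : 0 < a) (hl : 0 ≤ l) (hle : ∀ t ∈ Icc a (a + l), c ≤ f t) :
    c * l ≤ ∫ t in Ioi (0 : ℝ), f t := by
  have hsub : Icc a (a + l) ⊆ Ioi 0 := fun t ht => lt_of_lt_of_le ha ht.1
  calc c * l = ∫ t in Icc a (a + l), c := by
        rw [setIntegral_const, Measure.real, Real.volume_Icc, add_sub_cancel_left,
          ENNReal.toReal_ofReal hl, smul_eq_mul, mul_comm]
    _ ≤ ∫ t in Icc a (a + l), f t :=
        setIntegral_mono_on (integrableOn_const (hs := by simp)) (hf.mono_set hsub)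
          measurableSet_Icc hle
    _ ≤ _ := setIntegral_mono_set hf
        ((ae_restrict_iff' measurableSet_Ioi).2 (Filter.Eventually.of_forall fun t ht => h0 t ht))
        (Filter.Eventually.of_forall hsub)

/-- Lower bound of the order of the passage through the target, obtained from a window of width of
order `β^{-3/2}` after the passage time `1/β`. -/
theorem exists_le_integral_gaussKernel {p κ β₀ : ℝ} (hp : 0 ≤ p) (hκ : 0 < κ) (hβ₀ : 0 < β₀) :
    ∃ c : ℝ, 0 < c ∧ ∀ β : ℝ, β₀ ≤ β → IntegrableOn (gaussKernel p κ 1 β) (Ioi 0) →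
      c * β ^ (p - 3 / 2) ≤ ∫ σ in Ioi (0 : ℝ), gaussKernel p κ 1 β σ := by
  set k := min 1 (Real.sqrt β₀) with hk
  have hk0 : 0 < k := lt_min one_pos (Real.sqrt_pos.2 hβ₀)
  have hk1 : k ≤ 1 := min_le_left _ _
  refine ⟨2 ^ (-p) * Real.exp (-κ) * k, by positivity, fun β hβ hint => ?_⟩
  have hβp : 0 < β := hβ₀.trans_le hβ
  have hsβ : 0 < Real.sqrt β := Real.sqrt_pos.2 hβp
  set δ := k / Real.sqrt β with hδ
  have hδ0 : 0 < δ := by positivity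
  have hδ1 : δ ≤ 1 := by
    rw [hδ, div_le_one hsβ]
    exact (min_le_right _ _).trans (Real.sqrt_le_sqrt hβ)
  have hδβ : δ ^ 2 * β ≤ 1 := by
    rw [hδ, div_pow, Real.sq_sqrt hβp.le, div_mul_cancel₀ _ hβp.ne']
    exact pow_le_one₀ hk0.le hk1
  have h := le_integral_of_le_on_Icc (c := (2 * β⁻¹) ^ (-p) * Real.exp (-κ)) (a := β⁻¹)
    (l := δ * β⁻¹) hint (fun t ht => gaussKernel_nonneg _ _ _ _ ht.le) (by positivity)
    (by positivity) fun σ hσ => ?_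
  · refine le_trans (le_of_eq ?_) h
    have h3 : β ^ (p - 3 / 2) = β ^ p / (Real.sqrt β * β) := by
      rw [Real.rpow_sub hβp]
      congr 1
      rw [show (3 / 2 : ℝ) = 1 / 2 + 1 by norm_num, Real.rpow_add hβp, Real.rpow_one,
        ← Real.sqrt_eq_rpow]
    rw [Real.mul_rpow (by norm_num) (by positivity), Real.inv_rpow hβp.le,
      ← Real.rpow_neg hβp.le, neg_neg, h3, hδ]
    field_simp
  · have hβi : 0 < β⁻¹ := by positivity
    have hσ0 : 0 < σ := hβi.trans_le hσ.1
    have h1 : 1 ≤ σ * β := by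
      have := mul_le_mul_of_nonneg_right hσ.1 hβp.le
      rwa [inv_mul_cancel₀ hβp.ne'] at this
    have h2 : σ * β ≤ 1 + δ := by
      have := mul_le_mul_of_nonneg_right hσ.2 hβp.le
      rwa [add_mul, mul_assoc, inv_mul_cancel₀ hβp.ne', mul_one] at this
    have h3 : σ ≤ 2 * β⁻¹ := by
      have := hσ.2
      nlinarith
    unfold gaussKernel
    gcongr ?_ * ?_
    · exact Real.rpow_le_rpow_of_nonpos hσ0 h3 (by linarith)
    · rw [Real.exp_le_exp, neg_le_neg_iff]
      refine mul_le_of_le_one_right hκ.le ?_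
      rw [div_le_one hσ0, sq_abs]
      have h4 : (1 - σ * β) ^ 2 ≤ δ ^ 2 := by nlinarith
      have h5 : δ ^ 2 ≤ β⁻¹ := by
        rw [← one_div, le_div_iff₀ hβp]; exact hδβ
      linarith [hσ.1]

/-- Lower bound for small drift, obtained from times in `[1, 2]`. -/
theorem exists_le_integral_gaussKernel_of_le_one {p κ : ℝ} (hp : 0 ≤ p) (hκ : 0 < κ) :
    ∃ c : ℝ, 0 < c ∧ ∀ β : ℝ, 0 < β → β ≤ 1 → IntegrableOn (gaussKernel p κ 1 β) (Ioi 0) →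
      c ≤ ∫ σ in Ioi (0 : ℝ), gaussKernel p κ 1 β σ := by
  refine ⟨2 ^ (-p) * Real.exp (-κ) * 1, by positivity, fun β hβ hβ1 hint => ?_⟩
  refine le_integral_of_le_on_Icc (a := 1) (l := 1) hint
    (fun t ht => gaussKernel_nonneg _ _ _ _ ht.le) one_pos zero_le_one fun σ hσ => ?_
  have hσ0 : 0 < σ := one_pos.trans_le hσ.1
  have hσ2 : σ ≤ 2 := by linarith [hσ.2]
  unfold gaussKernel
  gcongr ?_ * ?_
  · exact Real.rpow_le_rpow_of_nonpos hσ0 hσ2 (by linarith)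
  · rw [Real.exp_le_exp, neg_le_neg_iff]
    refine mul_le_of_le_one_right hκ.le ?_
    rw [div_le_one hσ0, sq_abs]
    have h1 : 0 ≤ σ * β := by positivity
    have h2 : σ * β ≤ 2 := by nlinarith
    nlinarith [hσ.1]

end TimeIntegrals

section Comparison

theorem IntLE.polyKernel_scale {p m X e A : ℝ} (hX : 0 < X)
    (h : IntLE (polyKernel p m 1 (X * e)) (Ioi 0) A) :
    IntLE (polyKernel p m X e) (Ioi 0) (X ^ 2 * ((X ^ 2) ^ (-p) * A)) := by
  refine IntLE.scale (by positivity) ?_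
  refine (h.const_mul (c := (X ^ 2) ^ (-p)) (by positivity)).of_le measurableSet_Ioi
    ((measurable_polyKernel p m X e).comp (measurable_const_mul _))
    (fun t ht => polyKernel_nonneg _ _ _ _ ?_) fun t ht => (OrnsteinZernike.polyKernel_scale hX ht).le
  have : 0 < t := ht
  positivity

theorem integral_gaussKernel_scale {p κ X e : ℝ} (hX : 0 < X) :
    ∫ s in Ioi (0 : ℝ), gaussKernel p κ X e s =
      X ^ 2 * ((X ^ 2) ^ (-p) * ∫ σ in Ioi (0 : ℝ), gaussKernel p κ 1 (X * e) σ) := by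
  have h1 := integral_comp_mul_left_Ioi (gaussKernel p κ X e) 0 (b := X ^ 2) (by positivity)
  rw [mul_zero, smul_eq_mul, eq_inv_mul_iff_mul_eq₀ (by positivity)] at h1
  rw [← h1, setIntegral_congr_fun measurableSet_Ioi fun σ (hσ : 0 < σ) =>
    gaussKernel_scale (p := p) (κ := κ) (e := e) hX hσ, integral_const_mul]

theorem two_le_decayExp_cast (d : ℕ) : (2 : ℝ) ≤ decayExp d := by
  exact_mod_cast two_le_decayExp d

theorem sub_one_le_decayExp (d : ℕ) : (d : ℝ) - 1 ≤ decayExp d := by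
  have h : d ≤ decayExp d + 1 := by unfold decayExp; omega
  have : (d : ℝ) ≤ decayExp d + 1 := by exact_mod_cast h
  linarith

theorem decayExp_le (d : ℕ) (hd : 1 ≤ d) : (decayExp d : ℝ) ≤ d + 1 := by
  have h : decayExp d ≤ d + 1 := by unfold decayExp; omega
  exact_mod_cast h

variable {d : ℕ} {κ M β₀ : ℝ}

theorem integrableOn_gaussKernel (hd : 1 ≤ d) (hκ : 0 < κ) {X e : ℝ} (hX : 0 < X) (he : 0 < e) :
    IntegrableOn (gaussKernel (d / 2) κ X e) (Ioi 0) := by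
  obtain ⟨C, hC, hle⟩ := gaussKernel_le hκ (decayExp d)
  have hd' : (1 : ℝ) ≤ d := by exact_mod_cast hd
  have h1 := two_le_decayExp_cast d
  have h2 := sub_one_le_decayExp d
  obtain ⟨A, hA, hint⟩ := exists_intLE_polyKernel (p := d / 2) (m := decayExp d) (β₀ := X * e)
    (by positivity) (by linarith) (by linarith) (by linarith) (by positivity)
  exact (((hint _ le_rfl).polyKernel_scale hX).const_mul hC.le |>.of_le measurableSet_Ioi
    (measurable_gaussKernel _ _ _ _) (fun t ht => gaussKernel_nonneg _ _ _ _ (le_of_lt ht))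
    fun t ht => hle _ _ _ _ ht).1

/-- After giving up half a power of decay, the polynomial kernel still has a time integral
comparable with the Gaussian one. This needs the passage through the target to be visible, that is
`X e ≥ β₀`, unless the dimension is at least three. -/
theorem exists_intLE_integral_gaussKernel (hd : 1 ≤ d) (hκ : 0 < κ) (hM : 0 < M) (hβ₀ : 0 < β₀) :
    ∃ A c : ℝ, 0 < A ∧ 0 < c ∧ ∀ X e : ℝ, 1 ≤ X → 0 < e → e ≤ M → (2 < d ∨ β₀ ≤ X * e) →
      IntLE (polyKernel (d / 2) (decayExp d - 1 / 2) X e) (Ioi 0)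
        (A * ∫ s in Ioi (0 : ℝ), gaussKernel (d / 2) κ X e s) ∧
      c * X ^ (1 - (decayExp d : ℝ)) ≤ ∫ s in Ioi (0 : ℝ), gaussKernel (d / 2) κ X e s := by
  set p : ℝ := d / 2 with hp
  set m : ℝ := decayExp d - 1 / 2 with hm
  have hd' : (1 : ℝ) ≤ d := by exact_mod_cast hd
  have h2 := two_le_decayExp_cast d
  have h3 := sub_one_le_decayExp d
  have hp0 : 0 ≤ p := by positivity
  have hm1 : 1 < m := by linarith
  have hr : -1 < m / 2 - p := by linarith
  have hq : 1 < p + m / 2 := by linarith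
  have hint : ∀ β : ℝ, 0 < β → IntegrableOn (gaussKernel p κ 1 β) (Ioi 0) := fun β hβ =>
    integrableOn_gaussKernel hd hκ one_pos hβ
  set G : ℝ → ℝ := fun β => ∫ σ in Ioi (0 : ℝ), gaussKernel p κ 1 β σ with hG
  -- it suffices to treat distance one
  suffices H : ∃ A c : ℝ, 0 < A ∧ 0 < c ∧ ∀ X e : ℝ, 1 ≤ X → 0 < e → e ≤ M →
      (2 < d ∨ β₀ ≤ X * e) → IntLE (polyKernel p m 1 (X * e)) (Ioi 0) (A * G (X * e)) ∧
        c * X ^ ((d : ℝ) - 1 - decayExp d) ≤ G (X * e) by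
    obtain ⟨A, c, hA, hc, H⟩ := H
    refine ⟨A, c, hA, hc, fun X e hX he heM hcase => ?_⟩
    have hX0 : 0 < X := by linarith
    obtain ⟨H1, H2⟩ := H X e hX he heM hcase
    rw [integral_gaussKernel_scale hX0]
    refine ⟨(H1.polyKernel_scale hX0).mono (le_of_eq (by ring)), ?_⟩
    have h4 : X ^ 2 * (X ^ 2) ^ (-p) = X ^ (2 - (d : ℝ)) := by
      rw [← Real.rpow_natCast, ← Real.rpow_mul hX0.le, ← Real.rpow_add hX0]
      congr 1; rw [hp]; push_cast; ring
    rw [← mul_assoc, h4]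
    calc c * X ^ (1 - (decayExp d : ℝ)) =
          X ^ (2 - (d : ℝ)) * (c * X ^ ((d : ℝ) - 1 - decayExp d)) := by
          rw [mul_left_comm, ← Real.rpow_add hX0]; congr 2; ring
      _ ≤ _ := by gcongr
  by_cases hd2 : 2 < d
  · -- For `d ≥ 3` large and small values of `X e` are treated separately, with threshold `1`.
    have hd3 : (3 : ℝ) ≤ d := by exact_mod_cast hd2
    obtain ⟨A1, hA1, I1⟩ := exists_intLE_polyKernel hp0 hm1 hr hq one_pos
    obtain ⟨c1, hc1, L1⟩ := exists_le_integral_gaussKernel hp0 hκ one_pos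
    obtain ⟨A2, hA2, I2⟩ := exists_intLE_polyKernel_of_le_one (p := p) (by linarith)
      (by linarith) hr
    obtain ⟨c2, hc2, L2⟩ := exists_le_integral_gaussKernel_of_le_one hp0 hκ
    refine ⟨A1 / c1 + A2 / c2, min c1 c2, by positivity, lt_min hc1 hc2,
      fun X e hX he heM _ => ?_⟩
    have hβ : 0 < X * e := by positivity
    have hXd : X ^ ((d : ℝ) - 1 - decayExp d) ≤ 1 :=
      Real.rpow_le_one_of_one_le_of_nonpos hX (by linarith)
    suffices H : IntLE (polyKernel p m 1 (X * e)) (Ioi 0) ((A1 / c1 + A2 / c2) * G (X * e)) ∧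
        min c1 c2 ≤ G (X * e) from
      ⟨H.1, (mul_le_of_le_one_right (lt_min hc1 hc2).le hXd).trans H.2⟩
    rcases le_total (X * e) 1 with hle | hge
    · have l := L2 _ hβ hle (hint _ hβ)
      refine ⟨(I2 _ hβ hle).mono ?_, (min_le_right _ _).trans l⟩
      have hGp : 0 < G (X * e) := hc2.trans_le l
      calc A2 = A2 / c2 * c2 := by field_simp
        _ ≤ A2 / c2 * G (X * e) := by gcongr
        _ ≤ _ := by
            gcongr
            have : 0 < A1 / c1 := by positivity
            linarith
    · have l := L1 _ hge (hint _ hβ)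
      have h1 : 1 ≤ (X * e) ^ (p - 3 / 2) := Real.one_le_rpow hge (by linarith)
      have hGp : 0 < G (X * e) := lt_of_lt_of_le (by positivity) l
      refine ⟨(I1 _ hge).mono ?_, (min_le_left _ _).trans ((le_mul_of_one_le_right hc1.le h1).trans l)⟩
      calc A1 * (X * e) ^ (p - 3 / 2) = A1 / c1 * (c1 * (X * e) ^ (p - 3 / 2)) := by field_simp
        _ ≤ A1 / c1 * G (X * e) := by gcongr
        _ ≤ _ := by
            gcongr
            have : 0 < A2 / c2 := by positivity
            linarith
  · have hd2' : d ≤ 2 := by omega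
    have hd3 : (d : ℝ) ≤ 2 := by exact_mod_cast hd2'
    have hdec : (decayExp d : ℝ) = 2 := by
      have : decayExp d = 2 := by unfold decayExp; omega
      exact_mod_cast this
    obtain ⟨A1, hA1, I1⟩ := exists_intLE_polyKernel hp0 hm1 hr hq hβ₀
    obtain ⟨c1, hc1, L1⟩ := exists_le_integral_gaussKernel hp0 hκ hβ₀
    refine ⟨A1 / c1, c1 * M ^ (p - 3 / 2), by positivity, by positivity,
      fun X e hX he heM hcase => ?_⟩
    have hX0 : 0 < X := by linarith
    have hβ : β₀ ≤ X * e := hcase.resolve_left hd2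
    have l := L1 _ hβ (hint _ (by positivity))
    refine ⟨(I1 _ hβ).mono ?_, le_trans ?_ l⟩
    · calc A1 * (X * e) ^ (p - 3 / 2) = A1 / c1 * (c1 * (X * e) ^ (p - 3 / 2)) := by field_simp
        _ ≤ A1 / c1 * G (X * e) := by gcongr
    · rw [mul_assoc]
      gcongr
      calc M ^ (p - 3 / 2) * X ^ ((d : ℝ) - 1 - decayExp d)
          ≤ M ^ (p - 3 / 2) * X ^ (p - 3 / 2) := by
            refine mul_le_mul_of_nonneg_left (Real.rpow_le_rpow_of_exponent_le hX ?_) (by positivity)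
            rw [hdec, hp]; linarith
        _ = (X * M) ^ (p - 3 / 2) := by rw [Real.mul_rpow hX0.le hM.le, mul_comm]
        _ ≤ (X * e) ^ (p - 3 / 2) :=
            Real.rpow_le_rpow_of_nonpos (by positivity) (by gcongr) (by linarith)

end Comparison

/-! ### Comparison of the two-point function with the Brownian Green function -/

section GreenComparison

variable {d : ℕ} {M K ζ β₀ : ℝ}

theorem norm_sub_smul_of_eq {x η : Euc d} (hx : x ≠ 0) (h : η = (‖η‖ / ‖x‖) • x) (s : ℝ) :
    ‖x - s • η‖ = |‖x‖ - s * ‖η‖| := by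
  have hxp : 0 < ‖x‖ := norm_pos_iff.2 hx
  have h1 : x - s • η = (1 - s * (‖η‖ / ‖x‖)) • x := by
    conv_lhs => rw [h]
    module
  rw [h1, norm_smul, Real.norm_eq_abs]
  conv_lhs => rw [← abs_of_pos hxp]
  rw [← abs_mul, abs_of_pos hxp]
  congr 1
  field_simp

theorem measurable_heatKernel (x η : Euc d) (Λ : Matrix (Fin d) (Fin d) ℝ) :
    Measurable fun t => heatKernel t x η Λ := by
  have : Continuous fun t : ℝ =>
      ((x - t • η).ofLp ⬝ᵥ (Matrix.mulVec Λ⁻¹ (x - t • η).ofLp)) := by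
    fun_prop
  unfold heatKernel
  have := this.measurable
  fun_prop

theorem heatKernel_le_gaussKernel {a b : ℝ} {Λ : Matrix (Fin d) (Fin d) ℝ} (h : Elliptic a b Λ)
    (ha : 0 < a) {t : ℝ} (ht : 0 < t) {x η : Euc d} (hx : x ≠ 0) (hη : η = (‖η‖ / ‖x‖) • x) :
    heatKernel t x η Λ ≤ (Real.sqrt (a ^ d))⁻¹ * gaussKernel (d / 2) (2 * b)⁻¹ ‖x‖ ‖η‖ t := by
  have := heatKernel_le h ha ht x η
  rwa [norm_sub_smul_of_eq hx hη, mul_assoc] at this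

theorem gaussKernel_le_heatKernel {a b : ℝ} {Λ : Matrix (Fin d) (Fin d) ℝ} (h : Elliptic a b Λ)
    (ha : 0 < a) {t : ℝ} (ht : 0 < t) {x η : Euc d} (hx : x ≠ 0) (hη : η = (‖η‖ / ‖x‖) • x) :
    (Real.sqrt (b ^ d))⁻¹ * (2 * Real.pi) ^ (-((d : ℝ) / 2)) *
      gaussKernel (d / 2) (2 * a)⁻¹ ‖x‖ ‖η‖ t ≤ heatKernel t x η Λ := by
  have := le_heatKernel h ha ht x η
  rwa [norm_sub_smul_of_eq hx hη, mul_assoc] at this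

theorem integrableOn_heatKernel (hd : 1 ≤ d) {a b : ℝ} {Λ : Matrix (Fin d) (Fin d) ℝ}
    (h : Elliptic a b Λ) (ha : 0 < a) (hb : 0 < b) {x η : Euc d} (hx : x ≠ 0) (hη0 : η ≠ 0)
    (hη : η = (‖η‖ / ‖x‖) • x) : IntegrableOn (fun t => heatKernel t x η Λ) (Ioi 0) := by
  refine Integrable.mono' ((integrableOn_gaussKernel hd (κ := (2 * b)⁻¹) (by positivity)
    (norm_pos_iff.2 hx) (norm_pos_iff.2 hη0)).const_mul ((Real.sqrt (a ^ d))⁻¹))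
    (measurable_heatKernel x η Λ).aestronglyMeasurable
    ((ae_restrict_iff' measurableSet_Ioi).2 (Filter.Eventually.of_forall fun t ht => ?_))
  rw [Real.norm_of_nonneg (heatKernel_pos h ha ht x η).le]
  exact heatKernel_le_gaussKernel h ha ht hx hη

/-- Up to constants, the kernel at times `s ≥ 1` lives on the scale `√s`. -/
theorem le_polyKernel_of_one_le {C D X e s : ℝ} (hC : 0 ≤ C) (hD : 0 ≤ D) (hs : 1 ≤ s) {m : ℕ}
    (h : D * (1 + |X - s * e| / Real.sqrt (1 + s)) ^ m ≤ C * (Real.sqrt (1 + s))⁻¹ ^ d) :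
    D ≤ C * 2 ^ m * polyKernel (d / 2) m X e s := by
  have hs0 : 0 < s := by linarith
  have hr : 0 < Real.sqrt s := Real.sqrt_pos.2 hs0
  have hL : 0 < Real.sqrt (1 + s) := Real.sqrt_pos.2 (by linarith)
  have h1 : Real.sqrt s ≤ Real.sqrt (1 + s) := Real.sqrt_le_sqrt (by linarith)
  have h2 : Real.sqrt (1 + s) ≤ 2 * Real.sqrt s := by
    rw [Real.sqrt_le_left (by positivity), mul_pow, Real.sq_sqrt hs0.le]; linarith
  set v := |X - s * e| with hv
  have hv0 : 0 ≤ v := abs_nonneg _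
  have h3 : (1 + v / Real.sqrt s) / 2 ≤ 1 + v / Real.sqrt (1 + s) := by
    have : v / (2 * Real.sqrt s) ≤ v / Real.sqrt (1 + s) := by gcongr
    have e1 : v / (2 * Real.sqrt s) = v / Real.sqrt s / 2 := by field_simp
    linarith
  have h4 : (Real.sqrt s)⁻¹ ^ d = s ^ (-((d : ℝ) / 2)) := by
    rw [Real.sqrt_eq_rpow, ← Real.rpow_neg hs0.le, ← Real.rpow_natCast, ← Real.rpow_mul hs0.le]
    congr 1; ring
  have h5 : D * ((1 + v / Real.sqrt s) / 2) ^ m ≤ C * s ^ (-((d : ℝ) / 2)) := by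
    calc _ ≤ D * (1 + v / Real.sqrt (1 + s)) ^ m := by gcongr
      _ ≤ _ := h
      _ ≤ C * (Real.sqrt s)⁻¹ ^ d := by gcongr
      _ = _ := by rw [h4]
  unfold polyKernel
  rw [Real.rpow_neg (x := 1 + v / Real.sqrt s) (by positivity), Real.rpow_natCast]
  rw [div_pow, ← mul_div_assoc, div_le_iff₀ (by positivity)] at h5
  rw [← mul_assoc, ← div_eq_mul_inv, le_div_iff₀ (by positivity)]
  linarith

/-- Interpolation of a diffusive bound with decay and a uniform bound that is better in time. The
uniform bound gets the exponent `1/(2m)`, so that half a power of decay is given up. -/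
theorem le_polyKernel_of_interpolate {p X e s D B C z m : ℝ} (hD : 0 ≤ D) (hB : 0 < B)
    (hC : 0 < C) (hs : 0 < s) (hm : 1 ≤ m) (h1 : D ≤ B * polyKernel p m X e s)
    (h2 : D ≤ C * (s ^ (-p) * s ^ (-(z / 2)))) :
    D ≤ B ^ (1 - 1 / (2 * m)) * C ^ (1 / (2 * m)) *
      (s ^ (-(z / (4 * m))) * polyKernel p (m - 1 / 2) X e s) := by
  set θ : ℝ := 1 / (2 * m) with hθ
  have hm0 : 0 < m := by linarith
  have hθ0 : 0 < θ := by positivity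
  have hθ1 : 0 < 1 - θ := by
    have : θ ≤ 1 / 2 := by
      rw [hθ]; exact one_div_le_one_div_of_le (by norm_num) (by linarith)
    linarith
  have hu : 0 < 1 + |X - s * e| / Real.sqrt s := by positivity
  have e1 : D = D ^ (1 - θ) * D ^ θ := by
    rw [← Real.rpow_add_of_nonneg hD hθ1.le hθ0.le]; simp
  calc D = D ^ (1 - θ) * D ^ θ := e1
    _ ≤ (B * polyKernel p m X e s) ^ (1 - θ) * (C * (s ^ (-p) * s ^ (-(z / 2)))) ^ θ := by
        have := Real.rpow_nonneg (mul_nonneg hB.le (polyKernel_nonneg p m X e hs.le)) (1 - θ)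
        gcongr
    _ = _ := by
        unfold polyKernel
        rw [Real.mul_rpow hB.le (by positivity), Real.mul_rpow (by positivity) (by positivity),
          Real.mul_rpow hC.le (by positivity), Real.mul_rpow (by positivity) (by positivity),
          ← Real.rpow_mul hs.le, ← Real.rpow_mul hs.le, ← Real.rpow_mul hs.le,
          ← Real.rpow_mul hu.le]
        have e2 : -m * (1 - θ) = -(m - 1 / 2) := by rw [hθ]; field_simp
        have e3 : -(z / 2) * θ = -(z / (4 * m)) := by rw [hθ]; field_simp; norm_num
        have e4 : s ^ (-p) = s ^ (-p * (1 - θ)) * s ^ (-p * θ) := by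
          rw [← Real.rpow_add hs]; congr 1; ring
        rw [e2, e3, e4]; ring

/-- Times up to `T ≤ X / (2e)`, when the particle is still far from its target. -/
theorem polyKernel_le_of_early (hd : 1 ≤ d) {X e s T : ℝ} (hX : 0 < X) (hs : 0 < s) (hsT : s ≤ T)
    (hT : 1 ≤ T) (hv : X / 2 ≤ |X - s * e|) :
    polyKernel (d / 2) (decayExp d) X e s ≤ (2 / X) ^ decayExp d * (T * s ^ (-(1 / 2) : ℝ)) := by
  have h1 := one_add_div_sqrt_rpow_neg_le hs (Nat.cast_nonneg (decayExp d))
    (by positivity : 0 < X / 2) hv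
  have h2 := sub_one_le_decayExp d
  have h3 := decayExp_le d hd
  set a : ℝ := ((decayExp d : ℝ) - d + 1) / 2 with ha
  have e1 : (X / 2) ^ (-(decayExp d : ℝ)) = (2 / X) ^ decayExp d := by
    rw [Real.rpow_neg (by positivity), Real.rpow_natCast, ← inv_pow, inv_div]
  have e2 : s ^ (-((d : ℝ) / 2)) * s ^ ((decayExp d : ℝ) / 2) = s ^ a * s ^ (-(1 / 2) : ℝ) := by
    rw [← Real.rpow_add hs, ← Real.rpow_add hs]; congr 1; rw [ha]; ring
  have e3 : s ^ a ≤ T := by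
    calc s ^ a ≤ T ^ a := by
          refine Real.rpow_le_rpow hs.le hsT ?_
          rw [ha]; linarith
      _ ≤ T ^ (1 : ℝ) := Real.rpow_le_rpow_of_exponent_le hT (by rw [ha]; linarith)
      _ = T := Real.rpow_one T
  calc polyKernel (d / 2) (decayExp d) X e s
      ≤ s ^ (-((d : ℝ) / 2)) * ((X / 2) ^ (-(decayExp d : ℝ)) * s ^ ((decayExp d : ℝ) / 2)) :=
        mul_le_mul_of_nonneg_left h1 (by positivity)
    _ = (2 / X) ^ decayExp d * (s ^ (-((d : ℝ) / 2)) * s ^ ((decayExp d : ℝ) / 2)) := by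
        rw [e1]; ring
    _ ≤ _ := by rw [e2]; gcongr

/-- The early-time bound for the kernels of the semigroup, whose diffusive scale is `√(1+s)`. -/
theorem le_of_early (hd : 1 ≤ d) {C D X e s T : ℝ} (hC : 0 ≤ C) (hX : 0 < X) (hs : 0 < s)
    (hsT : s ≤ T) (hT : 1 ≤ T) (hv : X / 2 ≤ |X - s * e|) (hD : 0 ≤ D)
    (h : D * (1 + |X - s * e| / Real.sqrt (1 + s)) ^ decayExp d ≤
      C * (Real.sqrt (1 + s))⁻¹ ^ d) :
    D ≤ 2 * C * ((2 / X) ^ decayExp d * (T * s ^ (-(1 / 2) : ℝ))) := by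
  set L := Real.sqrt (1 + s) with hL
  have hL1 : 1 ≤ L := Real.one_le_sqrt.2 (by linarith)
  have hL0 : 0 < L := by linarith
  have h1 : X / 2 / L ≤ 1 + |X - s * e| / L := by
    have : X / 2 / L ≤ |X - s * e| / L := by gcongr
    linarith
  have h2 : D * (X / 2 / L) ^ decayExp d ≤ C * L⁻¹ ^ d := by
    refine le_trans ?_ h
    gcongr
  have hle : decayExp d ≤ d + 1 := by unfold decayExp; omega
  have h3 : D ≤ C * ((2 / X) ^ decayExp d * L) := by
    have e1 : (X / 2 / L) ^ decayExp d * ((2 / X) ^ decayExp d * L ^ decayExp d) = 1 := by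
      rw [← mul_pow, ← mul_pow]
      have : X / 2 / L * (2 / X * L) = 1 := by field_simp
      rw [this, one_pow]
    have e2 : L⁻¹ ^ d * L ^ decayExp d ≤ L := by
      calc L⁻¹ ^ d * L ^ decayExp d ≤ L⁻¹ ^ d * L ^ (d + 1) := by gcongr
        _ = L := by rw [pow_succ, ← mul_assoc, ← mul_pow, inv_mul_cancel₀ hL0.ne', one_pow, one_mul]
    calc D = D * (X / 2 / L) ^ decayExp d * ((2 / X) ^ decayExp d * L ^ decayExp d) := by
          rw [mul_assoc, e1, mul_one]
      _ ≤ C * L⁻¹ ^ d * ((2 / X) ^ decayExp d * L ^ decayExp d) := by gcongr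
      _ = C * ((2 / X) ^ decayExp d * (L⁻¹ ^ d * L ^ decayExp d)) := by ring
      _ ≤ _ := by gcongr
  have h4 : L ≤ 2 * (T * s ^ (-(1 / 2) : ℝ)) := by
    rw [Real.rpow_neg hs.le, ← Real.sqrt_eq_rpow]
    have hr : 0 < Real.sqrt s := Real.sqrt_pos.2 hs
    rw [← div_eq_mul_inv, ← mul_div_assoc, le_div_iff₀ hr, hL, ← Real.sqrt_mul (by linarith),
      Real.sqrt_le_left (by positivity)]
    nlinarith
  calc D ≤ C * ((2 / X) ^ decayExp d * L) := h3
    _ ≤ C * ((2 / X) ^ decayExp d * (2 * (T * s ^ (-(1 / 2) : ℝ)))) := by gcongr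
    _ = _ := by ring

/-- The contribution of times up to `√X` is `X^{-m + 3/4}`, smaller by a factor `X^{-1/4}` than the
lower bound `X^{1-m}` for the Gaussian time integral. -/
theorem intLE_early {D : ℝ → ℝ} (hDm : Measurable D) (hD0 : ∀ s, 0 ≤ D s) {B X G c ε : ℝ} {m : ℕ}
    (hB : 0 ≤ B) (hX : 1 ≤ X) (hc : 0 < c) (hε : ε ≤ 1 / 4)
    (hb : ∀ s ∈ Ioc 0 (Real.sqrt X),
      D s ≤ B * ((2 / X) ^ m * (Real.sqrt X * s ^ (-(1 / 2) : ℝ))))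
    (hG : c * X ^ (1 - (m : ℝ)) ≤ G) :
    IntLE D (Ioc 0 (Real.sqrt X)) (B * 2 ^ m * 2 / c * (X ^ (-ε) * G)) := by
  have hX0 : 0 < X := by linarith
  set T := Real.sqrt X with hT
  have hT0 : 0 < T := Real.sqrt_pos.2 hX0
  have h1 := (intLE_rpow_Ioc (r := -(1 / 2)) (b := T) (by norm_num) hT0.le).const_mul
    (c := B * ((2 / X) ^ m * T)) (by positivity)
  refine (h1.of_le measurableSet_Ioc hDm (fun s _ => hD0 s) fun s hs =>
    (hb s hs).trans_eq (by ring)).mono ?_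
  have e1 : T * T ^ (-(1 / 2) + 1 : ℝ) = X ^ (3 / 4 : ℝ) := by
    nth_rewrite 1 [← Real.rpow_one T]
    rw [← Real.rpow_add hT0, hT, Real.sqrt_eq_rpow, ← Real.rpow_mul hX0.le]
    norm_num
  have e2 : (2 / X) ^ m = 2 ^ m * X ^ (-(m : ℝ)) := by
    rw [div_pow, Real.rpow_neg hX0.le, Real.rpow_natCast, div_eq_mul_inv]
  have e3 : X ^ (-(m : ℝ)) * X ^ (3 / 4 : ℝ) ≤ X ^ (-ε) * (c⁻¹ * G) := by
    calc X ^ (-(m : ℝ)) * X ^ (3 / 4 : ℝ) = X ^ (-(1 / 4) : ℝ) * X ^ (1 - (m : ℝ)) := by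
          rw [← Real.rpow_add hX0, ← Real.rpow_add hX0]; congr 1; ring
      _ ≤ X ^ (-ε) * (c⁻¹ * G) := by
          refine mul_le_mul (Real.rpow_le_rpow_of_exponent_le hX (by linarith)) ?_
            (by positivity) (by positivity)
          rw [le_inv_mul_iff₀ hc]; exact hG
  calc _ = B * 2 ^ m * 2 * (X ^ (-(m : ℝ)) * X ^ (3 / 4 : ℝ)) := by
        rw [← e1, e2]; norm_num; ring
    _ ≤ B * 2 ^ m * 2 * (X ^ (-ε) * (c⁻¹ * G)) := by gcongr
    _ = _ := by ring

/-- After time `√X` the interpolated bound gains `s^{-z/(4m)} ≤ X^{-z/(8m)}` over a kernel with decay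
exponent `m - 1/2`, whose time integral is `A`. -/
theorem intLE_late {D : ℝ → ℝ} (hDm : Measurable D) (hD0 : ∀ s, 0 ≤ D s)
    {p m X e z A B C : ℝ} (hX : 1 ≤ X) (hm : 1 ≤ m) (hz : 0 ≤ z) (hB : 0 < B) (hC : 0 < C)
    (h1 : ∀ s, 1 ≤ s → D s ≤ B * polyKernel p m X e s)
    (h2 : ∀ s, 0 < s → D s ≤ C * (s ^ (-p) * s ^ (-(z / 2))))
    (hpoly : IntLE (polyKernel p (m - 1 / 2) X e) (Ioi 0) A) :
    IntLE D (Ioi (Real.sqrt X))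
      (B ^ (1 - 1 / (2 * m)) * C ^ (1 / (2 * m)) * X ^ (-(z / (8 * m))) * A) := by
  have hX0 : 0 < X := by linarith
  have hm0 : 0 < m := by linarith
  set T := Real.sqrt X with hT
  have hT1 : 1 ≤ T := Real.one_le_sqrt.2 hX
  have hT0 : 0 < T := by linarith
  have h3 : IntLE (polyKernel p (m - 1 / 2) X e) (Ioi T) A := by
    refine ⟨hpoly.1.mono_set (Ioi_subset_Ioi hT0.le), le_trans ?_ hpoly.2⟩
    exact setIntegral_mono_set hpoly.1
      ((ae_restrict_iff' measurableSet_Ioi).2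
        (Filter.Eventually.of_forall fun s hs => polyKernel_nonneg _ _ _ _ (le_of_lt hs)))
      (Filter.Eventually.of_forall (Ioi_subset_Ioi hT0.le))
  refine (h3.const_mul (by positivity)).of_le measurableSet_Ioi hDm (fun s _ => hD0 s) fun s hs => ?_
  have hs1 : 1 ≤ s := hT1.trans (le_of_lt hs)
  have hs0 : 0 < s := by linarith
  refine (le_polyKernel_of_interpolate (hD0 s) hB hC hs0 hm (h1 s hs1) (h2 s hs0)).trans ?_
  rw [mul_assoc (_ * _) (X ^ _)]
  refine mul_le_mul_of_nonneg_left (mul_le_mul_of_nonneg_right ?_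
    (polyKernel_nonneg _ _ _ _ hs0.le)) (by positivity)
  calc s ^ (-(z / (4 * m))) ≤ T ^ (-(z / (4 * m))) :=
        Real.rpow_le_rpow_of_nonpos hT0 (le_of_lt hs) (by
          have : 0 ≤ z / (4 * m) := by positivity
          linarith)
    _ = X ^ (-(z / (8 * m))) := by
        rw [hT, Real.sqrt_eq_rpow, ← Real.rpow_mul hX0.le]
        congr 1; field_simp; ring

/-- The time integral of the kernels differs from the Brownian Green function, which is the time
integral of the heat kernels, by a relative error of order `|x|^{-ε}`. Times below `|x|^{1/2}` are
negligible for both, because the target is out of reach; at later times the local limit theorem is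
interpolated with the decay of the kernels. -/
theorem exists_norm_integral_semiKernel_sub_le (hd : 1 ≤ d) (hM : 0 < M) (hK : 0 < K) (hζ : 0 < ζ)
    (hβ₀ : 0 < β₀) : ∃ A R : ℝ, ∀ Q g : Lat d → ℝ, InQ M K ζ Q g → ∑' y, Q y = 1 →
      ∀ x : Lat d, x ≠ 0 → drift Q ≠ 0 → ‖drift Q‖ ≤ M →
        drift Q = (‖drift Q‖ / ‖emb x‖) • emb x → R ≤ ‖emb x‖ →
        (2 < d ∨ β₀ ≤ ‖emb x‖ * ‖drift Q‖) →
        IntegrableOn (fun s => semiKernel Q g s x) (Ioi 0) →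
        0 < brownianGreen (emb x) (drift Q) (covMatrix Q) ∧
        ‖(∫ s in Ioi (0 : ℝ), semiKernel Q g s x) -
          (((∑' y, g y) * brownianGreen (emb x) (drift Q) (covMatrix Q) : ℝ) : ℂ)‖ ≤
          A * (‖emb x‖ ^ (-(min ζ 1 / (8 * decayExp d))) *
            brownianGreen (emb x) (drift Q) (covMatrix Q)) := by
  set z := min ζ 1 with hz
  have hz0 : 0 < z := lt_min hζ one_pos
  have hz1 : z ≤ 1 := min_le_right _ _
  set m := decayExp d with hm
  have hm2 : (2 : ℝ) ≤ m := two_le_decayExp_cast d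
  obtain ⟨C1, hC1, hker⟩ := norm_semiKernel_le hd hM hK hζ
  obtain ⟨C2, hC2, hlim⟩ := norm_semiKernel_sub_le (d := d) hM hK hζ
  obtain ⟨C3, hC3, hgp⟩ := gaussKernel_le (κ := (2 * M)⁻¹) (by positivity) m
  obtain ⟨A, c, hA, hc, hcmp⟩ := exists_intLE_integral_gaussKernel (κ := (2 * (2 * K))⁻¹) hd
    (by positivity) hM hβ₀
  set H := (Real.sqrt ((2 * K) ^ d))⁻¹ * C3 with hH
  set c2 := (Real.sqrt (M ^ d))⁻¹ * (2 * Real.pi) ^ (-((d : ℝ) / 2)) with hc2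
  have hH0 : 0 < H := by positivity
  have hc20 : 0 < c2 := by positivity
  set B1 := C1 * 2 ^ m + M * H with hB1
  have hB10 : 0 < B1 := by positivity
  set B2 := B1 ^ (1 - 1 / (2 * (m : ℝ))) * C2 ^ (1 / (2 * (m : ℝ))) with hB2
  have hB20 : 0 < B2 := by positivity
  set B3 := (2 * C1 + M * H) * 2 ^ m * 2 with hB3
  have hB30 : 0 < B3 := by positivity
  refine ⟨(B3 / c + B2 * A) / c2, max 1 (4 * M ^ 2), fun Q g hQ hψ x hx hη0 hηM hpar hR hcase hqi => ?_⟩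
  have hx' : emb x ≠ 0 := emb_ne_zero hx
  set X := ‖emb x‖ with hXdef
  set e := ‖drift Q‖ with hedef
  have he0 : 0 < e := norm_pos_iff.2 hη0
  have hX1 : 1 ≤ X := (le_max_left _ _).trans hR
  have hX0 : 0 < X := by linarith
  have hXM : 4 * M ^ 2 ≤ X := (le_max_right _ _).trans hR
  have hell := hQ.elliptic hM hζ
  have h2K : 0 < 2 * K := by positivity
  set hk : ℝ → ℝ := fun s => heatKernel s (emb x) (drift Q) (covMatrix Q) with hhk
  set G := ∫ s in Ioi (0 : ℝ), gaussKernel (d / 2) (2 * (2 * K))⁻¹ X e s with hG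
  obtain ⟨hpoly, hGlow⟩ := hcmp X e hX1 he0 hηM hcase
  have hG0 : 0 < G := lt_of_lt_of_le (by positivity) hGlow
  have hhki : IntegrableOn hk (Ioi 0) := integrableOn_heatKernel hd hell h2K hM hx' hη0 hpar
  have hGC : c2 * G ≤ brownianGreen (emb x) (drift Q) (covMatrix Q) := by
    rw [hG, ← integral_const_mul]
    exact setIntegral_mono_on ((integrableOn_gaussKernel hd (by positivity) hX0 he0).const_mul _)
      hhki measurableSet_Ioi fun s hs => gaussKernel_le_heatKernel hell h2K hs hx' hpar
  have hC0 : 0 < brownianGreen (emb x) (drift Q) (covMatrix Q) :=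
    lt_of_lt_of_le (by positivity) hGC
  refine ⟨hC0, ?_⟩
  set Cg := brownianGreen (emb x) (drift Q) (covMatrix Q) with hCg
  set a := ∑' y, g y with ha
  have haM : |a| ≤ M := by
    have h1 := hQ.sum_g hM
    refine le_trans ?_ h1.2
    rw [← Real.norm_eq_abs]
    exact norm_tsum_le_tsum_norm h1.1
  set D : ℝ → ℝ := fun s => ‖semiKernel Q g s x - ((a * hk s : ℝ) : ℂ)‖ with hD
  have hDm : Measurable D := by
    have h1 := (continuous_semiKernel (summable_abs_iff.1 (hQ.sum_Q hM).1)
      (summable_abs_iff.1 (hQ.sum_g hM).1) x).measurable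
    have h2 : Measurable hk := measurable_heatKernel _ _ _
    exact (h1.sub (Complex.measurable_ofReal.comp (h2.const_mul a))).norm
  have hD0 : ∀ s, 0 ≤ D s := fun s => norm_nonneg _
  have hhk0 : ∀ s, 0 < s → |a * hk s| ≤ M * H * polyKernel (d / 2) m X e s := by
    intro s hs
    have hpos := heatKernel_pos hell h2K hs (emb x) (drift Q)
    rw [abs_mul, abs_of_pos hpos]
    calc |a| * hk s ≤ M * ((Real.sqrt ((2 * K) ^ d))⁻¹ *
          (C3 * polyKernel (d / 2) m X e s)) := by
          gcongr
          exact (heatKernel_le_gaussKernel hell h2K hs hx' hpar).trans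
            (mul_le_mul_of_nonneg_left (hgp _ _ _ _ hs) (by positivity))
      _ = _ := by rw [hH]; ring
  have hDle : ∀ s, 0 < s → D s ≤ ‖semiKernel Q g s x‖ + |a * hk s| := fun s _ => by
    refine (norm_sub_le _ _).trans_eq ?_
    rw [Complex.norm_real, Real.norm_eq_abs]
  have hq : ∀ s, 0 < s → ‖semiKernel Q g s x‖ * (1 + |X - s * e| / Real.sqrt (1 + s)) ^ m ≤
      C1 * (Real.sqrt (1 + s))⁻¹ ^ d := fun s hs => by
    have := hker Q g hQ hψ.le s hs x
    rwa [norm_sub_smul_of_eq hx' hpar] at this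
  set T := Real.sqrt X with hT
  have hT1 : 1 ≤ T := Real.one_le_sqrt.2 hX1
  have hT0 : 0 < T := by linarith
  have hTX : T * T = X := Real.mul_self_sqrt hX0.le
  have hTM : 2 * M ≤ T := by
    rw [hT]
    refine Real.le_sqrt_of_sq_le ?_
    linarith only [hXM]
  set ε := z / (8 * m) with hε
  have hε4 : ε ≤ 1 / 4 := by
    rw [hε, div_le_div_iff₀ (by positivity) (by norm_num)]
    linarith only [hz1, hm2]
  have hearly : IntLE D (Ioc 0 T) (B3 / c * (X ^ (-ε) * G)) := by
    refine intLE_early hDm hD0 (by positivity) hX1 hc hε4 (fun s hs => ?_) hGlow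
    have hv : X / 2 ≤ |X - s * e| := by
      have h2 : s * e ≤ X / 2 := by
        have h3 : s * e ≤ T * M := mul_le_mul hs.2 hηM he0.le hT0.le
        have h4 := mul_le_mul_of_nonneg_left hTM hT0.le
        linarith only [h3, h4, hTX]
      exact le_trans (by linarith) (le_abs_self _)
    have h2 := le_of_early hd hC1.le hX0 hs.1 hs.2 hT1 hv (norm_nonneg _) (hq s hs.1)
    have h3 := mul_le_mul_of_nonneg_left (polyKernel_le_of_early hd hX0 hs.1 hs.2 hT1 hv)
      (by positivity : 0 ≤ M * H)
    rw [add_mul]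
    exact (hDle s hs.1).trans (add_le_add h2 ((hhk0 s hs.1).trans h3))
  have hlate : IntLE D (Ioi T) (B2 * X ^ (-ε) * (A * G)) := by
    refine intLE_late hDm hD0 hX1 (by linarith) hz0.le hB10 hC2 (fun s hs => ?_)
      (fun s hs => hlim Q g hQ hψ s hs x) hpoly
    have hs0 : 0 < s := by linarith
    rw [hB1, add_mul]
    exact (hDle s hs0).trans (add_le_add
      (le_polyKernel_of_one_le hC1.le (norm_nonneg _) hs (hq s hs0)) (hhk0 s hs0))
  have hDint := hearly.union_Ioi hT0.le hlate
  have hsub : (∫ s in Ioi (0 : ℝ), semiKernel Q g s x) - ((a * Cg : ℝ) : ℂ) =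
      ∫ s in Ioi (0 : ℝ), (semiKernel Q g s x - ((a * hk s : ℝ) : ℂ)) := by
    have h1 : IntegrableOn (fun s => ((a * hk s : ℝ) : ℂ)) (Ioi 0) := (hhki.const_mul a).ofReal
    rw [integral_sub hqi h1, integral_complex_ofReal, integral_const_mul]
    rfl
  rw [hsub]
  refine (norm_integral_le_integral_norm _).trans (hDint.2.trans ?_)
  calc B3 / c * (X ^ (-ε) * G) + B2 * X ^ (-ε) * (A * G)
      = (B3 / c + B2 * A) / c2 * (X ^ (-ε) * (c2 * G)) := by field_simp
    _ ≤ _ := by gcongr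

end GreenComparison

/-! ### The crossover formula -/

section Crossover

variable {d : ℕ} [NeZero d] {M K ζ β₀ : ℝ}

theorem wellDefined (hM : 0 < M) (hK : 0 < K) (hζ : 0 < ζ) {S J h : Lat d → ℝ}
    (hA : AveragedDecay S) (hB : OZBounds M K ζ S J h) : WellDefined S J where
  mass_lub := hA.isLUB_mass
  mass_pos := hA.mass_pos
  tilt_unique x hx := by
    obtain ⟨μ, hμ⟩ := hA.exists_isOptimalTilt hx
    exact ⟨μ, hμ, fun ν hν => hν.unique hM hK hζ hA hB hx hμ⟩
  lambda_posDef x hx :=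
    ((hB.mem_Q _ (isOptimalTilt_optimalTilt hA hx).mem_closure).elliptic hM hζ).posDef
      (by positivity)
  green_finite x hx := by
    have hμ := isOptimalTilt_optimalTilt hA hx
    exact integrableOn_heatKernel NeZero.one_le ((hB.mem_Q _ hμ.mem_closure).elliptic hM hζ)
      (by positivity) hM hx (drift_ne_zero hM hK hζ hA hB hμ.1) (hμ.drift_eq hM hK hζ hA hB hx)

/-- The formula for all dimensions, under the condition that either `d ≥ 3` or the passage of the
Brownian path through `x` is visible on the diffusive scale. -/
theorem exists_crossoverAt (hM : 0 < M) (hK : 0 < K) (hζ : 0 < ζ) (hβ₀ : 0 < β₀) :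
    ∃ A R : ℝ, ∀ S J h : Lat d → ℝ, AveragedDecay S → OZBounds M K ζ S J h →
      ∀ x : Lat d, x ≠ 0 → R ≤ ‖emb x‖ →
        (2 < d ∨ β₀ ≤ ‖emb x‖ * ‖etaHat S J (emb x)‖) →
          CrossoverAt S J h A (min ζ 1 / (8 * decayExp d)) x := by
  obtain ⟨A, R, hmain⟩ := exists_norm_integral_semiKernel_sub_le (d := d) NeZero.one_le hM hK hζ hβ₀
  refine ⟨A, R, fun S J h hA hB x hx hR hcase => ?_⟩
  have hx' : emb x ≠ 0 := emb_ne_zero hx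
  have hμ := isOptimalTilt_optimalTilt hA hx'
  set μ := optimalTilt S (emb x) with hμdef
  have hQ := hB.mem_Q μ hμ.mem_closure
  obtain ⟨hint, hval⟩ := integral_semiKernel_of_mem_frontier hM hK hζ hA hB hμ.1 x
  obtain ⟨hC, hle⟩ := hmain _ _ hQ (tsum_J_eq_one hM hA hB hμ.1) x hx
    (drift_ne_zero hM hK hζ hA hB hμ.1) (hQ.norm_drift_le hM hζ)
    (hμ.drift_eq hM hK hζ hA hB hx') hR hcase hint
  have hη : etaHat S J (emb x) = drift (tilt J μ) := rfl
  have hΛ : lambdaHat S J (emb x) = covMatrix (tilt J μ) := rfl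
  set C := brownianGreen (emb x) (drift (tilt J μ)) (covMatrix (tilt J μ)) with hCdef
  rw [hval, ← Complex.ofReal_sub, Complex.norm_real, Real.norm_eq_abs] at hle
  refine ⟨tilt S μ x / C - ∑' y, tilt h μ y, ?_, ?_⟩
  · have h1 : tilt S μ x / C - ∑' y, tilt h μ y = (tilt S μ x - (∑' y, tilt h μ y) * C) / C := by
      field_simp
    rw [h1, abs_div, abs_of_pos hC, div_le_iff₀ hC, one_div, ← Real.rpow_neg (norm_nonneg _),
      mul_assoc]
    exact hle
  · rw [hη, hΛ, ← hCdef, mass_mul_normS hA hx', ← hμdef, latFourier_zero, Complex.ofReal_re,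
      add_sub_cancel, mul_assoc, mul_comm (Real.exp _), ← mul_assoc, mul_div_cancel₀ _ hC.ne', tilt,
      mul_assoc, ← Real.exp_add, add_neg_cancel, Real.exp_zero, mul_one]

/-- A lower bound on `m_S |x|` is one on `|x| |η|`, as the boundary points of `Ω` have norm at least
`m_S / d` and the drift is at least `K` times the tilt. -/
theorem mul_mass_mul_norm_le (hM : 0 < M) (hK : 0 < K) (hζ : 0 < ζ) {S J h : Lat d → ℝ}
    (hA : AveragedDecay S) (hB : OZBounds M K ζ S J h) {x : Euc d} (hx : x ≠ 0) :
    K * (mass S * ‖x‖) / d ≤ ‖x‖ * ‖etaHat S J x‖ := by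
  have hμ := isOptimalTilt_optimalTilt hA hx
  have hd : (0 : ℝ) < d := by exact_mod_cast Nat.pos_of_ne_zero (NeZero.ne d)
  have h1 := hA.mass_le_norm (hA.mem_frontier_iff.1 hμ.1).2
  have h2 : K * ‖optimalTilt S x‖ ≤ ‖etaHat S J x‖ := mul_norm_le_norm_drift hM hK hζ hA hB hμ.1
  rw [div_le_iff₀ hd]
  calc K * (mass S * ‖x‖) ≤ K * (d * ‖optimalTilt S x‖ * ‖x‖) := by gcongr
    _ = ‖x‖ * (K * ‖optimalTilt S x‖) * d := by ring
    _ ≤ _ := by gcongr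

end Crossover

end OrnsteinZernike

open OrnsteinZernike in
theorem theorem1p5 (d : ℕ) [NeZero d] (M K ζ : ℝ) (hM : 0 < M) (hK : 0 < K) (hζ : 0 < ζ) :
    (∀ S J h : Lat d → ℝ, AveragedDecay S → OZBounds M K ζ S J h → WellDefined S J) ∧
    ∃ ε : ℝ, 0 < ε ∧
      (2 < d → ∃ A R : ℝ, ∀ S J h : Lat d → ℝ, AveragedDecay S → OZBounds M K ζ S J h →
        ∀ x : Lat d, x ≠ 0 → R ≤ ‖emb x‖ → CrossoverAt S J h A ε x) ∧
      (d ≤ 2 → ∀ s₀ : ℝ, 0 < s₀ → ∃ A R : ℝ, ∀ S J h : Lat d → ℝ,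
        AveragedDecay S → OZBounds M K ζ S J h →
        ∀ x : Lat d, x ≠ 0 → R ≤ ‖emb x‖ → s₀ ≤ mass S * ‖emb x‖ →
          CrossoverAt S J h A ε x) := by
  refine ⟨fun S J h hA hB => wellDefined hM hK hζ hA hB, min ζ 1 / (8 * decayExp d), ?_, ?_, ?_⟩
  · have := two_le_decayExp_cast d
    have : 0 < min ζ 1 := lt_min hζ one_pos
    positivity
  · intro hd
    obtain ⟨A, R, H⟩ := exists_crossoverAt (d := d) hM hK hζ one_pos
    exact ⟨A, R, fun S J h hA hB x hx hR => H S J h hA hB x hx hR (Or.inl hd)⟩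
  · intro _ s₀ hs₀
    have hd : (0 : ℝ) < d := by exact_mod_cast Nat.pos_of_ne_zero (NeZero.ne d)
    obtain ⟨A, R, H⟩ := exists_crossoverAt (d := d) (β₀ := K * s₀ / d) hM hK hζ (by positivity)
    refine ⟨A, R, fun S J h hA hB x hx hR hs => H S J h hA hB x hx hR (Or.inr ?_)⟩
    refine le_trans ?_ (mul_mass_mul_norm_le hM hK hζ hA hB (emb_ne_zero hx))
    gcongr
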